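/- Write points of $\mathbb R^6$ as $z=(x,y)$ with $x,y\in\mathbb R^3$, and put $r_i=\frac12(x_i^2+y_i^2)$ for $i=1,2,3$. Let $\omega_0=(\omega_{0,1},\omega_{0,2},\omega_{0,3})\in\mathbb R^3$ and let $k\in\{1,2,3\}$. There exist a function $H\in C^\infty(\mathbb R^6)$ with $$H(z)=\langle\omega_0,r\rangle+O(|z|^3)\quad (z\to0),$$ whose Hamiltonian vector field $X_H=(\partial_yH,-\partial_xH)$ has a flow $\Phi^t_H$ defined for all $t\in\mathbb R$, and a strictly increasing sequence $(a_n)_{n\in\mathbb Z}$ of positive real numbers with $\lim_{n\to-\infty}a_n=0$ and $\lim_{n\to+\infty}a_n=+\infty$, such that the following hold. 1. The sets $\{r_k=a_n\}$, $n\in\mathbb Z$, and $\{r_i=0\}$, $i=1,2,3$, are foliated by invariant tori: every flat torus $\{r=c\}$ (of dimension equal to the number of nonzero $c_i$) contained in one of these sets is invariant under $\Phi_H^t$, and $\Phi_H^t$ acts on it by a linear flow, i.e. it rotates the planes $(x_i,y_i)$ by the angles $t\Omega_i$ for some $\Omega\in\mathbb R^3$ depending on the torus. 2. Every other orbit accumulates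 on the union of these sets or at infinity: if $z$ lies in none of these sets, then there are times $t_j\in\mathbb R$ such that either $\Phi_H^{t_j}(z)$ converges to a point of one of these sets, or $|\Phi_H^{t_j}(z)|\to\infty$. 3. The origin is not KAM-stable: it has a neighbourhood $U$ such that the union of the invariant Lagrangian tori contained in $U$ has Lebesgue measure zero. (Here an invariant Lagrangian torus is a Lagrangian embedded $3$-dimensional torus of class $C^1$, invariant under $\Phi_H^t$, on which the flow is conjugate, through the embedding, to a linear flow on $\mathbb T^3$.) 4. If $\omega_{0,i}\,\omega_{0,j}<0$, where $i,j$ are the two indices different from $k$, then $\Phi_H^t$ is diffusive: for every $A>0$ there are $p\in\mathbb R^6$ and $t_1,t_2\in\mathbb R$ with $|\Phi_H^{t_1}(p)|\le A^{-1}$ and $|\Phi_H^{t_2}(p)|\ge A$. In particular, if the coordinates of $\omega_0$ are not all of the same sign (two of them have a negative product), then, with $k$ the remaining index (so $k=3$ after a relabelling of the coordinates), $H$ can be chosen so that 1--3 hold and $\Phi_H^t$ is diffusive. -/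

import Mathlib

open Filter Topology MeasureTheory
open scoped ContDiff

noncomputable section

/-- The phase space `ℝ^{2d}`; `z (Sum.inl i) = x_i` and `z (Sum.inr i) = y_i`. -/
abbrev Phase (d : ℕ) : Type := EuclideanSpace ℝ (Fin d ⊕ Fin d)

/-- The actions `r_i = (x_i² + y_i²) / 2`. -/
def action {d : ℕ} (z : Phase d) (i : Fin d) : ℝ :=
  (z (Sum.inl i) ^ 2 + z (Sum.inr i) ^ 2) / 2

/-- `H(z) = ⟨ω₀, r⟩ + O(|z|³)` at the origin. -/
def IsEllipticWithFrequency {d : ℕ} (ω₀ : Fin d → ℝ) (H : Phase d → ℝ) : Prop :=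
  (fun z : Phase d => H z - ∑ i, ω₀ i * action z i) =O[𝓝 0] (fun z : Phase d => ‖z‖ ^ 3)

/-- The Hamiltonian vector field `X_H = (∂_y H, -∂_x H)`. -/
def hamVectorField {d : ℕ} (H : Phase d → ℝ) (z : Phase d) : Phase d :=
  WithLp.toLp 2 (Sum.elim
    (fun i => fderiv ℝ H z (EuclideanSpace.single (Sum.inr i) 1))
    (fun i => -fderiv ℝ H z (EuclideanSpace.single (Sum.inl i) 1)))

/-- `Φ` is the (globally defined) flow of the Hamiltonian vector field of `H`. -/
def IsHamiltonianFlow {d : ℕ} (H : Phase d → ℝ) (Φ : ℝ → Phase d → Phase d) : Prop :=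
  (∀ z, Φ 0 z = z) ∧
    ∀ z t, HasDerivAt (fun s => Φ s z) (hamVectorField H (Φ t z)) t

/-- The rotation by the angle `θ_i` in each plane `(x_i, y_i)`, in the sense in which the flow of
`⟨ω, r⟩` rotates: that flow is `t ↦ rotate (t • ω)`. -/
def rotate {d : ℕ} (θ : Fin d → ℝ) (z : Phase d) : Phase d :=
  WithLp.toLp 2 (Sum.elim
    (fun i => Real.cos (θ i) * z (Sum.inl i) + Real.sin (θ i) * z (Sum.inr i))
    (fun i => -Real.sin (θ i) * z (Sum.inl i) + Real.cos (θ i) * z (Sum.inr i)))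

/-- The flat torus `{r = r(z)}` through `z`; its dimension is the number of nonzero actions
of `z`. -/
def flatTorus {d : ℕ} (z : Phase d) : Set (Phase d) :=
  {w | ∀ i, action w i = action z i}

/-- `S` is a union of flat tori, each of which is invariant under `Φ`, with linear dynamics. -/
def FoliatedByInvariantTori {d : ℕ} (Φ : ℝ → Phase d → Phase d) (S : Set (Phase d)) : Prop :=
  ∀ z ∈ S, flatTorus z ⊆ S ∧
    ∃ Ω : Fin d → ℝ, ∀ w ∈ flatTorus z, ∀ t : ℝ, Φ t w = rotate (t • Ω) w

/-- The orbit of `z` accumulates on `S`. -/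
def AccumulatesOn {d : ℕ} (Φ : ℝ → Phase d → Phase d) (z : Phase d) (S : Set (Phase d)) : Prop :=
  ∃ w ∈ S, ∃ t : ℕ → ℝ, Tendsto (fun j => Φ (t j) z) atTop (𝓝 w)

/-- The orbit of `z` accumulates at infinity. -/
def AccumulatesAtInfinity {d : ℕ} (Φ : ℝ → Phase d → Phase d) (z : Phase d) : Prop :=
  ∃ t : ℕ → ℝ, Tendsto (fun j => ‖Φ (t j) z‖) atTop atTop

/-- There are orbits from arbitrarily close to the origin to arbitrarily far away. -/
def IsDiffusive {d : ℕ} (Φ : ℝ → Phase d → Phase d) : Prop :=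
  ∀ A : ℝ, 0 < A → ∃ (z : Phase d) (t₁ t₂ : ℝ), ‖Φ t₁ z‖ ≤ A⁻¹ ∧ A ≤ ‖Φ t₂ z‖

/-- The standard symplectic form `∑ dx_i ∧ dy_i`. -/
def symplecticForm {d : ℕ} (u v : Phase d) : ℝ :=
  ∑ i, (u (Sum.inl i) * v (Sum.inr i) - u (Sum.inr i) * v (Sum.inl i))

/-- `T` is an invariant Lagrangian (KAM) torus of `Φ`: an embedded `C¹` torus of dimension `d`,
parametrized by a map `φ` on `ℝ^d / (2πℤ)^d`, on which the symplectic form vanishes and on which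
the flow is conjugate by `φ` to a linear flow. -/
def IsInvariantLagrangianTorus {d : ℕ} (Φ : ℝ → Phase d → Phase d) (T : Set (Phase d)) : Prop :=
  ∃ (φ : EuclideanSpace ℝ (Fin d) → Phase d) (Ω : EuclideanSpace ℝ (Fin d)),
    ContDiff ℝ 1 φ ∧
    (∀ u v, φ u = φ v ↔ ∀ i, ∃ n : ℤ, v i = u i + 2 * Real.pi * n) ∧
    (∀ u, Function.Injective (fderiv ℝ φ u)) ∧
    (∀ u v w, symplecticForm (fderiv ℝ φ u v) (fderiv ℝ φ u w) = 0) ∧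
    (∀ t u, Φ t (φ u) = φ (u + t • Ω)) ∧
    T = Set.range φ

/-- The origin is accumulated by a positive measure set of invariant Lagrangian tori: in every
neighbourhood of the origin, the invariant Lagrangian tori that it contains fill a set of positive
(outer) Lebesgue measure. -/
def IsKAMStable {d : ℕ} (Φ : ℝ → Phase d → Phase d) : Prop :=
  ∀ U ∈ 𝓝 (0 : Phase d),
    0 < volume (⋃₀ {T : Set (Phase d) | IsInvariantLagrangianTorus Φ T ∧ T ⊆ U})

/-- The union of the sets `{r_i = 0}`, over all `i`, and `{r_k = a_n}`, over all `n`. -/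
def exceptionalSet {d : ℕ} (k : Fin d) (a : ℤ → ℝ) : Set (Phase d) :=
  {z | (∃ i, action z i = 0) ∨ ∃ n, action z k = a n}

end

/-! The Hamiltonian is a limit of integrable ones obtained by successive conjugation, in the manner
of Anosov and Katok. Let D be the set of actions that are all positive and have `r k` off the
levels. Each approximation is `h ∘ action ∘ G`, with `h` a function on action space and `G` a
symplectic diffeomorphism equal to the identity outside a compact part of D.

One step (`ZoneSystem.exists_step`). A small change of `h` makes its gradient orthogonal to an
integer vector κ on each of finitely many zones of action space. The monomial with character κ is
then invariant under the flow of `h` over the zone, so the Hamiltonian "function of the actions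
times real part of the monomial" has a motion commuting with that flow, and this motion displaces
the actions along κ. A symplectic Γ built from such motions (`exists_zone_map`,
`ZoneSystem.exists_resonant_map`) preserves `h` and commutes with its flow, so replacing `G` by Γ⁻¹
∘ G changes neither the Hamiltonian nor its flow, however far Γ is from the identity. A second
perturbation, small depending on Γ, breaks the resonances. Now the linear flow turns the phase of
the monomial, and each orbit in the treated zones reaches the phases where Γ pushes the actions out
of a given compact subset of D. By compactness this exit survives all sufficiently small later
changes.

The zones have to cover the connected pieces of D, hence overlap, whereas the maps can only be glued
over disjoint zones. They are numbered so that only consecutive ones meet, and even and odd zones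
are treated alternately; two consecutive steps reach every point (`ApproxSeq.exists_exit`).

Outside D every `G` is the identity, so the limit flow rotates each torus there. Inside D every
orbit leaves every compact subset, hence accumulates on the complement or at infinity. An invariant
torus with linear flow is recurrent and cannot contain such an orbit; it lies over the complement of
D, which is a null set.

If `ω₀ j ≠ 0`, the m-th zone uses directions with `κ i = 2 ^ m * κ k`, and `κ j` is fixed by the
resonance. If `ω₀ i * ω₀ j < 0`, then κ is nonnegative for large m. Near the origin `r i` can then
grow by 2^m times the room left to `r k` in its cell, which is unbounded in m; this yields diffusion
(`drift_resonantZones`). If `ω₀ i = ω₀ j = 0`, a single zone and a quadratic term in the actions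
suffice (`degenerateZones`). -/

noncomputable section

/-! ### Symplectic linear algebra, Hamiltonian vector fields, functions of the actions. -/

section Basics

variable {d : ℕ}

lemma phase_ext {u v : Phase d} (hx : ∀ i, u (Sum.inl i) = v (Sum.inl i))
    (hy : ∀ i, u (Sum.inr i) = v (Sum.inr i)) : u = v := by
  ext j
  rcases j with i | i
  · exact hx i
  · exact hy i

lemma hasDerivAt_phase {γ : ℝ → Phase d} {γ' : Phase d} {t : ℝ}
    (h : ∀ j, HasDerivAt (fun s => γ s j) (γ' j) t) : HasDerivAt γ γ' t := by
  have h1 : HasDerivAt (fun s => (fun j => γ s j : Fin d ⊕ Fin d → ℝ)) (fun j => γ' j) t :=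
    hasDerivAt_pi.2 h
  exact ((PiLp.continuousLinearEquiv 2 ℝ
    (fun _ : Fin d ⊕ Fin d => ℝ)).symm.hasFDerivAt.comp_hasDerivAt t h1)

lemma contDiff_action : ContDiff ℝ ∞ (fun z : Phase d => action z) := by
  refine contDiff_pi.2 fun i => ?_
  unfold action
  fun_prop

lemma continuous_action : Continuous (fun z : Phase d => action z) := contDiff_action.continuous

lemma action_nonneg (z : Phase d) (i : Fin d) : 0 ≤ action z i := by
  unfold action; positivity

lemma norm_sq_eq_sum_action (z : Phase d) : ‖z‖ ^ 2 = 2 * ∑ i, action z i := by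
  rw [EuclideanSpace.norm_sq_eq, Fintype.sum_sum_type, Finset.mul_sum, ← Finset.sum_add_distrib]
  refine Finset.sum_congr rfl fun i _ => ?_
  simp only [Real.norm_eq_abs, sq_abs, action]
  ring

/-- The partial derivatives of a function of the actions. -/
def grad (h : (Fin d → ℝ) → ℝ) (r : Fin d → ℝ) (i : Fin d) : ℝ :=
  fderiv ℝ h r (Pi.single i 1)

lemma fderiv_eq_sum_grad (h : (Fin d → ℝ) → ℝ) (r v : Fin d → ℝ) :
    fderiv ℝ h r v = ∑ i, v i * grad h r i := by
  conv_lhs => rw [pi_eq_sum_univ' v]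
  simp [grad, map_sum]

lemma continuous_grad {h : (Fin d → ℝ) → ℝ} (hh : ContDiff ℝ ∞ h) : Continuous (grad h) :=
  continuous_pi fun _ => (hh.continuous_fderiv (by simp)).clm_apply continuous_const

lemma symplecticForm_add_left (u u' v : Phase d) :
    symplecticForm (u + u') v = symplecticForm u v + symplecticForm u' v := by
  simp only [symplecticForm, PiLp.add_apply, ← Finset.sum_add_distrib]
  exact Finset.sum_congr rfl fun i _ => by ring

lemma symplecticForm_smul_left (c : ℝ) (u v : Phase d) :
    symplecticForm (c • u) v = c * symplecticForm u v := by
  simp only [symplecticForm, PiLp.smul_apply, smul_eq_mul, Finset.mul_sum]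
  exact Finset.sum_congr rfl fun i _ => by ring

lemma symplecticForm_swap (u v : Phase d) : symplecticForm u v = -symplecticForm v u := by
  simp only [symplecticForm, ← Finset.sum_neg_distrib]
  exact Finset.sum_congr rfl fun i _ => by ring

lemma symplecticForm_add_right (u v v' : Phase d) :
    symplecticForm u (v + v') = symplecticForm u v + symplecticForm u v' := by
  rw [symplecticForm_swap, symplecticForm_add_left, symplecticForm_swap v u,
    symplecticForm_swap v' u]
  ring

lemma symplecticForm_smul_right (c : ℝ) (u v : Phase d) :
    symplecticForm u (c • v) = c * symplecticForm u v := by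
  rw [symplecticForm_swap, symplecticForm_smul_left, symplecticForm_swap v u]
  ring

/-- The functional `u ↦ symplecticForm u v`. -/
def symplecticFunctional (v : Phase d) : Phase d →L[ℝ] ℝ :=
  LinearMap.toContinuousLinearMap
    { toFun := fun u => symplecticForm u v
      map_add' := fun u u' => symplecticForm_add_left u u' v
      map_smul' := fun c u => symplecticForm_smul_left c u v }

@[simp] lemma symplecticFunctional_apply (u v : Phase d) :
    symplecticFunctional v u = symplecticForm u v := rfl

lemma symplecticForm_single_inr (u : Phase d) (i : Fin d) :
    symplecticForm u (EuclideanSpace.single (Sum.inr i) 1) = u (Sum.inl i) := by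
  simp [symplecticForm]

lemma symplecticForm_single_inl (u : Phase d) (i : Fin d) :
    symplecticForm u (EuclideanSpace.single (Sum.inl i) 1) = -u (Sum.inr i) := by
  simp [symplecticForm]

lemma symplecticForm_nondegenerate {u u' : Phase d}
    (h : ∀ v, symplecticForm u v = symplecticForm u' v) : u = u' := by
  refine phase_ext (fun i => ?_) fun i => ?_
  · simpa [symplecticForm_single_inr] using h (EuclideanSpace.single (Sum.inr i) 1)
  · simpa [symplecticForm_single_inl] using h (EuclideanSpace.single (Sum.inl i) 1)

lemma phase_eq_sum (v : Phase d) :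
    v = ∑ i, (v (Sum.inl i) • EuclideanSpace.single (Sum.inl i) (1 : ℝ) +
      v (Sum.inr i) • EuclideanSpace.single (Sum.inr i) (1 : ℝ)) := by
  refine phase_ext (fun i => ?_) fun i => ?_ <;> simp [Pi.single_apply]

/-- Together with nondegeneracy this characterizes `hamVectorField` without coordinates, which is
how its behaviour under symplectic maps, rotations and differentiation is obtained below. -/
lemma symplecticForm_hamVectorField (H : Phase d → ℝ) (z v : Phase d) :
    symplecticForm (hamVectorField H z) v = fderiv ℝ H z v := by
  conv_rhs => rw [phase_eq_sum v]
  simp only [symplecticForm, hamVectorField, map_sum, map_add, map_smul, smul_eq_mul,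
    Sum.elim_inl, Sum.elim_inr]
  exact Finset.sum_congr rfl fun i _ => by ring

lemma contDiff_hamVectorField {H : Phase d → ℝ} (hH : ContDiff ℝ ∞ H) :
    ContDiff ℝ ∞ (hamVectorField H) := by
  have h1 : ContDiff ℝ ∞ (fderiv ℝ H) := hH.fderiv_right (by simp)
  refine contDiff_euclidean.2 fun j => ?_
  rcases j with i | i
  · exact h1.clm_apply contDiff_const
  · exact (h1.clm_apply contDiff_const).neg

lemma norm_hamVectorField_le (H : Phase d → ℝ) (z : Phase d) :
    ‖hamVectorField H z‖ ≤ (2 * d) * ‖fderiv ℝ H z‖ := by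
  have key : ∀ j, ‖hamVectorField H z j‖ ≤ ‖fderiv ℝ H z‖ := by
    intro j
    rcases j with i | i
    · simpa [hamVectorField] using
        (fderiv ℝ H z).le_opNorm (EuclideanSpace.single (Sum.inr i) 1)
    · simpa [hamVectorField] using
        (fderiv ℝ H z).le_opNorm (EuclideanSpace.single (Sum.inl i) 1)
  rw [phase_eq_sum (hamVectorField H z)]
  refine (norm_sum_le _ _).trans ?_
  have : ∀ i ∈ (Finset.univ : Finset (Fin d)),
      ‖hamVectorField H z (Sum.inl i) • EuclideanSpace.single (Sum.inl i) (1 : ℝ) +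
        hamVectorField H z (Sum.inr i) • EuclideanSpace.single (Sum.inr i) (1 : ℝ)‖
      ≤ 2 * ‖fderiv ℝ H z‖ := by
    intro i _
    refine (norm_add_le _ _).trans ?_
    rw [norm_smul, norm_smul, PiLp.norm_single, PiLp.norm_single]
    have := key (Sum.inl i)
    have := key (Sum.inr i)
    simp only [norm_one, mul_one]
    linarith
  refine (Finset.sum_le_sum this).trans (le_of_eq ?_)
  simp
  ring

lemma hamVectorField_sub {H H' : Phase d → ℝ} {z : Phase d} (h : DifferentiableAt ℝ H z)
    (h' : DifferentiableAt ℝ H' z) :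
    hamVectorField H z - hamVectorField H' z = hamVectorField (fun w => H w - H' w) z := by
  have e : fderiv ℝ (fun w => H w - H' w) z = fderiv ℝ H z - fderiv ℝ H' z := fderiv_fun_sub h h'
  refine phase_ext (fun i => ?_) fun i => ?_ <;> (simp [hamVectorField, e]; try ring)

/-! ### Rotations -/

@[simp] lemma rotate_inl (θ : Fin d → ℝ) (z : Phase d) (i : Fin d) :
    rotate θ z (Sum.inl i) =
      Real.cos (θ i) * z (Sum.inl i) + Real.sin (θ i) * z (Sum.inr i) := rfl

@[simp] lemma rotate_inr (θ : Fin d → ℝ) (z : Phase d) (i : Fin d) :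
    rotate θ z (Sum.inr i) =
      -Real.sin (θ i) * z (Sum.inl i) + Real.cos (θ i) * z (Sum.inr i) := rfl

@[simp] lemma action_rotate (θ : Fin d → ℝ) (z : Phase d) : action (rotate θ z) = action z := by
  funext i
  simp only [action, rotate_inl, rotate_inr]
  have := Real.sin_sq_add_cos_sq (θ i)
  linear_combination ((z (Sum.inl i)) ^ 2 + (z (Sum.inr i)) ^ 2) / 2 * this

@[simp] lemma rotate_zero (z : Phase d) : rotate 0 z = z := by
  refine phase_ext (fun i => ?_) fun i => ?_ <;> simp

lemma rotate_rotate (θ θ' : Fin d → ℝ) (z : Phase d) :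
    rotate θ (rotate θ' z) = rotate (θ + θ') z := by
  refine phase_ext (fun i => ?_) fun i => ?_ <;>
    simp only [rotate_inl, rotate_inr, Pi.add_apply, Real.cos_add, Real.sin_add] <;> ring

lemma continuous_rotate : Continuous (fun p : (Fin d → ℝ) × Phase d => rotate p.1 p.2) := by
  unfold rotate
  refine (PiLp.continuous_toLp 2 _).comp (continuous_pi fun j => ?_)
  rcases j with i | i <;> simp only [Sum.elim_inl, Sum.elim_inr] <;> fun_prop

/-- The rotation of each plane `(x_i, y_i)`, as a linear map. -/
def rotateCLM (θ : Fin d → ℝ) : Phase d →L[ℝ] Phase d :=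
  LinearMap.toContinuousLinearMap
    { toFun := rotate θ
      map_add' := fun u v => by
        refine phase_ext (fun i => ?_) fun i => ?_ <;>
          simp only [rotate_inl, rotate_inr, PiLp.add_apply] <;> ring
      map_smul' := fun c u => by
        refine phase_ext (fun i => ?_) fun i => ?_ <;>
          simp only [rotate_inl, rotate_inr, PiLp.smul_apply, smul_eq_mul, RingHom.id_apply] <;>
          ring }

@[simp] lemma rotateCLM_apply (θ : Fin d → ℝ) (z : Phase d) : rotateCLM θ z = rotate θ z := rfl

lemma symplecticForm_rotate (θ : Fin d → ℝ) (u v : Phase d) :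
    symplecticForm (rotate θ u) (rotate θ v) = symplecticForm u v := by
  refine Finset.sum_congr rfl fun i _ => ?_
  simp only [rotate_inl, rotate_inr]
  have := Real.sin_sq_add_cos_sq (θ i)
  linear_combination (u (Sum.inl i) * v (Sum.inr i) - u (Sum.inr i) * v (Sum.inl i)) * this

/-- The flow of the Hamiltonian `h ∘ action`. -/
def actionFlow (h : (Fin d → ℝ) → ℝ) (t : ℝ) (z : Phase d) : Phase d :=
  rotate (t • grad h (action z)) z

@[simp] lemma action_actionFlow (h : (Fin d → ℝ) → ℝ) (t : ℝ) (z : Phase d) :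
    action (actionFlow h t z) = action z := action_rotate _ _

lemma hasFDerivAt_action (z : Phase d) (v : Phase d) :
    fderiv ℝ (fun w : Phase d => action w) z v =
      fun i => z (Sum.inl i) * v (Sum.inl i) + z (Sum.inr i) * v (Sum.inr i) := by
  have hd : DifferentiableAt ℝ (fun w : Phase d => action w) z :=
    contDiff_action.differentiable (by simp) z
  have h1 : HasDerivAt (fun s : ℝ => action (z + s • v))
      (fderiv ℝ (fun w : Phase d => action w) z v) 0 := by
    have h2 : HasDerivAt (fun s : ℝ => z + s • v) v 0 := by
      simpa using ((hasDerivAt_id (0 : ℝ)).smul_const v).const_add z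
    have h3 : HasFDerivAt (fun w : Phase d => action w)
      (fderiv ℝ (fun w : Phase d => action w) z) (z + (0 : ℝ) • v) := by
      simpa using hd.hasFDerivAt
    exact h3.comp_hasDerivAt 0 h2
  refine h1.unique (hasDerivAt_pi.2 fun i => ?_)
  have e1 : HasDerivAt (fun s : ℝ => z (Sum.inl i) + s * v (Sum.inl i)) (v (Sum.inl i)) 0 := by
    simpa using ((hasDerivAt_id (0 : ℝ)).mul_const (v (Sum.inl i))).const_add (z (Sum.inl i))
  have e2 : HasDerivAt (fun s : ℝ => z (Sum.inr i) + s * v (Sum.inr i)) (v (Sum.inr i)) 0 := by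
    simpa using ((hasDerivAt_id (0 : ℝ)).mul_const (v (Sum.inr i))).const_add (z (Sum.inr i))
  have e3 := ((e1.pow 2).add (e2.pow 2)).div_const 2
  simp only [action, PiLp.add_apply, PiLp.smul_apply, smul_eq_mul]
  refine e3.congr_deriv ?_
  simp
  ring

lemma hamVectorField_comp_action {h : (Fin d → ℝ) → ℝ} (hh : ContDiff ℝ ∞ h) (z : Phase d) :
    hamVectorField (fun w => h (action w)) z =
      WithLp.toLp 2 (Sum.elim (fun i => grad h (action z) i * z (Sum.inr i))
        (fun i => -(grad h (action z) i * z (Sum.inl i)))) := by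
  have e : ∀ v, fderiv ℝ (fun w : Phase d => h (action w)) z v =
      fderiv ℝ h (action z) (fderiv ℝ (fun w : Phase d => action w) z v) := by
    intro v
    have := fderiv_comp (g := h) (f := fun w : Phase d => action w) z
      (hh.differentiable (by simp) _) (contDiff_action.differentiable (by simp) z)
    simp only [Function.comp_def] at this
    rw [this]; rfl
  refine phase_ext (fun i => ?_) fun i => ?_
  · simp [hamVectorField, e, hasFDerivAt_action, fderiv_eq_sum_grad, mul_comm]
  · simp [hamVectorField, e, hasFDerivAt_action, fderiv_eq_sum_grad, mul_comm]

lemma hasDerivAt_actionFlow {h : (Fin d → ℝ) → ℝ} (hh : ContDiff ℝ ∞ h) (z : Phase d) (t : ℝ) :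
    HasDerivAt (fun s => actionFlow h s z)
      (hamVectorField (fun w => h (action w)) (actionFlow h t z)) t := by
  rw [hamVectorField_comp_action hh]
  refine hasDerivAt_phase fun j => ?_
  rcases j with i | i
  all_goals
    have e0 : HasDerivAt (fun s : ℝ => s * grad h (action z) i) (grad h (action z) i) t := by
      simpa using (hasDerivAt_id t).mul_const (grad h (action z) i)
    have e1 := e0.cos
    have e2 := e0.sin
  · refine ((e1.mul_const (z (Sum.inl i))).add (e2.mul_const (z (Sum.inr i)))).congr_deriv ?_
    simp [actionFlow]
    ring
  · refine ((e2.neg.mul_const (z (Sum.inl i))).add (e1.mul_const (z (Sum.inr i)))).congr_deriv ?_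
    simp [actionFlow]
    ring

/-! ### Symplectic diffeomorphisms -/

/-- `G` is a smooth symplectic diffeomorphism. -/
structure IsSymplectic (G : Phase d ≃ Phase d) : Prop where
  contDiff : ContDiff ℝ ∞ G
  contDiff_symm : ContDiff ℝ ∞ G.symm
  form : ∀ z u v, symplecticForm (fderiv ℝ G z u) (fderiv ℝ G z v) = symplecticForm u v

lemma IsSymplectic.refl : IsSymplectic (Equiv.refl (Phase d)) where
  contDiff := contDiff_id
  contDiff_symm := contDiff_id
  form z u v := by
    have : fderiv ℝ (Equiv.refl (Phase d)) z = ContinuousLinearMap.id ℝ _ := fderiv_id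
    rw [this]; rfl

lemma IsSymplectic.trans {G G' : Phase d ≃ Phase d} (hG : IsSymplectic G)
    (hG' : IsSymplectic G') : IsSymplectic (G.trans G') where
  contDiff := hG'.contDiff.comp hG.contDiff
  contDiff_symm := hG.contDiff_symm.comp hG'.contDiff_symm
  form z u v := by
    have : fderiv ℝ (G.trans G') z = (fderiv ℝ G' (G z)).comp (fderiv ℝ G z) :=
      fderiv_comp z (hG'.contDiff.differentiable (by simp) _)
        (hG.contDiff.differentiable (by simp) _)
    rw [this]
    simp [hG'.form, hG.form]

lemma IsSymplectic.fderiv_fderiv_symm {G : Phase d ≃ Phase d} (hG : IsSymplectic G)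
    (z u : Phase d) : fderiv ℝ G (G.symm z) (fderiv ℝ G.symm z u) = u := by
  have h1 : fderiv ℝ (G ∘ G.symm) z = (fderiv ℝ G (G.symm z)).comp (fderiv ℝ G.symm z) :=
    fderiv_comp z (hG.contDiff.differentiable (by simp) _)
      (hG.contDiff_symm.differentiable (by simp) _)
  have h2 : (G ∘ G.symm : Phase d → Phase d) = id := by funext x; simp
  rw [h2, fderiv_id] at h1
  simpa using (congrArg (fun A : Phase d →L[ℝ] Phase d => A u) h1).symm

lemma IsSymplectic.symm {G : Phase d ≃ Phase d} (hG : IsSymplectic G) :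
    IsSymplectic G.symm where
  contDiff := hG.contDiff_symm
  contDiff_symm := hG.contDiff
  form z u v := by
    rw [← hG.form (G.symm z), hG.fderiv_fderiv_symm, hG.fderiv_fderiv_symm]

/-- Symplectic maps transport Hamiltonian fields to Hamiltonian fields. Both sides are tested
against a vector written as the image under the derivative of `G.symm`, which preserves the form. -/
lemma IsSymplectic.fderiv_hamVectorField {G : Phase d ≃ Phase d} (hG : IsSymplectic G)
    {f : Phase d → ℝ} (hf : ContDiff ℝ ∞ f) (z : Phase d) :
    fderiv ℝ G.symm (G z) (hamVectorField f (G z)) = hamVectorField (fun w => f (G w)) z := by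
  refine symplecticForm_nondegenerate fun v => ?_
  rw [symplecticForm_hamVectorField]
  have h1 : fderiv ℝ (fun w => f (G w)) z = (fderiv ℝ f (G z)).comp (fderiv ℝ G z) :=
    fderiv_comp z (hf.differentiable (by simp) _) (hG.contDiff.differentiable (by simp) _)
  have h2 := hG.symm.fderiv_fderiv_symm z v
  simp only [Equiv.symm_symm] at h2
  conv_lhs => rw [← h2]
  rw [hG.symm.form, symplecticForm_hamVectorField, h1]
  rfl

/-- The flow of the Hamiltonian `h ∘ action ∘ G`. -/
def conjFlow (h : (Fin d → ℝ) → ℝ) (G : Phase d ≃ Phase d) (t : ℝ) (z : Phase d) : Phase d :=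
  G.symm (actionFlow h t (G z))

lemma conjFlow_zero (h : (Fin d → ℝ) → ℝ) (G : Phase d ≃ Phase d) (z : Phase d) :
    conjFlow h G 0 z = z := by
  simp [conjFlow, actionFlow]

lemma hasDerivAt_conjFlow {h : (Fin d → ℝ) → ℝ} (hh : ContDiff ℝ ∞ h) {G : Phase d ≃ Phase d}
    (hG : IsSymplectic G) (z : Phase d) (t : ℝ) :
    HasDerivAt (fun s => conjFlow h G s z)
      (hamVectorField (fun w => h (action (G w))) (conjFlow h G t z)) t := by
  have h1 := hasDerivAt_actionFlow hh (G z) t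
  have h2 : HasFDerivAt G.symm (fderiv ℝ G.symm (actionFlow h t (G z))) (actionFlow h t (G z)) :=
    (hG.contDiff_symm.differentiable (by simp) _).hasFDerivAt
  have h3 := h2.comp_hasDerivAt t h1
  have h4 := hG.fderiv_hamVectorField (f := fun w => h (action w)) (hh.comp contDiff_action)
    (conjFlow h G t z)
  have h5 : G (conjFlow h G t z) = actionFlow h t (G z) := by simp [conjFlow]
  rw [h5] at h4
  rw [h4] at h3
  exact h3

end Basics

/-! ### The implicit midpoint map of a Hamiltonian vector field. -/

section Midpoint

/-- A perturbation of the identity by a contraction is a homeomorphism. Its derivative `1 - W'` is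
invertible by the Neumann series because `‖W'‖ ≤ 1/2`, so the inverse is smooth too. -/
lemma exists_homeomorph_sub {E : Type*} [NormedAddCommGroup E] [NormedSpace ℝ E] [CompleteSpace E]
    {W : E → E} (hW : ContDiff ℝ ∞ W) (hL : LipschitzWith (1 / 2) W) :
    ∃ e : E ≃ₜ E, (∀ x, e x = x - W x) ∧ ContDiff ℝ ∞ e.symm := by
  have happ : ApproximatesLinearOn (fun x => x - W x)
      ((ContinuousLinearEquiv.refl ℝ E : E ≃L[ℝ] E) : E →L[ℝ] E) Set.univ (1 / 2) := by
    intro x _ y _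
    have h1 := hL.dist_le_mul y x
    rw [dist_eq_norm, dist_eq_norm, norm_sub_rev y x] at h1
    refine le_trans (le_of_eq ?_) h1
    congr 1
    simp only [ContinuousLinearEquiv.coe_refl, ContinuousLinearMap.coe_id', id_eq]
    abel
  have hc : Subsingleton E ∨ (1 / 2 : NNReal) <
      ‖((ContinuousLinearEquiv.refl ℝ E).symm : E →L[ℝ] E)‖₊⁻¹ := by
    rcases subsingleton_or_nontrivial E with h | h
    · exact Or.inl h
    · right
      have : ‖((ContinuousLinearEquiv.refl ℝ E).symm : E →L[ℝ] E)‖₊ = 1 := by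
        apply NNReal.eq
        simp
      rw [this]
      norm_num
  refine ⟨happ.toHomeomorph _ hc, fun x => rfl, ?_⟩
  have hlt : ∀ a, ‖fderiv ℝ W a‖ < 1 := fun a =>
    (norm_fderiv_le_of_lipschitz ℝ hL).trans_lt (by norm_num)
  refine Homeomorph.contDiff_symm _ (f₀' := fun a =>
    ContinuousLinearEquiv.unitsEquiv ℝ E (Units.oneSub (fderiv ℝ W a) (hlt a))) ?_ ?_
  · intro a
    have h1 : HasFDerivAt (fun x => x - W x) (ContinuousLinearMap.id ℝ E - fderiv ℝ W a) a :=
      (hasFDerivAt_id a).sub (hW.differentiable (by simp) a).hasFDerivAt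
    exact h1
  · exact contDiff_id.sub hW

variable {d : ℕ}

/-- The linearized field is infinitesimally symplectic: pairing it with the form gives the Hessian
of `F`, which is symmetric. -/
lemma symplecticForm_fderiv_hamVectorField {F : Phase d → ℝ} (hF : ContDiff ℝ ∞ F)
    (m u v : Phase d) :
    symplecticForm (fderiv ℝ (hamVectorField F) m u) v +
      symplecticForm u (fderiv ℝ (hamVectorField F) m v) = 0 := by
  have key : ∀ u v, symplecticForm (fderiv ℝ (hamVectorField F) m u) v =
      fderiv ℝ (fderiv ℝ F) m u v := by
    intro u v
    have hV : DifferentiableAt ℝ (hamVectorField F) m :=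
      (contDiff_hamVectorField hF).differentiable (by simp) m
    have h1 : HasFDerivAt (fun z => symplecticFunctional v (hamVectorField F z))
        ((symplecticFunctional v).comp (fderiv ℝ (hamVectorField F) m)) m :=
      (symplecticFunctional v).hasFDerivAt.comp m hV.hasFDerivAt
    have hD : DifferentiableAt ℝ (fderiv ℝ F) m :=
      ((hF.fderiv_right (m := ∞) (by simp)).differentiable (by simp)) m
    have h2 : HasFDerivAt (fun z => fderiv ℝ F z v)
        ((fderiv ℝ (fderiv ℝ F) m).flip v) m := by
      have := hD.hasFDerivAt.clm_apply (hasFDerivAt_const v m)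
      simpa using this
    have h3 : (fun z => symplecticFunctional v (hamVectorField F z)) =
        fun z => fderiv ℝ F z v := by
      funext z
      simp [symplecticForm_hamVectorField]
    rw [h3] at h1
    have := congrArg (fun A : Phase d →L[ℝ] ℝ => A u) (h1.unique h2)
    simpa using this
  rw [symplecticForm_swap u, key, key]
  have := (hF.contDiffAt (x := m)).isSymmSndFDerivAt (by simp; exact WithTop.coe_le_coe.2 (le_top : (2 : ℕ∞) ≤ ⊤)) u v
  rw [this]; ring

/-- `γ` is the implicit midpoint map with step `2 τ` of the Hamiltonian vector field of `F`, and
`m z` is the midpoint between `z` and `γ z`. -/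
structure IsMidpointMap (F : Phase d → ℝ) (τ : ℝ) (γ : Phase d ≃ Phase d)
    (m : Phase d → Phase d) : Prop where
  lipschitz : LipschitzWith (1 / 2) (fun z => τ • hamVectorField F z)
  symplectic : IsSymplectic γ
  continuous_mid : Continuous m
  mid : ∀ z, m z = z + τ • hamVectorField F (m z)
  map : ∀ z, γ z = m z + τ • hamVectorField F (m z)

/-- With X the Hamiltonian field, γ is (id + τX) ∘ (id − τX)⁻¹. Its derivative is the Cayley
transform of an infinitesimally symplectic map B: in the difference of the forms of (1 ± τB)a and (1
± τB)b the quadratic terms cancel, and the linear ones vanish by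
`symplecticForm_fderiv_hamVectorField`. The map replaces the time-τ flow because it is symplectic,
respects linear symmetries, and treats the actions exactly (`IsMidpointMap.action_map`). -/
lemma exists_isMidpointMap {F : Phase d → ℝ} (hF : ContDiff ℝ ∞ F) {τ : ℝ}
    (hL : LipschitzWith (1 / 2) (fun z => τ • hamVectorField F z)) :
    ∃ γ m, IsMidpointMap F τ γ m := by
  have hV := contDiff_hamVectorField hF
  have hW : ContDiff ℝ ∞ (fun z => τ • hamVectorField F z) := hV.const_smul τ
  have hLn : LipschitzWith (1 / 2) (fun z => -(τ • hamVectorField F z)) :=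
    LipschitzWith.of_dist_le_mul fun x y => by
      rw [dist_neg_neg]; exact hL.dist_le_mul x y
  obtain ⟨e, he, hes⟩ := exists_homeomorph_sub hW hL
  obtain ⟨e', he', hes'⟩ := exists_homeomorph_sub hW.neg hLn
  have hce : ContDiff ℝ ∞ e := by
    have : (e : Phase d → Phase d) = fun x => x - τ • hamVectorField F x := funext he
    rw [this]; exact contDiff_id.sub hW
  have hce' : ContDiff ℝ ∞ e' := by
    have : (e' : Phase d → Phase d) = fun x => x - -(τ • hamVectorField F x) := funext he'
    rw [this]; exact contDiff_id.sub hW.neg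
  refine ⟨e.symm.toEquiv.trans e'.toEquiv, e.symm, hL, ⟨hce'.comp hes, hce.comp hes', ?_⟩,
    e.symm.continuous, fun z => ?_, fun z => ?_⟩
  · intro z u v
    set m := e.symm z with hm
    set B := fderiv ℝ (hamVectorField F) m with hB
    have hVd : HasFDerivAt (fun z => τ • hamVectorField F z) (τ • B) m :=
      (hV.differentiable (by simp) m).hasFDerivAt.const_smul τ
    have d1 : HasFDerivAt e (ContinuousLinearMap.id ℝ _ - τ • B) m := by
      have : (e : Phase d → Phase d) = fun x => x - τ • hamVectorField F x := funext he
      rw [this]; exact (hasFDerivAt_id m).sub hVd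
    have d2 : HasFDerivAt e' (ContinuousLinearMap.id ℝ _ - -(τ • B)) m := by
      have : (e' : Phase d → Phase d) = fun x => x - -(τ • hamVectorField F x) := funext he'
      rw [this]; exact (hasFDerivAt_id m).sub hVd.neg
    have d3 : HasFDerivAt e.symm (fderiv ℝ e.symm z) z :=
      (hes.differentiable (by simp) z).hasFDerivAt
    have d4 : HasFDerivAt (e.symm.toEquiv.trans e'.toEquiv)
        ((ContinuousLinearMap.id ℝ _ - -(τ • B)).comp (fderiv ℝ e.symm z)) z :=
      HasFDerivAt.comp (g := e') (f := e.symm) z d2 d3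
    have d5 : (ContinuousLinearMap.id ℝ _ - τ • B).comp (fderiv ℝ e.symm z) =
        ContinuousLinearMap.id ℝ _ := by
      have := HasFDerivAt.comp (g := e) (f := e.symm) z d1 d3
      have h0 : (e ∘ e.symm : Phase d → Phase d) = id := by funext x; simp
      rw [h0] at this
      exact this.unique (hasFDerivAt_id z)
    rw [d4.fderiv]
    have hu : ∀ u, u = fderiv ℝ e.symm z u - τ • B (fderiv ℝ e.symm z u) := fun u => by
      have := congrArg (fun A : Phase d →L[ℝ] Phase d => A u) d5
      simpa using this.symm
    conv_rhs => rw [hu u, hu v]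
    have hc : ∀ w, ((ContinuousLinearMap.id ℝ _ - -(τ • B)).comp (fderiv ℝ e.symm z)) w =
        fderiv ℝ e.symm z w + τ • B (fderiv ℝ e.symm z w) := fun w => by simp
    rw [hc, hc]
    generalize fderiv ℝ e.symm z u = a
    generalize fderiv ℝ e.symm z v = b
    have hs := symplecticForm_fderiv_hamVectorField hF m a b
    rw [← hB] at hs
    have e1 : a - τ • B a = a + (-τ) • B a := by rw [neg_smul, sub_eq_add_neg]
    have e2 : b - τ • B b = b + (-τ) • B b := by rw [neg_smul, sub_eq_add_neg]
    simp only [e1, e2, symplecticForm_add_left,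
      symplecticForm_add_right, symplecticForm_smul_left, symplecticForm_smul_right]
    linear_combination 2 * τ * hs
  · have := he (e.symm z)
    rw [e.apply_symm_apply] at this
    exact (eq_add_of_sub_eq this.symm)
  · have := he' (e.symm z)
    simpa using this

namespace IsMidpointMap

variable {F : Phase d → ℝ} {τ : ℝ} {γ : Phase d ≃ Phase d} {m : Phase d → Phase d}

lemma eq_mid (h : IsMidpointMap F τ γ m) {z y : Phase d}
    (hy : y = z + τ • hamVectorField F y) : y = m z := by
  have h1 := h.lipschitz.dist_le_mul y (m z)
  have h2 : dist y (m z) = dist (τ • hamVectorField F y) (τ • hamVectorField F (m z)) := by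
    conv_lhs => rw [hy, h.mid z, dist_add_left]
  rw [← h2] at h1
  have h3 : dist y (m z) ≤ 0 := by
    push_cast at h1
    linarith
  exact dist_le_zero.1 h3

lemma map_eq_self (h : IsMidpointMap F τ γ m) {z : Phase d}
    (hz : hamVectorField F (m z) = 0) : γ z = z := by
  have h1 := h.mid z
  have h2 := h.map z
  rw [hz, smul_zero, add_zero] at h1 h2
  rw [h2, h1]

/-- The actions are quadratic and |m + v|² − |m − v|² = 4⟨m, v⟩, so their increment is read off
exactly from the radial component at the midpoint. -/
lemma action_map (h : IsMidpointMap F τ γ m) (z : Phase d) (i : Fin d) :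
    action (γ z) i = action z i + 2 * τ *
      (m z (Sum.inl i) * hamVectorField F (m z) (Sum.inl i) +
        m z (Sum.inr i) * hamVectorField F (m z) (Sum.inr i)) := by
  have h1 : ∀ j, z j = m z j - τ * hamVectorField F (m z) j := fun j =>
    congrArg (fun w : Phase d => w j) (eq_sub_of_add_eq (h.mid z).symm)
  rw [h.map z]
  simp only [action, PiLp.add_apply, PiLp.smul_apply, smul_eq_mul, h1 (Sum.inl i),
    h1 (Sum.inr i)]
  ring

/-- The midpoint is the fixed point of a contraction, so it lies in every closed set that contains
`z` and is preserved by the contraction. -/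
lemma mem_of_mapsTo (h : IsMidpointMap F τ γ m) {z : Phase d} {s : Set (Phase d)}
    (hs : IsClosed s) (hz : z ∈ s) (hm : ∀ y ∈ s, z + τ • hamVectorField F y ∈ s) : m z ∈ s := by
  have hc : ContractingWith (1 / 2) (fun y => z + τ • hamVectorField F y) := by
    refine ⟨by norm_num, ?_⟩
    exact LipschitzWith.of_dist_le_mul fun x y => by
      rw [dist_add_left]; exact h.lipschitz.dist_le_mul x y
  obtain ⟨y, hys, hy, -⟩ := ContractingWith.exists_fixedPoint' hs.isComplete hm (hc.restrict hm)
    hz (edist_ne_top _ _)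
  rw [← h.eq_mid (z := z) (y := y) hy.symm]
  exact hys

end IsMidpointMap

end Midpoint

/-! ### Resonant monomials and the Hamiltonians built from them. -/

section Monomial

variable {d : ℕ}

lemma isCompact_preimage_action {K : Set (Fin d → ℝ)} (hK : IsCompact K) :
    IsCompact {z : Phase d | action z ∈ K} := by
  refine Metric.isCompact_of_isClosed_isBounded (hK.isClosed.preimage continuous_action) ?_
  obtain ⟨R, hR⟩ := (hK.image (f := fun r : Fin d → ℝ => 2 * ∑ i, r i)
    (by fun_prop)).isBounded.exists_norm_le
  refine (Metric.isBounded_closedBall (x := (0 : Phase d)) (r := R + 1)).subset fun z hz => ?_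
  rw [mem_closedBall_zero_iff]
  have h1 := hR _ ⟨action z, hz, rfl⟩
  simp only [← norm_sq_eq_sum_action, Real.norm_eq_abs] at h1
  have h2 := le_abs_self (‖z‖ ^ 2)
  nlinarith [norm_nonneg z]

lemma exists_bump {E : Type*} [NormedAddCommGroup E] [NormedSpace ℝ E] [FiniteDimensional ℝ E]
    {K O : Set E} (hK : IsCompact K) (hO : IsOpen O) (hKO : K ⊆ O) :
    ∃ f : E → ℝ, ContDiff ℝ ∞ f ∧ HasCompactSupport f ∧ tsupport f ⊆ O ∧ (∀ x, 0 ≤ f x) ∧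
      (∀ x, f x ≤ 1) ∧ ∀ x ∈ K, f x = 1 := by
  obtain ⟨δ, hδ, hsub⟩ := hK.exists_cthickening_subset_open hO hKO
  obtain ⟨f, h1, h0, hf⟩ := exists_contMDiffMap_one_nhds_of_subset_interior
    (n := ⊤) (modelWithCornersSelf ℝ E) hK.isClosed
    (t := Metric.cthickening δ K)
    ((Metric.self_subset_thickening hδ K).trans
      (interior_maximal (Metric.thickening_subset_cthickening δ K) Metric.isOpen_thickening))
  have hs : tsupport f ⊆ Metric.cthickening δ K :=
    closure_minimal (fun x hx => by
      by_contra h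
      exact hx (h0 x h)) Metric.isClosed_cthickening
  exact ⟨f, f.contMDiff.contDiff, hK.cthickening.of_isClosed_subset (isClosed_tsupport _) hs,
    hs.trans hsub, fun x => (hf x).1, fun x => (hf x).2, fun x hx => h1.self_of_nhdsSet x hx⟩

/-- The complex coordinate `x_i - √-1 y_i`. -/
def complexCoord (i : Fin d) (z : Phase d) : ℂ :=
  (z (Sum.inl i) : ℂ) - (z (Sum.inr i) : ℂ) * Complex.I

/-- The monomial on which the rotation by `θ` acts through the character `exp (√-1 ∑ κ_i θ_i)`. -/
def monomial (κ : Fin d → ℤ) (z : Phase d) : ℂ :=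
  ∏ i, if 0 ≤ κ i then complexCoord i z ^ (κ i).natAbs
    else (starRingEnd ℂ (complexCoord i z)) ^ (κ i).natAbs

/-- The linear map multiplying each plane `(x_i, y_i)` by `t_i`, as a function of `t`. -/
def scaleMap (z : Phase d) : (Fin d → ℝ) →ₗ[ℝ] Phase d where
  toFun t := WithLp.toLp 2 (Sum.elim (fun i => t i * z (Sum.inl i)) (fun i => t i * z (Sum.inr i)))
  map_add' t s := by
    refine phase_ext (fun i => ?_) fun i => ?_ <;> simp [add_mul]
  map_smul' c t := by
    refine phase_ext (fun i => ?_) fun i => ?_ <;> simp [mul_assoc]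

@[simp] lemma scaleMap_inl (z : Phase d) (t : Fin d → ℝ) (i : Fin d) :
    scaleMap z t (Sum.inl i) = t i * z (Sum.inl i) := rfl

@[simp] lemma scaleMap_inr (z : Phase d) (t : Fin d → ℝ) (i : Fin d) :
    scaleMap z t (Sum.inr i) = t i * z (Sum.inr i) := rfl

lemma scaleMap_one (z : Phase d) : scaleMap z 1 = z := by
  refine phase_ext (fun i => ?_) fun i => ?_ <;> simp

lemma scaleMap_scaleMap (z : Phase d) (t s : Fin d → ℝ) :
    scaleMap (scaleMap z t) s = scaleMap z (s * t) := by
  refine phase_ext (fun i => ?_) fun i => ?_ <;> simp [mul_assoc]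

lemma action_scaleMap (z : Phase d) (t : Fin d → ℝ) (i : Fin d) :
    action (scaleMap z t) i = t i ^ 2 * action z i := by
  simp only [action, scaleMap_inl, scaleMap_inr]; ring

lemma contDiff_monomial (κ : Fin d → ℤ) : ContDiff ℝ ∞ (monomial κ) := by
  have h1 : ∀ i, ContDiff ℝ ∞ (complexCoord (d := d) i) := by
    intro i
    have e1 : ContDiff ℝ ∞ (fun z : Phase d => ((z (Sum.inl i) : ℝ) : ℂ)) :=
      Complex.ofRealCLM.contDiff.comp (by fun_prop)
    have e2 : ContDiff ℝ ∞ (fun z : Phase d => ((z (Sum.inr i) : ℝ) : ℂ)) :=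
      Complex.ofRealCLM.contDiff.comp (by fun_prop)
    exact e1.sub (e2.mul contDiff_const)
  refine contDiff_prod fun i _ => ?_
  split_ifs
  · exact (h1 i).pow _
  · exact (Complex.conjCLE.contDiff.comp (h1 i)).pow _

lemma complexCoord_rotate (θ : Fin d → ℝ) (z : Phase d) (i : Fin d) :
    complexCoord i (rotate θ z) = Complex.exp (θ i * Complex.I) * complexCoord i z := by
  rw [Complex.exp_mul_I, ← Complex.ofReal_cos, ← Complex.ofReal_sin]
  apply Complex.ext <;> simp [complexCoord]

lemma monomial_rotate (κ : Fin d → ℤ) (θ : Fin d → ℝ) (z : Phase d) :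
    monomial κ (rotate θ z) =
      Complex.exp (((∑ i, κ i * θ i : ℝ) : ℂ) * Complex.I) * monomial κ z := by
  rw [Complex.ofReal_sum, Finset.sum_mul, Complex.exp_sum, monomial, monomial,
    ← Finset.prod_mul_distrib]
  refine Finset.prod_congr rfl fun i _ => ?_
  rw [complexCoord_rotate]
  split_ifs with h
  · rw [mul_pow, ← Complex.exp_nat_mul]
    congr 2
    have : ((κ i).natAbs : ℤ) = κ i := Int.natAbs_of_nonneg h
    have h2 : (((κ i).natAbs : ℕ) : ℂ) = ((κ i : ℤ) : ℂ) := by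
      rw [← this]; simp
    rw [h2]; push_cast; ring
  · rw [map_mul, ← Complex.exp_conj, mul_pow, ← Complex.exp_nat_mul]
    congr 2
    have : ((κ i).natAbs : ℤ) = -κ i := Int.ofNat_natAbs_of_nonpos (le_of_not_ge h)
    have h2 : (((κ i).natAbs : ℕ) : ℂ) = -((κ i : ℤ) : ℂ) := by
      rw [← Int.cast_neg, ← this]; simp
    rw [h2]; simp; ring

lemma monomial_scaleMap (κ : Fin d → ℤ) (z : Phase d) (t : Fin d → ℝ) :
    monomial κ (scaleMap z t) = ((∏ i, t i ^ (κ i).natAbs : ℝ) : ℂ) * monomial κ z := by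
  rw [monomial, monomial, Complex.ofReal_prod, ← Finset.prod_mul_distrib]
  refine Finset.prod_congr rfl fun i _ => ?_
  have : complexCoord i (scaleMap z t) = (t i : ℂ) * complexCoord i z := by
    simp [complexCoord]; ring
  rw [this]
  split_ifs
  · rw [mul_pow]; simp
  · rw [map_mul, mul_pow]; simp

lemma monomial_ne_zero (κ : Fin d → ℤ) {z : Phase d} (hz : ∀ i, 0 < action z i) :
    monomial κ z ≠ 0 := by
  refine Finset.prod_ne_zero_iff.2 fun i _ => ?_
  have : complexCoord i z ≠ 0 := by
    intro h
    have h1 := congrArg Complex.re h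
    have h2 := congrArg Complex.im h
    simp [complexCoord] at h1 h2
    have := hz i
    simp [action, h1, h2] at this
  split_ifs
  · exact pow_ne_zero _ this
  · exact pow_ne_zero _ (by simpa using this)

/-- A Hamiltonian which generates a motion of the actions along `κ`. -/
def resonantHam (f : (Fin d → ℝ) → ℝ) (κ : Fin d → ℤ) (z : Phase d) : ℝ :=
  f (action z) * (monomial κ z).re

variable {f : (Fin d → ℝ) → ℝ} {κ : Fin d → ℤ}

lemma contDiff_monomial_re (κ : Fin d → ℤ) : ContDiff ℝ ∞ (fun z => (monomial κ z).re) :=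
  Complex.reCLM.contDiff.comp (contDiff_monomial κ)

lemma contDiff_resonantHam (hf : ContDiff ℝ ∞ f) : ContDiff ℝ ∞ (resonantHam f κ) :=
  (hf.comp contDiff_action).mul (contDiff_monomial_re κ)

lemma hamVectorField_resonantHam_of_re (hf : ContDiff ℝ ∞ f) {z : Phase d}
    (hz : (monomial κ z).re = 0) (hfz : f (action z) = 0) :
    hamVectorField (resonantHam f κ) z = 0 := by
  have h : fderiv ℝ (resonantHam f κ) z = 0 := by
    have h1 := ((hf.comp contDiff_action).differentiable (by simp) z).hasFDerivAt.mul
      ((contDiff_monomial_re κ).differentiable (by simp) z).hasFDerivAt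
    have h2 : HasFDerivAt (resonantHam f κ) _ z := h1
    rw [h2.fderiv]
    simp [hz, hfz]
  refine phase_ext (fun i => ?_) fun i => ?_ <;> simp [hamVectorField, h]

/-- Up to sign, the radial component in the plane `i` is the derivative of the Hamiltonian along the
rotation of that plane. The rotation fixes the actions and multiplies the monomial by exp(√-1 κ_i
s). Since only the factor `κ i` depends on `i`, the actions move along κ. -/
lemma radial_hamVectorField_resonantHam (hf : ContDiff ℝ ∞ f) (z : Phase d) (i : Fin d) :
    z (Sum.inl i) * hamVectorField (resonantHam f κ) z (Sum.inl i) +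
      z (Sum.inr i) * hamVectorField (resonantHam f κ) z (Sum.inr i) =
    κ i * (f (action z) * (monomial κ z).im) := by
  set F := resonantHam f κ with hF
  have hFd : DifferentiableAt ℝ F z := (contDiff_resonantHam hf).differentiable (by simp) z
  -- the infinitesimal rotation of the plane `i`
  let J : Phase d := WithLp.toLp 2 (Sum.elim (fun j => if j = i then z (Sum.inr i) else 0)
    (fun j => if j = i then -z (Sum.inl i) else 0))
  have hJ : HasDerivAt (fun s : ℝ => rotate (Pi.single i s) z) J 0 := by
    refine hasDerivAt_phase fun j => ?_
    rcases j with j | j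
    all_goals
      by_cases hj : j = i
      · subst hj
        have e1 := (hasDerivAt_id (0 : ℝ)).cos
        have e2 := (hasDerivAt_id (0 : ℝ)).sin
        simp only [rotate_inl, rotate_inr, Pi.single_eq_same]
        first
          | refine ((e1.mul_const (z (Sum.inl j))).add
              (e2.mul_const (z (Sum.inr j)))).congr_deriv ?_
            simp [J]
          | refine ((e2.neg.mul_const (z (Sum.inl j))).add
              (e1.mul_const (z (Sum.inr j)))).congr_deriv ?_
            simp [J]
      · simp only [rotate_inl, rotate_inr, Pi.single_eq_of_ne hj]
        refine (hasDerivAt_const (0 : ℝ) _).congr_deriv ?_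
        simp [J, hj]
  have h1 : HasDerivAt (fun s : ℝ => F (rotate (Pi.single i s) z)) (fderiv ℝ F z J) 0 := by
    have : HasFDerivAt F (fderiv ℝ F z) (rotate (Pi.single i (0 : ℝ)) z) := by
      simpa using hFd.hasFDerivAt
    exact this.comp_hasDerivAt 0 hJ
  have h2 : HasDerivAt (fun s : ℝ => F (rotate (Pi.single i s) z))
      (-(κ i * (f (action z) * (monomial κ z).im))) 0 := by
    have e : (fun s : ℝ => F (rotate (Pi.single i s) z)) = fun s : ℝ => f (action z) *
        (Real.cos (κ i * s) * (monomial κ z).re - Real.sin (κ i * s) * (monomial κ z).im) := by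
      funext s
      have : ∑ j, (κ j : ℝ) * (Pi.single i s : Fin d → ℝ) j = κ i * s := by
        simp [Pi.single_apply]
      simp only [hF, resonantHam, action_rotate, monomial_rotate, this]
      rw [Complex.exp_mul_I, ← Complex.ofReal_cos, ← Complex.ofReal_sin]
      simp only [Complex.mul_re, Complex.add_re, Complex.add_im, Complex.mul_im, Complex.ofReal_re,
        Complex.ofReal_im, Complex.I_re, Complex.I_im]
      ring
    rw [e]
    have e0 : HasDerivAt (fun s : ℝ => (κ i : ℝ) * s) (κ i) 0 := by
      simpa using (hasDerivAt_id (0 : ℝ)).const_mul (κ i : ℝ)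
    refine (((e0.cos.mul_const (monomial κ z).re).sub
      (e0.sin.mul_const (monomial κ z).im)).const_mul (f (action z))).congr_deriv ?_
    simp
    ring
  have h3 := h1.unique h2
  rw [← symplecticForm_hamVectorField] at h3
  have h4 : symplecticForm (hamVectorField F z) J =
      -(z (Sum.inl i) * hamVectorField F z (Sum.inl i) +
        z (Sum.inr i) * hamVectorField F z (Sum.inr i)) := by
    simp only [symplecticForm, J, Sum.elim_inl, Sum.elim_inr]
    rw [Finset.sum_eq_single i]
    · simp; ring
    · intro j _ hj; simp [hj]
    · simp
  linarith

/-- Scaling the planes multiplies the monomial by a real number, so the Hamiltonian vanishes along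
all scalings of a point where the real part is zero. Its field is therefore symplectically
orthogonal to the radial direction of every plane, hence radial in each two-dimensional plane with
nonzero action. -/
lemma exists_hamVectorField_resonantHam_eq_scaleMap (hf : ContDiff ℝ ∞ f)
    (hpos : ∀ r, f r ≠ 0 → ∀ i, 0 < r i) {z : Phase d} (hz : (monomial κ z).re = 0) :
    ∃ c, hamVectorField (resonantHam f κ) z = scaleMap z c := by
  by_cases hfz : f (action z) = 0
  · exact ⟨0, by rw [hamVectorField_resonantHam_of_re hf hz hfz, map_zero]⟩
  have hp := hpos _ hfz
  set F := resonantHam f κ with hF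
  have hFd : DifferentiableAt ℝ F z := (contDiff_resonantHam hf).differentiable (by simp) z
  have key : ∀ i, hamVectorField F z (Sum.inl i) * z (Sum.inr i) -
      hamVectorField F z (Sum.inr i) * z (Sum.inl i) = 0 := by
    intro i
    have h0 : HasDerivAt (fun s : ℝ => z + s • scaleMap z (Pi.single i 1))
        (scaleMap z (Pi.single i 1)) 0 := by
      simpa using ((hasDerivAt_id (0 : ℝ)).smul_const (scaleMap z (Pi.single i 1))).const_add z
    have h1 : HasDerivAt (fun s : ℝ => F (z + s • scaleMap z (Pi.single i 1)))
        (fderiv ℝ F z (scaleMap z (Pi.single i 1))) 0 := by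
      have : HasFDerivAt F (fderiv ℝ F z) (z + (0 : ℝ) • scaleMap z (Pi.single i 1)) := by
        simpa using hFd.hasFDerivAt
      exact this.comp_hasDerivAt 0 h0
    have h2 : (fun s : ℝ => F (z + s • scaleMap z (Pi.single i 1))) = fun _ => 0 := by
      funext s
      have : z + s • scaleMap z (Pi.single i 1) = scaleMap z (1 + s • Pi.single i 1) := by
        rw [map_add, map_smul, scaleMap_one]
      rw [this, hF, resonantHam, monomial_scaleMap, Complex.re_ofReal_mul, hz]
      simp
    rw [h2] at h1
    have h3 := h1.unique (hasDerivAt_const (0 : ℝ) (0 : ℝ))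
    rw [← symplecticForm_hamVectorField] at h3
    rw [← h3, symplecticForm, Finset.sum_eq_single i]
    · simp
    · intro j _ hj; simp [hj]
    · simp
  refine ⟨fun i => (z (Sum.inl i) * hamVectorField F z (Sum.inl i) +
    z (Sum.inr i) * hamVectorField F z (Sum.inr i)) / (2 * action z i), ?_⟩
  refine phase_ext (fun i => ?_) fun i => ?_
  · have h1 := (hp i).ne'
    have h2 := key i
    rw [scaleMap_inl, div_mul_eq_mul_div, eq_div_iff (by simpa using h1)]
    simp only [action]
    linear_combination (z (Sum.inr i)) * h2
  · have h1 := (hp i).ne'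
    have h2 := key i
    rw [scaleMap_inr, div_mul_eq_mul_div, eq_div_iff (by simpa using h1)]
    simp only [action]
    linear_combination (-z (Sum.inl i)) * h2

lemma hamVectorField_rotate {F : Phase d → ℝ} (hF : ContDiff ℝ ∞ F) {θ : Fin d → ℝ}
    (h : ∀ z, F (rotate θ z) = F z) (z : Phase d) :
    hamVectorField F (rotate θ z) = rotate θ (hamVectorField F z) := by
  refine symplecticForm_nondegenerate fun v => ?_
  have hv : v = rotate θ (rotate (-θ) v) := by rw [rotate_rotate]; simp
  rw [hv, symplecticForm_rotate, symplecticForm_hamVectorField, symplecticForm_hamVectorField]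
  have h1 : HasFDerivAt (fun w => F (rotate θ w))
      ((fderiv ℝ F (rotate θ z)).comp (rotateCLM θ)) z :=
    (hF.differentiable (by simp) (rotate θ z)).hasFDerivAt.comp z (rotateCLM θ).hasFDerivAt
  have h2 : (fun w => F (rotate θ w)) = F := funext h
  rw [h2] at h1
  rw [h1.fderiv]
  rfl

lemma IsMidpointMap.map_rotate {F : Phase d → ℝ} (hF : ContDiff ℝ ∞ F) {θ : Fin d → ℝ}
    (h : ∀ z, F (rotate θ z) = F z) {τ : ℝ} {γ : Phase d ≃ Phase d} {m : Phase d → Phase d}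
    (hγ : IsMidpointMap F τ γ m) (z : Phase d) : γ (rotate θ z) = rotate θ (γ z) := by
  have hm : rotate θ (m z) = m (rotate θ z) := by
    refine hγ.eq_mid ?_
    conv_lhs => rw [hγ.mid z]
    rw [hamVectorField_rotate hF h]
    simp only [← rotateCLM_apply, map_add, map_smul]
  rw [hγ.map, hγ.map, ← hm, hamVectorField_rotate hF h]
  simp only [← rotateCLM_apply, map_add, map_smul]

end Monomial

/-! ### Symplectic maps pushing the actions of a zone along an integer direction. -/

section ZoneMap

variable {d : ℕ}

/-- The segment from `ρ` to `ρ + t κ` is contained in `S`. -/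
def LineIn (S : Set (Fin d → ℝ)) (κ : Fin d → ℤ) (ρ : Fin d → ℝ) (t : ℝ) : Prop :=
  ∀ s ∈ Set.uIcc 0 t, ρ + s • (fun i => (κ i : ℝ)) ∈ S

/-- `O` is invariant under the translations along `κ` inside `D`. -/
def LineInvariant (D : Set (Fin d → ℝ)) (κ : Fin d → ℤ) (O : Set (Fin d → ℝ)) : Prop :=
  ∀ ρ ∈ O, ∀ t, LineIn D κ ρ t → ρ + t • (fun i => (κ i : ℝ)) ∈ O

variable {S D O C Q : Set (Fin d → ℝ)} {κ : Fin d → ℤ} {ρ : Fin d → ℝ} {t t' : ℝ}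

lemma lineIn_zero : LineIn S κ ρ 0 ↔ ρ ∈ S := by
  simp [LineIn]

lemma LineIn.left_mem (h : LineIn S κ ρ t) : ρ ∈ S := by
  simpa using h 0 Set.left_mem_uIcc

lemma LineIn.right_mem (h : LineIn S κ ρ t) : ρ + t • (fun i => (κ i : ℝ)) ∈ S :=
  h t Set.right_mem_uIcc

lemma LineIn.mono (h : LineIn S κ ρ t) (ht : t' ∈ Set.uIcc 0 t) : LineIn S κ ρ t' := fun s hs =>
  h s (Set.uIcc_subset_uIcc Set.left_mem_uIcc ht hs)

lemma LineIn.add (h : LineIn S κ ρ t) (h' : LineIn S κ (ρ + t • (fun i => (κ i : ℝ))) t') :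
    LineIn S κ ρ (t + t') := by
  intro s hs
  rcases Set.uIcc_subset_uIcc_union_uIcc (b := t) hs with h1 | h1
  · exact h s h1
  · have h2 : s - t ∈ Set.uIcc 0 t' := by
      rw [Set.mem_uIcc] at h1 ⊢
      rcases h1 with h1 | h1
      · left; constructor <;> linarith [h1.1, h1.2]
      · right; constructor <;> linarith [h1.1, h1.2]
    have := h' _ h2
    rwa [add_assoc, ← add_smul, add_sub_cancel] at this

lemma LineIn.neg (h : LineIn S κ ρ t) : LineIn S κ (ρ + t • (fun i => (κ i : ℝ))) (-t) := by
  intro s hs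
  have h2 : t + s ∈ Set.uIcc 0 t := by
    rw [Set.mem_uIcc] at hs ⊢
    rcases hs with h1 | h1
    · right; constructor <;> linarith [h1.1, h1.2]
    · left; constructor <;> linarith [h1.1, h1.2]
  have := h _ h2
  rwa [add_smul, ← add_assoc] at this

/-- One step of the motion along `κ` generated by a resonant Hamiltonian. -/
lemma exists_zone_step (hO : IsOpen O) (hpos : ∀ r ∈ O, ∀ i, 0 < r i) (hCO : C ⊆ O)
    (hCQ : IsCompact (C ∩ Q)) :
    ∃ (γ : Phase d ≃ Phase d) (K : Set (Fin d → ℝ)) (c : ℝ), IsSymplectic γ ∧ IsCompact K ∧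
      K ⊆ O ∧ 0 < c ∧ (∀ z, action z ∉ K → γ z = z) ∧
      (∀ θ : Fin d → ℝ, ∑ i, κ i * θ i = 0 → ∀ z, γ (rotate θ z) = rotate θ (γ z)) ∧
      (∀ z, action z ∈ O → ∃ t, action (γ z) = action z + t • (fun i => (κ i : ℝ)) ∧
        LineIn O κ (action z) t) ∧
      (∀ z, action z ∈ O → (monomial κ z).re = 0 → ∃ t s : ℝ, 0 < s ∧
        monomial κ (γ z) = s * monomial κ z ∧
        action (γ z) = action z + t • (fun i => (κ i : ℝ)) ∧
        LineIn O κ (action z) t ∧ 0 ≤ t * (monomial κ z).im ∧ (action z ∈ C ∩ Q → c ≤ |t|)) := by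
  obtain ⟨f, hf, hfc, hfO, hf0, -, hf1⟩ :=
    exists_bump hCQ hO (Set.inter_subset_left.trans hCO)
  have hfpos : ∀ r, f r ≠ 0 → ∀ i, 0 < r i := fun r hr =>
    hpos r (hfO (subset_tsupport _ hr))
  set F := resonantHam f κ with hF
  have hFs : ContDiff ℝ ∞ F := contDiff_resonantHam hf
  have hV := contDiff_hamVectorField hFs
  have hK' : IsCompact {z : Phase d | action z ∈ tsupport f} := isCompact_preimage_action hfc
  have hV0 : ∀ z, action z ∉ tsupport f → hamVectorField F z = 0 := by
    intro z hz
    have h1 : ∀ᶠ w in 𝓝 z, F w = 0 := by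
      have : ∀ᶠ w in 𝓝 z, action w ∉ tsupport f :=
        (continuous_action.tendsto z).eventually ((isClosed_tsupport f).isOpen_compl.mem_nhds hz)
      filter_upwards [this] with w hw
      rw [hF, resonantHam, image_eq_zero_of_notMem_tsupport hw, zero_mul]
    have h2 : fderiv ℝ F z = 0 := by
      rw [Filter.EventuallyEq.fderiv_eq h1]; simp
    refine phase_ext (fun i => ?_) fun i => ?_ <;> simp [hamVectorField, h2]
  have hVc : HasCompactSupport (hamVectorField F) :=
    HasCompactSupport.intro hK' fun z hz => hV0 z hz
  obtain ⟨L, hL⟩ := ContDiff.lipschitzWith_of_hasCompactSupport hVc hV (by simp)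
  obtain ⟨B, hB⟩ := hVc.exists_bound_of_continuous hV.continuous
  obtain ⟨η, hη, hηO⟩ := hfc.exists_cthickening_subset_open hO hfO
  -- Over the support of `f`, a displacement shorter than δ changes the actions by less than η.
  obtain ⟨δ, hδ, hδη⟩ := Metric.mem_uniformity_dist.1
    (hK'.uniformContinuousAt_of_continuousAt (fun z : Phase d => action z)
      (fun a _ => continuous_action.continuousAt) (Metric.dist_mem_uniformity hη))
  have hB0 : 0 ≤ B := (norm_nonneg _).trans (hB 0)
  -- The first bound makes the rescaled field a contraction; the second makes each half-step from
  -- the midpoint shorter than δ.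
  set τ : ℝ := min (1 / (2 * (L + 1))) (δ / (2 * (B + 1))) with hτdef
  have hLp : (0 : ℝ) < 2 * (L + 1) := by positivity
  have hτ : 0 < τ := lt_min (by positivity) (by positivity)
  have hτL : τ * L ≤ 1 / 2 := by
    have h1 : τ * (2 * (L + 1)) ≤ 1 := by
      rw [← le_div_iff₀ hLp]; exact min_le_left _ _
    have : (0 : ℝ) ≤ L := L.coe_nonneg
    nlinarith
  have hτB : τ * B < δ := by
    have h1 : τ * (2 * (B + 1)) ≤ δ := by
      rw [← le_div_iff₀ (by positivity)]; exact min_le_right _ _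
    nlinarith
  have hLip : LipschitzWith (1 / 2) (fun z => τ • hamVectorField F z) :=
    LipschitzWith.of_dist_le_mul fun x y => by
      rw [dist_smul₀, Real.norm_eq_abs, abs_of_pos hτ]
      have h1 := hL.dist_le_mul x y
      have h2 : (0 : ℝ) ≤ dist x y := dist_nonneg
      push_cast
      nlinarith
  obtain ⟨γ, m, hγ⟩ := exists_isMidpointMap hFs hLip
  -- the points between `z` and `γ z`
  have hball : ∀ y, action y ∈ tsupport f → ∀ s ∈ Set.Icc (-1 : ℝ) 1,
      action (y + s • τ • hamVectorField F y) ∈ Metric.ball (action y) η := by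
    intro y hy s hs
    rw [Metric.mem_ball, dist_comm]
    refine hδη (b := y + s • τ • hamVectorField F y) ?_ hy
    rw [dist_self_add_right, norm_smul, norm_smul, Real.norm_eq_abs, Real.norm_eq_abs,
      abs_of_pos hτ]
    have h1 : |s| ≤ 1 := abs_le.2 hs
    have h2 := hB y
    have h3 : 0 ≤ τ * ‖hamVectorField F y‖ := by positivity
    nlinarith
  have hballO : ∀ y, action y ∈ tsupport f → Metric.ball (action y) η ⊆
      Metric.cthickening η (tsupport f) := fun y hy =>
    (Metric.ball_subset_thickening hy η).trans (Metric.thickening_subset_cthickening _ _)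
  have hz_eq : ∀ z, z = m z + (-1 : ℝ) • τ • hamVectorField F (m z) := fun z => by
    rw [neg_one_smul, ← sub_eq_add_neg]
    exact eq_sub_of_add_eq (hγ.mid z).symm
  have hγ_eq : ∀ z, γ z = m z + (1 : ℝ) • τ • hamVectorField F (m z) := fun z => by
    rw [one_smul]; exact hγ.map z
  have haction : ∀ z, action (γ z) = action z +
      (2 * τ * (f (action (m z)) * (monomial κ (m z)).im)) • (fun i => (κ i : ℝ)) := by
    intro z
    funext i
    rw [hγ.action_map, radial_hamVectorField_resonantHam hf]
    simp
    ring
  -- The actions of `z` and `γ z` lie in the η-ball around those of the midpoint. The ball is convex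
  -- and contained in `O`, so the whole segment is in `O`.
  have hline : ∀ z, action z ∈ O →
      LineIn O κ (action z) (2 * τ * (f (action (m z)) * (monomial κ (m z)).im)) := by
    intro z hz
    by_cases hm : action (m z) ∈ tsupport f
    · have h1 := hball (m z) hm (-1) (by simp)
      have h2 := hball (m z) hm 1 (by simp)
      rw [← hz_eq] at h1
      rw [← hγ_eq, haction] at h2
      intro s hs
      refine hηO (hballO _ hm ?_)
      set T := 2 * τ * (f (action (m z)) * (monomial κ (m z)).im)
      have hseg : action z + s • (fun i => (κ i : ℝ)) ∈
          segment ℝ (action z) (action z + T • (fun i => (κ i : ℝ))) := by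
        rw [← segment_eq_uIcc] at hs
        obtain ⟨a, b, ha, hb, hab, rfl⟩ := hs
        refine ⟨a, b, ha, hb, hab, ?_⟩
        rw [smul_add, ← add_assoc, ← add_smul, hab, one_smul, smul_zero, zero_add, smul_smul,
          smul_eq_mul]
      exact (convex_ball _ _).segment_subset h1 h2 hseg
    · rw [image_eq_zero_of_notMem_tsupport hm]
      simpa [lineIn_zero] using hz
  -- the motion on the set where the monomial is purely imaginary
  have hrad : ∀ z, (monomial κ z).re = 0 → ∃ a, m z = scaleMap z a := by
    intro z hz
    have := hγ.mem_of_mapsTo (z := z) (s := LinearMap.range (scaleMap z))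
      (Submodule.closed_of_finiteDimensional _) ⟨1, scaleMap_one z⟩ ?_
    · obtain ⟨a, ha⟩ := this
      exact ⟨a, ha.symm⟩
    · rintro y ⟨a, rfl⟩
      obtain ⟨b, hb⟩ := exists_hamVectorField_resonantHam_eq_scaleMap (κ := κ) hf hfpos
        (z := scaleMap z a) (by rw [monomial_scaleMap, Complex.re_ofReal_mul, hz, mul_zero])
      rw [hF, hb, scaleMap_scaleMap]
      exact ⟨1 + τ • (b * a), by rw [map_add, map_smul, scaleMap_one]⟩
  have hradpos : ∀ z, action z ∈ O → (monomial κ z).re = 0 →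
      ∃ a : Fin d → ℝ, (∀ i, 0 < a i) ∧ (∀ i, 0 < 2 * a i - 1) ∧ m z = scaleMap z a ∧
        γ z = scaleMap z (2 • a - 1) := by
    intro z hzO hz
    by_cases hm : action (m z) ∈ tsupport f
    · obtain ⟨a, ha⟩ := hrad z hz
      have hb : τ • hamVectorField F (m z) = scaleMap z (a - 1) := by
        have := hγ.mid z
        rw [map_sub, ← ha, scaleMap_one]
        exact (sub_eq_of_eq_add' this).symm
      have hpath : ∀ s ∈ Set.Icc (-1 : ℝ) 1, ∀ i, 0 < (a i + s * (a i - 1)) ^ 2 * action z i := by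
        intro s hs i
        have h1 := hpos _ (hηO (hballO _ hm (hball (m z) hm s hs))) i
        have h2 : m z + s • τ • hamVectorField F (m z) = scaleMap z (a + s • (a - 1)) := by
          rw [hb, ha, map_add, map_smul]
        rw [h2, action_scaleMap] at h1
        simpa using h1
      -- Otherwise the factor of the plane `i` would vanish at the parameter `a i / (1 - a i)` of
      -- the segment from `z` to `γ z`, where the actions are still positive. Hence `γ` multiplies
      -- the monomial by a positive number on the set where its real part vanishes.
      have ha2 : ∀ i, 0 < 2 * a i - 1 := by
        intro i
        by_contra hneg
        have h1 : 0 < 1 - a i := by linarith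
        have h2 := hpath (a i / (1 - a i)) ⟨by rw [le_div_iff₀ h1]; linarith,
          by rw [div_le_iff₀ h1]; linarith⟩ i
        have h3 : a i + a i / (1 - a i) * (a i - 1) = 0 := by field_simp; ring
        rw [h3] at h2
        simp at h2
      refine ⟨a, fun i => by linarith [ha2 i], ha2, ha, ?_⟩
      rw [hγ.map, hb, ha, ← map_add]
      congr 1
      rw [two_smul]; abel
    · have h0 := hV0 _ hm
      have h1 := hγ.map_eq_self h0
      have h2 := hγ.mid z
      rw [h0, smul_zero, add_zero] at h2
      refine ⟨1, by simp, by norm_num, by rw [h2, scaleMap_one], ?_⟩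
      rw [h1]
      conv_lhs => rw [← scaleMap_one z]
      congr 1
      rw [two_smul]; abel
  -- If `f` vanished at the midpoint, the field would vanish there and the midpoint would be `z`
  -- itself, where `f = 1`.
  have hne : ∀ z, action z ∈ C ∩ Q → (monomial κ z).re = 0 →
      2 * τ * (f (action (m z)) * (monomial κ (m z)).im) ≠ 0 := by
    intro z hz hre
    have hzO := hCO hz.1
    obtain ⟨a, ha, -, hma, -⟩ := hradpos z hzO hre
    have him : (monomial κ z).im ≠ 0 := fun h =>
      monomial_ne_zero κ (hpos _ hzO) (Complex.ext hre h)
    have hmre : (monomial κ (m z)).re = 0 := by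
      rw [hma, monomial_scaleMap, Complex.re_ofReal_mul, hre, mul_zero]
    have hmim : (monomial κ (m z)).im ≠ 0 := by
      rw [hma, monomial_scaleMap, Complex.im_ofReal_mul]
      exact mul_ne_zero (Finset.prod_ne_zero_iff.2 fun i _ => pow_ne_zero _ (ha i).ne') him
    have hfm : f (action (m z)) ≠ 0 := by
      intro h
      have h0 : hamVectorField F (m z) = 0 := hamVectorField_resonantHam_of_re hf hmre h
      have h2 := hγ.mid z
      rw [h0, smul_zero, add_zero] at h2
      rw [h2, hf1 _ hz] at h
      exact one_ne_zero h
    have := hτ.ne'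
    positivity
  have hcomp : IsCompact {z : Phase d | action z ∈ C ∩ Q ∧ (monomial κ z).re = 0} :=
    (isCompact_preimage_action hCQ).inter_right
      (isClosed_eq (contDiff_monomial_re κ).continuous continuous_const)
  have hcont : Continuous
      fun z => |2 * τ * (f (action (m z)) * (monomial κ (m z)).im)| := by
    have h1 := hγ.continuous_mid
    have h2 : Continuous fun z => (monomial κ z).im :=
      Complex.continuous_im.comp (contDiff_monomial κ).continuous
    exact (continuous_const.mul
      ((hf.continuous.comp (continuous_action.comp h1)).mul (h2.comp h1))).abs
  obtain ⟨c, hc, hcle⟩ : ∃ c, 0 < c ∧ ∀ z, action z ∈ C ∩ Q → (monomial κ z).re = 0 →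
      c ≤ |2 * τ * (f (action (m z)) * (monomial κ (m z)).im)| := by
    rcases Set.eq_empty_or_nonempty {z : Phase d | action z ∈ C ∩ Q ∧ (monomial κ z).re = 0}
      with he | he
    · refine ⟨1, one_pos, fun z h1 h2 => ?_⟩
      exact absurd (show z ∈ {z : Phase d | action z ∈ C ∩ Q ∧ (monomial κ z).re = 0} from
        ⟨h1, h2⟩) (by rw [he]; simp)
    · obtain ⟨w, hw, hmin⟩ := hcomp.exists_isMinOn he hcont.continuousOn
      exact ⟨_, abs_pos.2 (hne w hw.1 hw.2), fun z h1 h2 => hmin ⟨h1, h2⟩⟩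
  refine ⟨γ, Metric.cthickening η (tsupport f), c, hγ.symplectic, hfc.cthickening, hηO, hc,
    fun z hz => ?_, fun θ hθ z => ?_, fun z hz => ⟨_, haction z, hline z hz⟩,
    fun z hz hre => ?_⟩
  · refine hγ.map_eq_self (hV0 _ fun hm => hz ?_)
    have h1 := hball (m z) hm (-1) (by simp)
    rw [← hz_eq] at h1
    exact hballO _ hm h1
  · refine hγ.map_rotate hFs (fun z => ?_) z
    rw [hF, resonantHam, resonantHam, action_rotate, monomial_rotate, hθ]
    simp
  · obtain ⟨a, ha, ha2, hma, hγa⟩ := hradpos z hz hre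
    refine ⟨_, ∏ i, (2 • a - 1 : Fin d → ℝ) i ^ (κ i).natAbs, ?_, ?_, haction z, hline z hz, ?_,
      fun h => hcle z h hre⟩
    · refine Finset.prod_pos fun i _ => pow_pos ?_ _
      simpa using ha2 i
    · rw [hγa, monomial_scaleMap]
    · rw [hma, monomial_scaleMap, Complex.im_ofReal_mul]
      have h1 : 0 ≤ ∏ i, a i ^ (κ i).natAbs := Finset.prod_nonneg fun i _ => pow_nonneg (ha i).le _
      have h2 := hf0 (action (scaleMap z a))
      have h3 := mul_self_nonneg (monomial κ z).im
      have : 2 * τ * (f (action (scaleMap z a)) * ((∏ i, a i ^ (κ i).natAbs) *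
          (monomial κ z).im)) * (monomial κ z).im = 2 * τ * f (action (scaleMap z a)) *
          (∏ i, a i ^ (κ i).natAbs) * ((monomial κ z).im * (monomial κ z).im) := by ring
      rw [this]
      positivity

/-- Iterating the step, the actions leave `Q` along `κ`. -/
theorem exists_zone_map (hκ : κ ≠ 0) (hO : IsOpen O) (hpos : ∀ r ∈ O, ∀ i, 0 < r i) (hOD : O ⊆ D)
    (hCO : C ⊆ O) (hQ : IsCompact Q) (hCQ : IsCompact (C ∩ Q))
    (hOinv : LineInvariant D κ O) (hCinv : LineInvariant D κ C) :
    ∃ (γ : Phase d ≃ Phase d) (K : Set (Fin d → ℝ)), IsSymplectic γ ∧ IsCompact K ∧ K ⊆ O ∧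
      (∀ z, action z ∉ K → γ z = z) ∧
      (∀ θ : Fin d → ℝ, ∑ i, κ i * θ i = 0 → ∀ z, γ (rotate θ z) = rotate θ (γ z)) ∧
      (∀ z, action z ∈ O → ∃ t, action (γ z) = action z + t • (fun i => (κ i : ℝ)) ∧
        LineIn D κ (action z) t) ∧
      (∀ z, action z ∈ C → (monomial κ z).re = 0 → ∃ t : ℝ, 0 ≤ t * (monomial κ z).im ∧
        action (γ z) = action z + t • (fun i => (κ i : ℝ)) ∧ LineIn D κ (action z) t ∧
        ¬ LineIn Q κ (action z) t) := by
  obtain ⟨g, K, c, hg, hK, hKO, hc, hgid, hgrot, hgline, hgre⟩ :=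
    exists_zone_step (κ := κ) hO hpos hCO hCQ
  have hOD' : ∀ {ρ t}, LineIn O κ ρ t → LineIn D κ ρ t := fun h s hs => hOD (h s hs)
  have iter : ∀ N : ℕ, ∃ γ : Phase d ≃ Phase d, IsSymplectic γ ∧
      (∀ z, action z ∉ K → γ z = z) ∧
      (∀ θ : Fin d → ℝ, ∑ i, κ i * θ i = 0 → ∀ z, γ (rotate θ z) = rotate θ (γ z)) ∧
      (∀ z, action z ∈ O → ∃ t, action (γ z) = action z + t • (fun i => (κ i : ℝ)) ∧
        LineIn D κ (action z) t) ∧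
      (∀ z, action z ∈ C → (monomial κ z).re = 0 → ∃ t s : ℝ, 0 < s ∧
        monomial κ (γ z) = s * monomial κ z ∧ 0 ≤ t * (monomial κ z).im ∧
        action (γ z) = action z + t • (fun i => (κ i : ℝ)) ∧ LineIn D κ (action z) t ∧
        (LineIn Q κ (action z) t → N * c ≤ |t|)) := by
    intro N
    induction N with
    | zero =>
      refine ⟨Equiv.refl _, IsSymplectic.refl, fun _ _ => rfl, fun _ _ _ => rfl,
        fun z hz => ⟨0, by simp, lineIn_zero.2 (hOD hz)⟩, fun z hz _ => ⟨0, 1, one_pos, by simp,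
          by simp, by simp, lineIn_zero.2 (hOD (hCO hz)), by simp⟩⟩
    | succ N ih =>
      obtain ⟨γ, h1, h2, h3, h4, h5⟩ := ih
      refine ⟨γ.trans g, h1.trans hg, fun z hz => ?_, fun θ hθ z => ?_, fun z hz => ?_,
        fun z hz hre => ?_⟩
      · simp only [Equiv.trans_apply, h2 z hz, hgid z hz]
      · simp only [Equiv.trans_apply, h3 θ hθ, hgrot θ hθ]
      · obtain ⟨t, ht, hl⟩ := h4 z hz
        have hzO : action (γ z) ∈ O := ht ▸ hOinv _ hz _ hl
        obtain ⟨t', ht', hl'⟩ := hgline _ hzO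
        refine ⟨t + t', ?_, hl.add ?_⟩
        · rw [Equiv.trans_apply, ht', ht, add_smul, add_assoc]
        · rw [← ht]; exact hOD' hl'
      · obtain ⟨t, s, hs, hm, him, ht, hl, hN⟩ := h5 z hz hre
        have hzC : action (γ z) ∈ C := ht ▸ hCinv _ hz _ hl
        have hre' : (monomial κ (γ z)).re = 0 := by
          rw [hm, Complex.re_ofReal_mul, hre, mul_zero]
        obtain ⟨t', s', hs', hm', ht', hl', him', hc'⟩ := hgre _ (hCO hzC) hre'
        have him2 : 0 ≤ t' * (monomial κ z).im := by
          rw [hm, Complex.im_ofReal_mul] at him'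
          have : 0 ≤ s * (t' * (monomial κ z).im) := by linarith
          exact nonneg_of_mul_nonneg_right this hs
        have him0 : (monomial κ z).im ≠ 0 := fun h =>
          monomial_ne_zero κ (hpos _ (hCO hz)) (Complex.ext hre h)
        -- The imaginary part of the monomial keeps its sign under the previous iterates, so
        -- successive displacements have the same sign and their sizes add up.
        have hsame : (0 ≤ t ∧ 0 ≤ t') ∨ (t ≤ 0 ∧ t' ≤ 0) := by
          rcases lt_or_gt_of_ne him0 with h | h
          · right
            exact ⟨by nlinarith, by nlinarith⟩
          · left
            exact ⟨nonneg_of_mul_nonneg_left him h, nonneg_of_mul_nonneg_left him2 h⟩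
        have habs : |t + t'| = |t| + |t'| := (abs_add_eq_add_abs_iff t t').2 hsame
        have hmem : t ∈ Set.uIcc 0 (t + t') := by
          rw [Set.mem_uIcc]
          rcases hsame with h | h
          · left; constructor <;> linarith [h.1, h.2]
          · right; constructor <;> linarith [h.1, h.2]
        refine ⟨t + t', s' * s, by positivity, ?_, by rw [add_mul]; linarith, ?_, hl.add ?_,
          fun hQl => ?_⟩
        · rw [Equiv.trans_apply, hm', hm]; push_cast; ring
        · rw [Equiv.trans_apply, ht', ht, add_smul, add_assoc]
        · rw [← ht]; exact hOD' hl'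
        · rw [habs]
          have h6 := hN (hQl.mono hmem)
          have h7 := hc' ⟨hzC, by rw [ht]; exact hQl t hmem⟩
          push_cast
          linarith
  obtain ⟨i₀, hi₀⟩ : ∃ i, κ i ≠ 0 := by
    by_contra h
    push Not at h
    exact hκ (funext h)
  obtain ⟨R, hR⟩ := hQ.isBounded.exists_norm_le
  -- `Q` lies in the ball of radius `R` and κ has an entry of size at least 1, so a segment inside
  -- `Q` has `|t| ≤ 2 * R`; `N` steps of length at least `c` exceed this.
  obtain ⟨N, hN⟩ := exists_nat_gt (2 * R / c)
  obtain ⟨γ, h1, h2, h3, h4, h5⟩ := iter N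
  refine ⟨γ, K, h1, hK, hKO, h2, h3, h4, fun z hz hre => ?_⟩
  obtain ⟨t, s, hs, hm, him, ht, hl, hN'⟩ := h5 z hz hre
  refine ⟨t, him, ht, hl, fun hQl => ?_⟩
  have e1 := hN' hQl
  have e2 := hR _ hQl.left_mem
  have e3 := hR _ hQl.right_mem
  have e4 : |t| ≤ 2 * R := by
    have h6 : ‖t • (fun i => (κ i : ℝ))‖ ≤ 2 * R := by
      have : t • (fun i => (κ i : ℝ)) =
        (action z + t • (fun i => (κ i : ℝ))) - action z := by abel
      rw [this]
      exact (norm_sub_le _ _).trans (by linarith)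
    have h7 := (norm_le_pi_norm (t • (fun i => (κ i : ℝ))) i₀).trans h6
    simp only [Pi.smul_apply, smul_eq_mul, norm_mul, Real.norm_eq_abs] at h7
    have h8 : (1 : ℝ) ≤ |(κ i₀ : ℝ)| := by
      have := Int.one_le_abs hi₀
      exact_mod_cast this
    nlinarith [abs_nonneg t]
  rw [div_lt_iff₀ hc] at hN
  linarith

end ZoneMap

/-! ### Closeness of approximations and small perturbations of the integrable part. -/

section Perturbation

variable {d : ℕ}

lemma exists_cutoff (d l : ℕ) : ∃ f : Phase d → ℝ, ContDiff ℝ ∞ f ∧ HasCompactSupport f ∧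
    ∀ x ∈ Metric.closedBall (0 : Phase d) l, f x = 1 := by
  obtain ⟨f, h1, h2, -, -, -, h3⟩ := exists_bump
    (isCompact_closedBall (0 : Phase d) (l : ℝ)) isOpen_univ (Set.subset_univ _)
  exact ⟨f, h1, h2, h3⟩

/-- A smooth compactly supported function which is `1` on the ball of radius `l`. -/
def cutoff (d l : ℕ) : Phase d → ℝ := (exists_cutoff d l).choose

lemma contDiff_cutoff (d l : ℕ) : ContDiff ℝ ∞ (cutoff d l) := (exists_cutoff d l).choose_spec.1

lemma hasCompactSupport_cutoff (d l : ℕ) : HasCompactSupport (cutoff d l) :=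
  (exists_cutoff d l).choose_spec.2.1

lemma cutoff_eq_one {l : ℕ} {x : Phase d} (hx : ‖x‖ ≤ l) : cutoff d l x = 1 :=
  (exists_cutoff d l).choose_spec.2.2 x (by simpa using hx)

/-- The Hamiltonians `h ∘ action ∘ G` and `h' ∘ action ∘ G'`, and their flows, are close to each
other. -/
structure FlowClose (j : ℕ) (R ε : ℝ) (h : (Fin d → ℝ) → ℝ) (G : Phase d ≃ Phase d)
    (h' : (Fin d → ℝ) → ℝ) (G' : Phase d ≃ Phase d) : Prop where
  flow : ∀ t z, |t| ≤ R → ‖z‖ ≤ R → dist (conjFlow h G t z) (conjFlow h' G' t z) ≤ ε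
  deriv : ∀ l ≤ j, ∀ n ≤ j, ∀ z, ‖iteratedFDeriv ℝ n
    (fun w => cutoff d l w * (h' (action (G' w)) - h (action (G w)))) z‖ ≤ ε
  ham : ∀ z, ‖z‖ ≤ 1 → |h' (action (G' z)) - h (action (G z))| ≤ ε * ‖z‖ ^ 3
  freq : ∀ r, ‖r‖ ≤ j → ‖grad h' r - grad h r‖ ≤ ε

lemma contDiff_ham {h : (Fin d → ℝ) → ℝ} (hh : ContDiff ℝ ∞ h) {G : Phase d ≃ Phase d}
    (hG : IsSymplectic G) : ContDiff ℝ ∞ (fun z => h (action (G z))) :=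
  hh.comp (contDiff_action.comp hG.contDiff)

lemma FlowClose.trans {j : ℕ} {R ε ε' : ℝ} {h₁ h₂ h₃ : (Fin d → ℝ) → ℝ}
    {G₁ G₂ G₃ : Phase d ≃ Phase d} (hh₁ : ContDiff ℝ ∞ h₁) (hh₂ : ContDiff ℝ ∞ h₂)
    (hh₃ : ContDiff ℝ ∞ h₃) (hG₁ : IsSymplectic G₁) (hG₂ : IsSymplectic G₂)
    (hG₃ : IsSymplectic G₃) (h : FlowClose j R ε h₁ G₁ h₂ G₂)
    (h' : FlowClose j R ε' h₂ G₂ h₃ G₃) : FlowClose j R (ε + ε') h₁ G₁ h₃ G₃ where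
  flow t z ht hz := (dist_triangle _ _ _).trans (add_le_add (h.flow t z ht hz) (h'.flow t z ht hz))
  deriv l hl n hn z := by
    have e1 : ContDiff ℝ n
        (fun w => cutoff d l w * (h₂ (action (G₂ w)) - h₁ (action (G₁ w)))) :=
      ((contDiff_cutoff d l).mul ((contDiff_ham hh₂ hG₂).sub (contDiff_ham hh₁ hG₁))).of_le
        (WithTop.coe_le_coe.2 le_top)
    have e2 : ContDiff ℝ n
        (fun w => cutoff d l w * (h₃ (action (G₃ w)) - h₂ (action (G₂ w)))) :=
      ((contDiff_cutoff d l).mul ((contDiff_ham hh₃ hG₃).sub (contDiff_ham hh₂ hG₂))).of_le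
        (WithTop.coe_le_coe.2 le_top)
    have e3 : (fun w => cutoff d l w * (h₃ (action (G₃ w)) - h₁ (action (G₁ w)))) =
        (fun w => cutoff d l w * (h₂ (action (G₂ w)) - h₁ (action (G₁ w)))) +
        (fun w => cutoff d l w * (h₃ (action (G₃ w)) - h₂ (action (G₂ w)))) := by
      funext w; simp only [Pi.add_apply]; ring
    rw [e3, iteratedFDeriv_add_apply e1.contDiffAt e2.contDiffAt]
    exact (norm_add_le _ _).trans (add_le_add (h.deriv l hl n hn z) (h'.deriv l hl n hn z))
  ham z hz := by
    have e : h₃ (action (G₃ z)) - h₁ (action (G₁ z)) =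
      (h₂ (action (G₂ z)) - h₁ (action (G₁ z))) + (h₃ (action (G₃ z)) - h₂ (action (G₂ z))) := by
      ring
    rw [e, add_mul]
    exact (abs_add_le _ _).trans (add_le_add (h.ham z hz) (h'.ham z hz))
  freq r hr := by
    have e : grad h₃ r - grad h₁ r = (grad h₂ r - grad h₁ r) + (grad h₃ r - grad h₂ r) := by abel
    rw [e]
    exact (norm_add_le _ _).trans (add_le_add (h.freq r hr) (h'.freq r hr))

/-- The perturbation `h + ∑ c_i u_i`. -/
def perturbed {N : ℕ} (h : (Fin d → ℝ) → ℝ) (u : Fin N → (Fin d → ℝ) → ℝ) (c : Fin N → ℝ)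
    (r : Fin d → ℝ) : ℝ :=
  h r + ∑ i, c i * u i r

lemma contDiff_perturbed {N : ℕ} {h : (Fin d → ℝ) → ℝ} (hh : ContDiff ℝ ∞ h)
    {u : Fin N → (Fin d → ℝ) → ℝ} (hu : ∀ i, ContDiff ℝ ∞ (u i)) (c : Fin N → ℝ) :
    ContDiff ℝ ∞ (perturbed h u c) :=
  hh.add (ContDiff.sum fun i _ => contDiff_const.mul (hu i))

lemma grad_perturbed {N : ℕ} {h : (Fin d → ℝ) → ℝ} (hh : ContDiff ℝ ∞ h)
    {u : Fin N → (Fin d → ℝ) → ℝ} (hu : ∀ i, ContDiff ℝ ∞ (u i)) (c : Fin N → ℝ)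
    (r : Fin d → ℝ) : grad (perturbed h u c) r = grad h r + ∑ i, c i • grad (u i) r := by
  have h1 : HasFDerivAt (perturbed h u c)
      (fderiv ℝ h r + ∑ i, c i • fderiv ℝ (u i) r) r := by
    refine (hh.differentiable (by simp) r).hasFDerivAt.add ?_
    exact HasFDerivAt.fun_sum fun i _ =>
      ((hu i).differentiable (by simp) r).hasFDerivAt.const_mul (c i)
  funext j
  simp [grad, h1.fderiv]

lemma norm_action_le (z : Phase d) : ‖action z‖ ≤ ‖z‖ ^ 2 := by
  rw [norm_sq_eq_sum_action]
  refine (pi_norm_le_iff_of_nonneg (by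
    have := Finset.sum_nonneg fun i (_ : i ∈ Finset.univ) => action_nonneg z i
    positivity)).2 fun i => ?_
  rw [Real.norm_eq_abs, abs_of_nonneg (action_nonneg z i)]
  have h1 := Finset.single_le_sum (fun i (_ : i ∈ Finset.univ) => action_nonneg z i)
    (Finset.mem_univ i)
  have h2 := action_nonneg z i
  linarith

lemma isBigO_comp_action {u : (Fin d → ℝ) → ℝ} (hu : u =O[𝓝 0] fun r => ‖r‖ ^ 2) :
    (fun z : Phase d => u (action z)) =O[𝓝 0] fun z => ‖z‖ ^ 3 := by
  have ht : Tendsto (fun z : Phase d => action z) (𝓝 0) (𝓝 0) := by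
    have := (continuous_action (d := d)).tendsto 0
    have h0 : action (0 : Phase d) = 0 := by funext i; simp [action]
    rwa [h0] at this
  refine (hu.comp_tendsto ht).trans (Asymptotics.IsBigO.of_bound 1 ?_)
  filter_upwards [Metric.closedBall_mem_nhds (0 : Phase d) one_pos] with z hz
  rw [mem_closedBall_zero_iff] at hz
  rw [one_mul, Real.norm_of_nonneg (by simp), Real.norm_of_nonneg (by positivity)]
  have h1 := norm_action_le z
  calc ‖action z‖ ^ 2 ≤ (‖z‖ ^ 2) ^ 2 := pow_le_pow_left₀ (norm_nonneg _) h1 2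
    _ = ‖z‖ ^ 3 * ‖z‖ := by ring
    _ ≤ ‖z‖ ^ 3 * 1 := mul_le_mul_of_nonneg_left hz (by positivity)
    _ = ‖z‖ ^ 3 := mul_one _

lemma exists_bound_on_unit_ball {g : Phase d → ℝ} (hg : Continuous g)
    (h0 : g =O[𝓝 0] fun z => ‖z‖ ^ 3) : ∃ B, ∀ z, ‖z‖ ≤ 1 → |g z| ≤ B * ‖z‖ ^ 3 := by
  obtain ⟨B, hB⟩ := h0.bound
  obtain ⟨s, hs, hsB⟩ := Metric.eventually_nhds_iff.1 hB
  obtain ⟨A, hA⟩ := (isCompact_closedBall (0 : Phase d) 1).exists_bound_of_continuousOn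
    hg.continuousOn
  have hA0 : 0 ≤ A := (norm_nonneg _).trans (hA 0 (by simp))
  refine ⟨max B (A / s ^ 3), fun z hz => ?_⟩
  rcases lt_or_ge ‖z‖ s with h | h
  · have := hsB (y := z) (by simpa using h)
    simp only [Real.norm_eq_abs, abs_pow, abs_norm] at this
    exact this.trans (mul_le_mul_of_nonneg_right (le_max_left _ _) (by positivity))
  · have h1 := hA z (by simpa using hz)
    rw [Real.norm_eq_abs] at h1
    have h2 : A ≤ A / s ^ 3 * ‖z‖ ^ 3 := by
      rw [div_mul_eq_mul_div, le_div_iff₀ (by positivity)]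
      exact mul_le_mul_of_nonneg_left (pow_le_pow_left₀ hs.le h 3) hA0
    exact h1.trans (h2.trans (mul_le_mul_of_nonneg_right (le_max_right _ _) (by positivity)))

lemma continuous_conjFlow_perturbed {h : (Fin d → ℝ) → ℝ} (hh : ContDiff ℝ ∞ h)
    {G : Phase d ≃ Phase d} (hG : IsSymplectic G) {N : ℕ} {u : Fin N → (Fin d → ℝ) → ℝ}
    (hu : ∀ i, ContDiff ℝ ∞ (u i)) :
    Continuous fun q : (Fin N → ℝ) × (ℝ × Phase d) =>
      conjFlow (perturbed h u q.1) G q.2.1 q.2.2 := by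
  have c0 : Continuous fun q : (Fin N → ℝ) × (ℝ × Phase d) => G q.2.2 :=
    hG.contDiff.continuous.comp (by fun_prop)
  have c1 : Continuous fun q : (Fin N → ℝ) × (ℝ × Phase d) => action (G q.2.2) :=
    continuous_action.comp c0
  have c2 : Continuous fun q : (Fin N → ℝ) × (ℝ × Phase d) => grad h (action (G q.2.2)) :=
    (continuous_grad hh).comp c1
  have c3 : ∀ i, Continuous fun q : (Fin N → ℝ) × (ℝ × Phase d) =>
      grad (u i) (action (G q.2.2)) := fun i => (continuous_grad (hu i)).comp c1
  have c4 : Continuous fun q : (Fin N → ℝ) × (ℝ × Phase d) =>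
      grad (perturbed h u q.1) (action (G q.2.2)) := by
    simp only [grad_perturbed hh hu]
    exact c2.add (continuous_finsetSum _ fun i _ =>
      (((continuous_apply i).comp continuous_fst).smul (c3 i)))
  have c5 : Continuous fun q : (Fin N → ℝ) × (ℝ × Phase d) =>
      q.2.1 • grad (perturbed h u q.1) (action (G q.2.2)) :=
    (continuous_fst.comp continuous_snd).smul c4
  have c6 : Continuous fun q : (Fin N → ℝ) × (ℝ × Phase d) =>
      rotate (q.2.1 • grad (perturbed h u q.1) (action (G q.2.2))) (G q.2.2) := by
    have := (continuous_rotate (d := d)).comp (c5.prodMk c0)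
    exact this
  exact hG.contDiff_symm.continuous.comp c6

/-- The change of the Hamiltonian is linear in the finitely many coefficients, each multiplying a
function with bounded seminorms; the flow depends continuously on the coefficients, uniformly on
compact sets. The cubic bound at the origin uses that `G` is the identity there and that actions are
quadratic in `z`. -/
lemma exists_flowClose_perturbed {h : (Fin d → ℝ) → ℝ} (hh : ContDiff ℝ ∞ h)
    {G : Phase d ≃ Phase d} (hG : IsSymplectic G) (hG0 : ∀ᶠ z in 𝓝 0, G z = z)
    {N : ℕ} {u : Fin N → (Fin d → ℝ) → ℝ} (hu : ∀ i, ContDiff ℝ ∞ (u i))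
    (hu0 : ∀ i, u i =O[𝓝 0] fun r => ‖r‖ ^ 2) (j : ℕ) (R : ℝ) {ε : ℝ} (hε : 0 < ε) :
    ∃ η > 0, ∀ c : Fin N → ℝ, ‖c‖ < η → FlowClose j R ε h G (perturbed h u c) G := by
  have key : ∀ᶠ c : Fin N → ℝ in 𝓝 0, FlowClose j R ε h G (perturbed h u c) G := by
    set g : Fin N → Phase d → ℝ := fun i z => u i (action (G z)) with hg
    have hgs : ∀ i, ContDiff ℝ ∞ (g i) := fun i => contDiff_ham (hu i) hG
    have hdiff : ∀ c z, perturbed h u c (action (G z)) - h (action (G z)) =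
        ∑ i, c i * g i z := fun c z => by simp [perturbed, hg]
    -- a sum of bounded terms with small coefficients
    have hsmall : ∀ B : Fin N → ℝ, ∀ᶠ c : Fin N → ℝ in 𝓝 0, ∑ i, |c i| * B i ≤ ε := by
      intro B
      have : Tendsto (fun c : Fin N → ℝ => ∑ i, |c i| * B i) (𝓝 0) (𝓝 0) := by
        have hc : Continuous fun c : Fin N → ℝ => ∑ i, |c i| * B i := by fun_prop
        simpa using hc.tendsto 0
      exact (this.eventually (gt_mem_nhds hε)).mono fun c hc => hc.le
    have hflow : ∀ᶠ c : Fin N → ℝ in 𝓝 0, ∀ p ∈ Metric.closedBall (0 : ℝ) R ×ˢ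
        Metric.closedBall (0 : Phase d) R,
        dist (conjFlow h G p.1 p.2) (conjFlow (perturbed h u c) G p.1 p.2) ≤ ε := by
      refine ((isCompact_closedBall _ _).prod
        (isCompact_closedBall _ _)).eventually_forall_of_forall_eventually fun p hp => ?_
      have h0 : perturbed h u 0 = h := by funext r; simp [perturbed]
      have hcont : Continuous fun q : (Fin N → ℝ) × (ℝ × Phase d) =>
          dist (conjFlow h G q.2.1 q.2.2) (conjFlow (perturbed h u q.1) G q.2.1 q.2.2) := by
        refine Continuous.dist ?_ (continuous_conjFlow_perturbed hh hG hu)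
        have := (continuous_conjFlow_perturbed hh hG hu).comp
          (continuous_const.prodMk continuous_snd :
            Continuous fun q : (Fin N → ℝ) × (ℝ × Phase d) => ((0 : Fin N → ℝ), q.2))
        simpa only [Function.comp_def, h0] using this
      have ht := hcont.tendsto (0, p)
      simp only [h0, dist_self] at ht
      exact (ht.eventually (gt_mem_nhds hε)).mono fun q hq => hq.le
    have hderiv : ∀ᶠ c : Fin N → ℝ in 𝓝 0, ∀ l ∈ Finset.range (j + 1), ∀ n ∈ Finset.range (j + 1),
        ∀ z, ‖iteratedFDeriv ℝ n (fun w => cutoff d l w * (∑ i, c i * g i w)) z‖ ≤ ε := by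
      rw [Filter.eventually_all_finset]
      intro l _
      rw [Filter.eventually_all_finset]
      intro n _
      have hs : ∀ i, ContDiff ℝ ∞ (fun w => cutoff d l w * g i w) := fun i =>
        (contDiff_cutoff d l).mul (hgs i)
      have hb : ∀ i, ∃ B, ∀ z, ‖iteratedFDeriv ℝ n (fun w => cutoff d l w * g i w) z‖ ≤ B :=
        fun i => by
          have hc : HasCompactSupport (fun w => cutoff d l w * g i w) :=
            (hasCompactSupport_cutoff d l).mul_right
          exact (hc.iteratedFDeriv (𝕜 := ℝ) n).exists_bound_of_continuous
            ((hs i).continuous_iteratedFDeriv (WithTop.coe_le_coe.2 le_top))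
      choose B hB using hb
      filter_upwards [hsmall B] with c hc z
      have e : (fun w => cutoff d l w * (∑ i, c i * g i w)) =
          fun w => ∑ i, c i • (cutoff d l w * g i w) := by
        funext w
        rw [Finset.mul_sum]
        exact Finset.sum_congr rfl fun i _ => by simp; ring
      have hs' : ∀ i, ContDiff ℝ n (fun w => cutoff d l w * g i w) := fun i =>
        (hs i).of_le (WithTop.coe_le_coe.2 le_top)
      rw [e, iteratedFDeriv_fun_sum_apply fun i _ => ((hs' i).const_smul (c i)).contDiffAt]
      refine (norm_sum_le _ _).trans (le_trans (Finset.sum_le_sum fun i _ => ?_) hc)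
      rw [iteratedFDeriv_const_smul_apply' (hs' i).contDiffAt, norm_smul, Real.norm_eq_abs]
      exact mul_le_mul_of_nonneg_left (hB i z) (abs_nonneg _)
    have hham : ∀ᶠ c : Fin N → ℝ in 𝓝 0, ∀ z : Phase d, ‖z‖ ≤ 1 →
        |∑ i, c i * g i z| ≤ ε * ‖z‖ ^ 3 := by
      have hb : ∀ i, ∃ B, ∀ z : Phase d, ‖z‖ ≤ 1 → |g i z| ≤ B * ‖z‖ ^ 3 := fun i => by
        refine exists_bound_on_unit_ball (hgs i).continuous ?_
        refine Asymptotics.IsBigO.congr' (isBigO_comp_action (hu0 i)) ?_ EventuallyEq.rfl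
        filter_upwards [hG0] with z hz
        simp only [hg, hz]
      choose B hB using hb
      filter_upwards [hsmall B] with c hc z hz
      refine (Finset.abs_sum_le_sum_abs _ _).trans ?_
      refine le_trans (Finset.sum_le_sum (g := fun i => |c i| * B i * ‖z‖ ^ 3) fun i _ => ?_) ?_
      · rw [abs_mul, mul_assoc]
        exact mul_le_mul_of_nonneg_left (hB i z hz) (abs_nonneg _)
      · rw [← Finset.sum_mul]
        exact mul_le_mul_of_nonneg_right hc (by positivity)
    have hgrad : ∀ᶠ c : Fin N → ℝ in 𝓝 0, ∀ r ∈ Metric.closedBall (0 : Fin d → ℝ) j,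
        ‖∑ i, c i • grad (u i) r‖ ≤ ε := by
      have hb : ∀ i, ∃ B, ∀ r ∈ Metric.closedBall (0 : Fin d → ℝ) j, ‖grad (u i) r‖ ≤ B :=
        fun i => (isCompact_closedBall _ _).exists_bound_of_continuousOn
          (continuous_grad (hu i)).continuousOn
      choose B hB using hb
      filter_upwards [hsmall B] with c hc r hr
      refine (norm_sum_le _ _).trans (le_trans (Finset.sum_le_sum fun i _ => ?_) hc)
      rw [norm_smul, Real.norm_eq_abs]
      exact mul_le_mul_of_nonneg_left (hB i r hr) (abs_nonneg _)
    filter_upwards [hflow, hderiv, hham, hgrad] with c h1 h2 h3 h4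
    refine ⟨fun t z ht hz => h1 (t, z) ⟨by simpa using ht, by simpa using hz⟩,
      fun l hl n hn z => ?_, fun z hz => ?_, fun r hr => ?_⟩
    · simp only [hdiff]
      exact h2 l (by simp; omega) n (by simp; omega) z
    · rw [hdiff]; exact h3 z hz
    · rw [grad_perturbed hh hu, add_sub_cancel_left]
      exact h4 r (by simpa using hr)
  obtain ⟨η, hη, h⟩ := Metric.eventually_nhds_iff.1 key
  exact ⟨η, hη, fun c hc => h (by simpa using hc)⟩

end Perturbation

/-! ### Gluing maps over disjoint zones, and the axioms for a system of zones. -/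

section Composition

variable {d : ℕ}

/-- Maps supported on disjoint invariant sets are combined into a single map. -/
lemma exists_combined_map {D : Set (Fin d → ℝ)} (S : Finset ℕ) (O : ℕ → Set (Fin d → ℝ))
    (K : ℕ → Set (Fin d → ℝ)) (γ : ℕ → Phase d ≃ Phase d)
    (hdisj : ∀ m ∈ S, ∀ m' ∈ S, m ≠ m' → Disjoint (O m) (O m'))
    (hγ : ∀ m ∈ S, IsSymplectic (γ m)) (hK : ∀ m ∈ S, IsCompact (K m))
    (hKO : ∀ m ∈ S, K m ⊆ O m) (hOD : ∀ m ∈ S, O m ⊆ D)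
    (hid : ∀ m ∈ S, ∀ z, action z ∉ K m → γ m z = z)
    (hmap : ∀ m ∈ S, ∀ z, action z ∈ O m → action (γ m z) ∈ O m) :
    ∃ (Γ : Phase d ≃ Phase d) (L : Set (Fin d → ℝ)), IsSymplectic Γ ∧ IsCompact L ∧ L ⊆ D ∧
      (∀ z, action z ∉ L → Γ z = z) ∧ (∀ m ∈ S, ∀ z, action z ∈ O m → Γ z = γ m z) ∧
      ∀ z, (∀ m ∈ S, action z ∉ O m) → Γ z = z := by
  induction S using Finset.induction_on with
  | empty =>
    exact ⟨Equiv.refl _, ∅, IsSymplectic.refl, isCompact_empty, Set.empty_subset _,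
      fun _ _ => rfl, fun m hm => absurd hm (Finset.notMem_empty m), fun _ _ => rfl⟩
  | insert a S ha ih =>
    obtain ⟨Γ, L, h1, h2, h3, h4, h5, h6⟩ := ih
      (fun m hm m' hm' => hdisj m (by simp [hm]) m' (by simp [hm']))
      (fun m hm => hγ m (by simp [hm])) (fun m hm => hK m (by simp [hm]))
      (fun m hm => hKO m (by simp [hm])) (fun m hm => hOD m (by simp [hm]))
      (fun m hm => hid m (by simp [hm])) (fun m hm => hmap m (by simp [hm]))
    have hain : a ∈ insert a S := Finset.mem_insert_self a S
    have hne : ∀ m ∈ S, m ≠ a := fun m hm h => ha (h ▸ hm)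
    refine ⟨Γ.trans (γ a), L ∪ K a, h1.trans (hγ a hain), h2.union (hK a hain),
      Set.union_subset h3 ((hKO a hain).trans (hOD a hain)), fun z hz => ?_, fun m hm z hz => ?_,
      fun z hz => ?_⟩
    · rw [Set.mem_union, not_or] at hz
      rw [Equiv.trans_apply, h4 z hz.1, hid a hain z hz.2]
    · rcases Finset.mem_insert.1 hm with rfl | hm
      · rw [Equiv.trans_apply, h6 z fun m' hm' hz' => ?_]
        exact Set.disjoint_left.1 (hdisj m' (by simp [hm']) m hain (hne m' hm')) hz' hz
      · rw [Equiv.trans_apply, h5 m hm z hz]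
        refine hid a hain _ fun hK' => ?_
        exact Set.disjoint_left.1 (hdisj m (by simp [hm]) a hain (hne m hm))
          (hmap m (by simp [hm]) z hz) (hKO a hain hK')
    · rw [Equiv.trans_apply, h6 z fun m hm => hz m (by simp [hm])]
      exact hid a hain z fun h => hz a hain (hKO a hain h)

/-- A function which is constant along `κ` has a gradient which is constant along `κ`. -/
lemma eq_of_lineIn_of_resonant {D O : Set (Fin d → ℝ)} {κ : Fin d → ℤ} {h : (Fin d → ℝ) → ℝ}
    (hh : ContDiff ℝ ∞ h) (hO : IsOpen O) (hinv : LineInvariant D κ O)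
    (hres : ∀ r ∈ O, ∑ i, κ i * grad h r i = 0) {ρ : Fin d → ℝ} (hρ : ρ ∈ O) {t : ℝ}
    (hl : LineIn D κ ρ t) :
    h (ρ + t • (fun i => (κ i : ℝ))) = h ρ ∧
      grad h (ρ + t • (fun i => (κ i : ℝ))) = grad h ρ := by
  set v : Fin d → ℝ := fun i => (κ i : ℝ) with hv
  have hlO : ∀ s ∈ Set.uIcc 0 t, ρ + s • v ∈ O := fun s hs => hinv ρ hρ s (hl.mono hs)
  have hconst : ∀ r, (∀ s ∈ Set.uIcc 0 t, r + s • v ∈ O) → h (r + t • v) = h r := by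
    intro r hr
    have hd : ∀ s ∈ Set.uIcc 0 t,
        HasDerivWithinAt (fun s => h (r + s • v)) 0 (Set.uIcc 0 t) s := by
      intro s hs
      have h1 : HasDerivAt (fun s : ℝ => r + s • v) v s := by
        simpa using ((hasDerivAt_id s).smul_const v).const_add r
      have h2 := ((hh.differentiable (by simp) (r + s • v)).hasFDerivAt).comp_hasDerivAt s h1
      rw [fderiv_eq_sum_grad] at h2
      have h3 := hres _ (hr s hs)
      rw [hv] at h2
      rw [h3] at h2
      exact h2.hasDerivWithinAt
    have := (convex_uIcc (0 : ℝ) t).norm_image_sub_le_of_norm_hasDerivWithin_le (C := 0) hd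
      (fun s _ => by simp) Set.left_mem_uIcc Set.right_mem_uIcc
    simpa [sub_eq_zero] using this
  refine ⟨hconst ρ hlO, ?_⟩
  -- Segments starting near `ρ` also stay in `O`, so `h` and its translate agree near `ρ` and have
  -- the same derivative there.
  have hev : ∀ᶠ r in 𝓝 ρ, ∀ s ∈ Set.uIcc 0 t, r + s • v ∈ O := by
    refine isCompact_uIcc.eventually_forall_of_forall_eventually fun s hs => ?_
    have hc : Continuous fun q : (Fin d → ℝ) × ℝ => q.1 + q.2 • v := by fun_prop
    exact (hc.tendsto (ρ, s)).eventually (hO.mem_nhds (hlO s hs))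
  have heq : (fun r => h (r + t • v)) =ᶠ[𝓝 ρ] h := hev.mono fun r hr => hconst r hr
  have := heq.fderiv_eq (𝕜 := ℝ)
  rw [fderiv_comp_add_right (𝕜 := ℝ) (f := h)] at this
  funext i
  simp only [grad, this]

end Composition

/-- A resonant covering of a domain `D` in the space of actions: the sets `C m` cover `D`, and in a
neighbourhood `O m` of `C m` the admissible Hamiltonians may be made resonant with a direction in
`dir m`, along which `O m` and `C m` are invariant inside `D`. The sets `Q j` exhaust `D`. -/
structure ZoneSystem (d : ℕ) where
  D : Set (Fin d → ℝ)
  pos : ∀ r ∈ D, ∀ i, 0 < r i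
  zero_notMem : (0 : Fin d → ℝ) ∉ D
  Q : ℕ → Set (Fin d → ℝ)
  isCompact_Q : ∀ j, IsCompact (Q j)
  Q_subset : ∀ j, Q j ⊆ D
  monotone_Q : Monotone Q
  exists_subset_Q : ∀ K, IsCompact K → K ⊆ D → ∃ j, K ⊆ Q j
  -- Convexity of the exhaustion along segments of `D`: if a segment is not contained in `Q j`, its
  -- two ends cannot both lie in `Q j`.
  lineIn_Q : ∀ j κ ρ t, ρ ∈ Q j → ρ + t • (fun i => ((κ : Fin d → ℤ) i : ℝ)) ∈ Q j →
    LineIn D κ ρ t → LineIn (Q j) κ ρ t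
  O : ℕ → Set (Fin d → ℝ)
  C : ℕ → Set (Fin d → ℝ)
  isOpen_O : ∀ m, IsOpen (O m)
  O_subset : ∀ m, O m ⊆ D
  C_subset : ∀ m, C m ⊆ O m
  isCompact_C_inter : ∀ m K, IsCompact K → K ⊆ D → IsCompact (C m ∩ K)
  cover : ∀ r ∈ D, ∃ m, r ∈ C m
  disjoint_O : ∀ m m', m ≠ m' → m % 2 = m' % 2 → Disjoint (O m) (O m')
  finite_C : ∀ K, IsCompact K → K ⊆ D → ∃ M, ∀ m, (C m ∩ K).Nonempty → m < M
  dir : ℕ → Set (Fin d → ℤ)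
  dir_ne : ∀ m, ∀ κ ∈ dir m, κ ≠ 0
  inv_O : ∀ m, ∀ κ ∈ dir m, LineInvariant D κ (O m)
  inv_C : ∀ m, ∀ κ ∈ dir m, LineInvariant D κ (C m)
  Adm : ((Fin d → ℝ) → ℝ) → Prop
  contDiff_of_adm : ∀ h, Adm h → ContDiff ℝ ∞ h
  -- One axiom for two uses: `M = 0` only creates resonances in the first `M'` zones, `M' = 0` only
  -- destroys the existing ones in the first `M` zones.
  perturb : ∀ h, Adm h → ∀ (M M' : ℕ) (kv : ℕ → Fin d → ℤ),
    (∀ m < M, kv m ∈ dir m ∧ ∀ r ∈ O m, ∑ i, kv m i * grad h r i = 0) →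
    ∃ (N : ℕ) (u : Fin N → (Fin d → ℝ) → ℝ), (∀ i, ContDiff ℝ ∞ (u i)) ∧
      (∀ i, u i =O[𝓝 0] fun r => ‖r‖ ^ 2) ∧
      ∀ η > 0, ∃ c : Fin N → ℝ, ‖c‖ < η ∧ Adm (perturbed h u c) ∧
        (∃ kv' : ℕ → Fin d → ℤ, ∀ m < M', kv' m ∈ dir m ∧
          ∀ r ∈ O m, ∑ i, kv' m i * grad (perturbed h u c) r i = 0) ∧
        ∀ m < M, ∀ r ∈ C m, ∑ i, kv m i * grad (perturbed h u c) r i ≠ 0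

/-! ### Approximations on a zone system and the map commuting with a resonant flow. -/

namespace ZoneSystem

variable {d : ℕ} (Z : ZoneSystem d)

/-- The integrable Hamiltonian `h` and the change of coordinates `G` define one of the
approximations `h ∘ action ∘ G`. -/
structure IsState (h : (Fin d → ℝ) → ℝ) (G : Phase d ≃ Phase d) : Prop where
  adm : Z.Adm h
  symplectic : IsSymplectic G
  support : ∃ K, IsCompact K ∧ K ⊆ Z.D ∧ ∀ z, action z ∉ K → G z = z

/-- Near the origin there are orbits that may be driven far away, below any given compact set. -/
def Drift : Prop :=
  ∀ A > 0, ∀ K, IsCompact K → K ⊆ Z.D → ∀ m₀ : ℕ, ∃ m, m % 2 = m₀ % 2 ∧ ∃ ρ ∈ Z.C m,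
    2 * ∑ i, ρ i < A⁻¹ ^ 2 ∧ ∃ L, IsCompact L ∧ L ⊆ Z.D ∧ ∀ κ ∈ Z.dir m, (∀ i, 0 ≤ κ i) ∧
      ∀ t, LineIn Z.D κ ρ t → ρ + t • (fun i => (κ i : ℝ)) ∉ K ∧
        (0 ≤ t → ∑ i, (ρ + t • (fun i => (κ i : ℝ))) i < A ^ 2 →
          ρ + t • (fun i => (κ i : ℝ)) ∈ L)

variable {Z} {h : (Fin d → ℝ) → ℝ} {G : Phase d ≃ Phase d}

lemma IsState.eventually_eq (hs : Z.IsState h G) : ∀ᶠ z in 𝓝 0, G z = z := by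
  obtain ⟨K, hK, hKD, hid⟩ := hs.support
  have h0 : action (0 : Phase d) = 0 := by funext i; simp [action]
  have : ∀ᶠ z in 𝓝 (0 : Phase d), action z ∉ K :=
    ((continuous_action (d := d)).tendsto 0).eventually (hK.isClosed.isOpen_compl.mem_nhds
      (by rw [h0]; exact fun h => Z.zero_notMem (hKD h)))
  exact this.mono hid

lemma IsState.action_mem (hs : Z.IsState h G) (z : Phase d) :
    action (G z) ∈ Z.D ↔ action z ∈ Z.D := by
  obtain ⟨K, hK, hKD, hid⟩ := hs.support
  constructor
  · intro hz
    by_contra hn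
    rw [hid z fun h => hn (hKD h)] at hz
    exact hn hz
  · intro hz
    by_contra hn
    have := hid (G z) fun h => hn (hKD h)
    rw [G.injective this] at hn
    exact hn hz

lemma IsState.symm_eq (hs : Z.IsState h G) : ∃ K, IsCompact K ∧ K ⊆ Z.D ∧
    (∀ z, action z ∉ K → G z = z) ∧ ∀ z, action z ∉ K → G.symm z = z := by
  obtain ⟨K, hK, hKD, hid⟩ := hs.support
  exact ⟨K, hK, hKD, hid, fun z hz => by rw [Equiv.symm_apply_eq, hid z hz]⟩

/-- The map which moves the points of the zones of one parity along the resonances of `h`. -/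
lemma exists_resonant_map (hh : Z.Adm h) (M c j : ℕ) (kv : ℕ → Fin d → ℤ)
    (hkv : ∀ m < M, kv m ∈ Z.dir m ∧ ∀ r ∈ Z.O m, ∑ i, kv m i * grad h r i = 0) :
    ∃ Γ : Phase d ≃ Phase d, IsSymplectic Γ ∧
      (∃ K, IsCompact K ∧ K ⊆ Z.D ∧ ∀ z, action z ∉ K → Γ z = z) ∧
      (∀ t z, Γ (actionFlow h t z) = actionFlow h t (Γ z)) ∧
      (∀ z, h (action (Γ z)) = h (action z)) ∧
      (∀ m, m % 2 = c → ∀ z, action (Γ z) ∈ Z.C m ↔ action z ∈ Z.C m) ∧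
      (∀ m < M, m % 2 = c → ∀ z, action z ∈ Z.O m → ∃ t,
        action (Γ z) = action z + t • (fun i => (kv m i : ℝ)) ∧ LineIn Z.D (kv m) (action z) t) ∧
      (∀ m < M, m % 2 = c → ∀ z, action z ∈ Z.C m → (monomial (kv m) z).re = 0 → ∃ t : ℝ,
        0 ≤ t * (monomial (kv m) z).im ∧
        action (Γ z) = action z + t • (fun i => (kv m i : ℝ)) ∧ LineIn Z.D (kv m) (action z) t ∧
        ¬ LineIn (Z.Q j) (kv m) (action z) t) := by
  have hex : ∀ m, ∃ (γ : Phase d ≃ Phase d) (K : Set (Fin d → ℝ)), m < M → IsSymplectic γ ∧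
      IsCompact K ∧ K ⊆ Z.O m ∧ (∀ z, action z ∉ K → γ z = z) ∧
      (∀ θ : Fin d → ℝ, ∑ i, kv m i * θ i = 0 → ∀ z, γ (rotate θ z) = rotate θ (γ z)) ∧
      (∀ z, action z ∈ Z.O m → ∃ t, action (γ z) = action z + t • (fun i => (kv m i : ℝ)) ∧
        LineIn Z.D (kv m) (action z) t) ∧
      (∀ z, action z ∈ Z.C m → (monomial (kv m) z).re = 0 → ∃ t : ℝ,
        0 ≤ t * (monomial (kv m) z).im ∧
        action (γ z) = action z + t • (fun i => (kv m i : ℝ)) ∧ LineIn Z.D (kv m) (action z) t ∧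
        ¬ LineIn (Z.Q j) (kv m) (action z) t) := by
    intro m
    by_cases hm : m < M
    · obtain ⟨hd, -⟩ := hkv m hm
      obtain ⟨γ, K, h⟩ := exists_zone_map (Z.dir_ne m _ hd) (Z.isOpen_O m)
        (fun r hr => Z.pos r (Z.O_subset m hr)) (Z.O_subset m) (Z.C_subset m) (Z.isCompact_Q j)
        (Z.isCompact_C_inter m _ (Z.isCompact_Q j) (Z.Q_subset j)) (Z.inv_O m _ hd)
        (Z.inv_C m _ hd)
      exact ⟨γ, K, fun _ => h⟩
    · exact ⟨Equiv.refl _, ∅, fun h => absurd h hm⟩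
  choose γ K hγ using hex
  set S := (Finset.range M).filter fun m => m % 2 = c with hS
  have hSM : ∀ m ∈ S, m < M ∧ m % 2 = c := fun m hm => by simpa [hS] using hm
  have hmap : ∀ m ∈ S, ∀ z, action z ∈ Z.O m → action (γ m z) ∈ Z.O m := by
    intro m hm z hz
    obtain ⟨t, ht, hl⟩ := (hγ m (hSM m hm).1).2.2.2.2.2.1 z hz
    rw [ht]
    exact Z.inv_O m _ (hkv m (hSM m hm).1).1 _ hz _ hl
  obtain ⟨Γ, L, h1, h2, h3, h4, h5, h6⟩ := exists_combined_map (D := Z.D) S Z.O K γ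
    (fun m hm m' hm' hne => Z.disjoint_O m m' hne (by rw [(hSM m hm).2, (hSM m' hm').2]))
    (fun m hm => (hγ m (hSM m hm).1).1) (fun m hm => (hγ m (hSM m hm).1).2.1)
    (fun m hm => (hγ m (hSM m hm).1).2.2.1) (fun m _ => Z.O_subset m)
    (fun m hm => (hγ m (hSM m hm).1).2.2.2.1) hmap
  have hline : ∀ m ∈ S, ∀ z, action z ∈ Z.O m → ∃ t,
      action (Γ z) = action z + t • (fun i => (kv m i : ℝ)) ∧ LineIn Z.D (kv m) (action z) t := by
    intro m hm z hz
    rw [h5 m hm z hz]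
    exact (hγ m (hSM m hm).1).2.2.2.2.2.1 z hz
  have hmem : ∀ m, m < M → m % 2 = c → m ∈ S := fun m h h' => by simp [hS, h, h']
  -- Inside a zone the actions move along the resonant direction, along which `h` and its gradient
  -- are constant.
  have hinv : ∀ z, grad h (action (Γ z)) = grad h (action z) ∧ h (action (Γ z)) = h (action z) := by
    intro z
    by_cases hz : ∃ m ∈ S, action z ∈ Z.O m
    · obtain ⟨m, hm, hz⟩ := hz
      obtain ⟨t, ht, hl⟩ := hline m hm z hz
      have := eq_of_lineIn_of_resonant (Z.contDiff_of_adm h hh) (Z.isOpen_O m)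
        (Z.inv_O m _ (hkv m (hSM m hm).1).1) (hkv m (hSM m hm).1).2 hz hl
      rw [ht]
      exact ⟨this.2, this.1⟩
    · push Not at hz
      rw [h6 z hz]
      exact ⟨rfl, rfl⟩
  refine ⟨Γ, h1, ⟨L, h2, h3, h4⟩, fun t z => ?_, fun z => (hinv z).2, fun m hm z => ?_,
    fun m hmM hm z hz => hline m (hmem m hmM hm) z hz, fun m hmM hm z hz hre => ?_⟩
  · have hflow : actionFlow h t (Γ z) = rotate (t • grad h (action z)) (Γ z) := by
      rw [actionFlow, (hinv z).1]
    rw [hflow]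
    by_cases hz : ∃ m ∈ S, action z ∈ Z.O m
    · obtain ⟨m, hm, hz⟩ := hz
      -- The flow rotates by a multiple of the gradient, which is orthogonal to the resonant
      -- direction; such rotations commute with the map of the zone.
      rw [h5 m hm z hz, h5 m hm _ (by rw [action_actionFlow]; exact hz)]
      refine (hγ m (hSM m hm).1).2.2.2.2.1 _ ?_ z
      have := (hkv m (hSM m hm).1).2 _ hz
      simp only [Pi.smul_apply, smul_eq_mul]
      rw [← mul_zero t, ← this, Finset.mul_sum]
      exact Finset.sum_congr rfl fun i _ => by ring
    · push Not at hz
      rw [h6 z hz, h6 _ (by simpa using hz)]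
      rfl
  · by_cases hz : ∃ m' ∈ S, action z ∈ Z.O m'
    · obtain ⟨m', hm', hz⟩ := hz
      obtain ⟨t, ht, hl⟩ := hline m' hm' z hz
      by_cases he : m' = m
      · subst he
        have hC := Z.inv_C m' _ (hkv m' (hSM m' hm').1).1
        constructor
        · intro h
          rw [ht] at h
          have := hC _ h _ hl.neg
          rwa [add_assoc, ← add_smul, add_neg_cancel, zero_smul, add_zero] at this
        · intro h
          rw [ht]
          exact hC _ h _ hl
      · have hd := Z.disjoint_O m' m he (by rw [(hSM m' hm').2, hm])
        have hz' : action (Γ z) ∈ Z.O m' := by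
          rw [h5 m' hm' z hz]; exact hmap m' hm' z hz
        exact ⟨fun h => absurd (Z.C_subset m h) (Set.disjoint_left.1 hd hz'),
          fun h => absurd (Z.C_subset m h) (Set.disjoint_left.1 hd hz)⟩
    · push Not at hz
      rw [h6 z hz]
  · rw [h5 m (hmem m hmM hm) z (Z.C_subset m hz)]
    exact (hγ m hmM).2.2.2.2.2.2 z hz hre

end ZoneSystem

/-! ### The inductive step: create resonances, conjugate, break them. -/

section Step

variable {d : ℕ}

/-- Off resonance the argument of the monomial turns at constant nonzero speed, so it reaches both
π/2 and −π/2. -/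
lemma exists_monomial_rotate_eq {κ : Fin d → ℤ} {v : Fin d → ℝ} (hv : ∑ i, κ i * v i ≠ 0)
    (w : Phase d) (s : ℝ) (hs : s = 1 ∨ s = -1) :
    ∃ t : ℝ, (monomial κ (rotate (t • v) w)).re = 0 ∧
      (monomial κ (rotate (t • v) w)).im = s * ‖monomial κ w‖ := by
  set p := monomial κ w with hp
  set c := ∑ i, κ i * v i with hc
  refine ⟨(s * (Real.pi / 2) - p.arg) / c, ?_⟩
  have h1 : ∑ i, (κ i : ℝ) * (((s * (Real.pi / 2) - p.arg) / c) • v) i =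
      s * (Real.pi / 2) - p.arg := by
    have : ∑ i, (κ i : ℝ) * (((s * (Real.pi / 2) - p.arg) / c) • v) i =
        ((s * (Real.pi / 2) - p.arg) / c) * c := by
      rw [hc, Finset.mul_sum]
      exact Finset.sum_congr rfl fun i _ => by simp; ring
    rw [this, div_mul_cancel₀ _ hv]
  have h2 : monomial κ (rotate (((s * (Real.pi / 2) - p.arg) / c) • v) w) =
      (‖p‖ : ℂ) * Complex.exp (((s * (Real.pi / 2) : ℝ) : ℂ) * Complex.I) := by
    rw [monomial_rotate, h1, ← hp]
    conv_lhs => rw [← Complex.norm_mul_exp_arg_mul_I p]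
    rw [mul_left_comm, ← Complex.exp_add, ← add_mul, ← Complex.ofReal_add,
      Complex.norm_mul_exp_arg_mul_I]
    congr 4
    ring
  rw [h2, Complex.exp_mul_I, ← Complex.ofReal_cos, ← Complex.ofReal_sin]
  rcases hs with rfl | rfl
  · simp
  · simp [neg_mul]

lemma exists_action_eq {ρ : Fin d → ℝ} (hρ : ∀ i, 0 ≤ ρ i) : ∃ w : Phase d, action w = ρ := by
  refine ⟨WithLp.toLp 2 (Sum.elim (fun i => Real.sqrt (2 * ρ i)) (fun _ => 0)), ?_⟩
  funext i
  have := Real.sq_sqrt (show 0 ≤ 2 * ρ i by linarith [hρ i])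
  change (Real.sqrt (2 * ρ i) ^ 2 + 0 ^ 2) / 2 = ρ i
  rw [this]
  ring

lemma continuous_conjFlow {h : (Fin d → ℝ) → ℝ} (hh : ContDiff ℝ ∞ h) {G : Phase d ≃ Phase d}
    (hG : IsSymplectic G) : Continuous fun q : ℝ × Phase d => conjFlow h G q.1 q.2 := by
  have := (continuous_conjFlow_perturbed (N := 0) (u := fun _ _ => 0) hh hG
    (fun i => contDiff_const)).comp
    (continuous_const.prodMk continuous_id :
      Continuous fun q : ℝ × Phase d => ((0 : Fin 0 → ℝ), q))
  have h0 : perturbed h (fun (_ : Fin 0) _ => (0 : ℝ)) 0 = h := by funext r; simp [perturbed]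
  simpa only [Function.comp_def, h0] using this

/-- The two motions are `ε`-close on the ball of radius `R` up to the time `R`. -/
def MotionClose (ε R : ℝ) (Φ Ψ : ℝ → Phase d → Phase d) : Prop :=
  ∀ t z, |t| ≤ R → ‖z‖ ≤ R → dist (Φ t z) (Ψ t z) ≤ ε

lemma MotionClose.mono {ε ε' R R' : ℝ} {Φ Ψ : ℝ → Phase d → Phase d} (h : MotionClose ε R Φ Ψ)
    (hε : ε ≤ ε') (hR : R' ≤ R) : MotionClose ε' R' Φ Ψ := fun t z ht hz =>
  (h t z (ht.trans hR) (hz.trans hR)).trans hε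

/-- That all orbits of a compact set visit an open set is stable under perturbations. -/
lemma exists_motionClose_visit {Φ : ℝ → Phase d → Phase d}
    (hΦ : Continuous fun q : ℝ × Phase d => Φ q.1 q.2) {A U : Set (Phase d)} (hA : IsCompact A)
    (hU : IsOpen U) (hAU : ∀ z ∈ A, ∃ t, Φ t z ∈ U) :
    ∃ ε > 0, ∃ R, ∀ Ψ, MotionClose ε R Φ Ψ → ∀ z ∈ A, ∃ t, Ψ t z ∈ U := by
  refine hA.induction_on (p := fun A => ∃ ε > 0, ∃ R, ∀ Ψ, MotionClose ε R Φ Ψ →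
    ∀ z ∈ A, ∃ t, Ψ t z ∈ U) ⟨1, one_pos, 0, by simp⟩ ?_ ?_ fun z hz => ?_
  · rintro s t hst ⟨ε, hε, R, h⟩
    exact ⟨ε, hε, R, fun Ψ hΨ z hz => h Ψ hΨ z (hst hz)⟩
  · rintro s t ⟨ε, hε, R, h⟩ ⟨ε', hε', R', h'⟩
    refine ⟨min ε ε', lt_min hε hε', max R R', fun Ψ hΨ z hz => ?_⟩
    rcases hz with hz | hz
    · exact h Ψ (hΨ.mono (min_le_left _ _) (le_max_left _ _)) z hz
    · exact h' Ψ (hΨ.mono (min_le_right _ _) (le_max_right _ _)) z hz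
  · obtain ⟨t, ht⟩ := hAU z hz
    obtain ⟨ε, hε, hball⟩ := Metric.isOpen_iff.1 hU _ ht
    have hc : Continuous fun w => Φ t w := hΦ.comp (continuous_const.prodMk continuous_id)
    have hev : ∀ᶠ w in 𝓝 z, dist (Φ t w) (Φ t z) < ε / 2 ∧ ‖w‖ < ‖z‖ + 1 :=
      ((hc.tendsto z).eventually (Metric.ball_mem_nhds _ (half_pos hε))).and
        ((continuous_norm.tendsto z).eventually (gt_mem_nhds (lt_add_one _)))
    refine ⟨_, mem_nhdsWithin_of_mem_nhds hev, ε / 3, by positivity, max |t| (‖z‖ + 1),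
      fun Ψ hΨ w hw => ⟨t, hball ?_⟩⟩
    have h1 := hΨ t w (le_max_left _ _) (hw.2.le.trans (le_max_right _ _))
    have h2 := hw.1
    rw [Metric.mem_ball]
    rw [dist_comm] at h1
    linarith [dist_triangle (Ψ t w) (Φ t w) (Φ t z)]

namespace ZoneSystem

variable {Z : ZoneSystem d} {h : (Fin d → ℝ) → ℝ} {G : Phase d ≃ Phase d}

/-- The conjugacy changes while `h₁` is resonant, at no cost for the Hamiltonian or the flow; only
the two perturbations of the integrable part count, and the second is chosen after the conjugacy.
The preservation clause holds because Γ preserves each core of the treated parity. The exit and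
drift properties are stated for all nearby motions, so that the limit flow inherits them. -/
theorem exists_step (hs : Z.IsState h G) (j : ℕ) (R : ℝ) {ε : ℝ} (hε : 0 < ε) :
    ∃ (h' : (Fin d → ℝ) → ℝ) (G' : Phase d ≃ Phase d), Z.IsState h' G' ∧
      FlowClose j R ε h G h' G' ∧
      (∀ m, m % 2 = j % 2 → ∀ z, action (G' z) ∈ Z.C m → action (G z) ∈ Z.C m) ∧
      ∃ ε' > 0, ∃ R', ∀ Ψ, MotionClose ε' R' (conjFlow h' G') Ψ →
        (∀ m, m % 2 = j % 2 → ∀ z, action z ∈ Z.Q j → action (G z) ∈ Z.C m →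
          ∃ t, action (Ψ t z) ∉ Z.Q j) ∧
        (Z.Drift → ∃ p t₁ t₂, ‖Ψ t₁ p‖ < ((j : ℝ) + 1)⁻¹ ∧ (j : ℝ) + 1 < ‖Ψ t₂ p‖) := by
  obtain ⟨K, hK, hKD, hid, hid'⟩ := hs.symm_eq
  have hhs := Z.contDiff_of_adm h hs.adm
  have hGc := hs.symplectic.contDiff.continuous
  -- the data of the diffusing orbit
  obtain ⟨L, hL, hLD, m₁, hdrift⟩ : ∃ L, IsCompact L ∧ L ⊆ Z.D ∧ ∃ m₁ : ℕ, Z.Drift →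
      m₁ % 2 = j % 2 ∧ ∃ ρ ∈ Z.C m₁, 2 * ∑ i, ρ i < ((j : ℝ) + 1)⁻¹ ^ 2 ∧
        ∀ κ ∈ Z.dir m₁, (∀ i, 0 ≤ κ i) ∧ ∀ t, LineIn Z.D κ ρ t →
          ρ + t • (fun i => (κ i : ℝ)) ∉ K ∧
          (0 ≤ t → ∑ i, (ρ + t • (fun i => (κ i : ℝ))) i < ((j : ℝ) + 1) ^ 2 →
            ρ + t • (fun i => (κ i : ℝ)) ∈ L) := by
    by_cases hD : Z.Drift
    · obtain ⟨m, hm, ρ, hρ, h1, L, hL, hLD, h2⟩ := hD ((j : ℝ) + 1) (by positivity) K hK hKD j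
      exact ⟨L, hL, hLD, m, fun _ => ⟨hm, ρ, hρ, h1, h2⟩⟩
    · exact ⟨∅, isCompact_empty, Set.empty_subset _, 0, fun h => absurd h hD⟩
  have hKj : IsCompact {z : Phase d | action z ∈ Z.Q j} :=
    isCompact_preimage_action (Z.isCompact_Q j)
  -- `Q j'` contains the actions of `G z` for all `z` over `Q j`. Leaving `Q j'` in the coordinates
  -- given by `G` therefore means leaving `Q j` in the original ones.
  obtain ⟨j', hj'⟩ := Z.exists_subset_Q
    (L ∪ (fun z => action (G z)) '' {z : Phase d | action z ∈ Z.Q j})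
    (hL.union (hKj.image (continuous_action.comp hGc)))
    (Set.union_subset hLD (by
      rintro _ ⟨z, hz, rfl⟩
      exact (hs.action_mem z).2 (Z.Q_subset j hz)))
  obtain ⟨M₀, hM₀⟩ := Z.finite_C (Z.Q j') (Z.isCompact_Q j') (Z.Q_subset j')
  set M := max M₀ (m₁ + 1) with hM
  -- make the Hamiltonian resonant
  obtain ⟨N, u, hu, hu0, hpert⟩ := Z.perturb h hs.adm 0 M (fun _ => 0) (by simp)
  obtain ⟨η, hη, hclose⟩ := exists_flowClose_perturbed hhs hs.symplectic hs.eventually_eq hu hu0 j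
    R (half_pos hε)
  obtain ⟨c, hc, hadm, ⟨kv, hkv⟩, -⟩ := hpert η hη
  have hclose1 := hclose c hc
  set h₁ := perturbed h u c with hh₁
  obtain ⟨Γ, hΓ, ⟨KΓ, hKΓ, hKΓD, hΓid⟩, hΓflow, hΓh, hΓC, hΓline, hΓexit⟩ :=
    exists_resonant_map hadm M (j % 2) j' kv hkv
  set G' : Phase d ≃ Phase d := G.trans Γ.symm with hG'
  have hΓG' : ∀ z, Γ (G' z) = G z := fun z => by simp [hG']
  have hs₁ : Z.IsState h₁ G' := by
    refine ⟨hadm, hs.symplectic.trans hΓ.symm, K ∪ KΓ, hK.union hKΓ, Set.union_subset hKD hKΓD,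
      fun z hz => ?_⟩
    rw [Set.mem_union, not_or] at hz
    rw [hG', Equiv.trans_apply, hid z hz.1, Equiv.symm_apply_eq, hΓid z hz.2]
  have hham : ∀ z, h₁ (action (G' z)) = h₁ (action (G z)) := fun z => by
    rw [← hΓG', hΓh]
  -- Γ commutes with the resonant flow, so it cancels in the conjugation.
  have hconj : ∀ t z, conjFlow h₁ G' t z = conjFlow h₁ G t z := fun t z => by
    have : Γ (actionFlow h₁ t (G' z)) = actionFlow h₁ t (G z) := by rw [hΓflow, hΓG']
    simp [conjFlow, hG', ← this]
  have hclose1' : FlowClose j R (ε / 2) h G h₁ G' := by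
    refine ⟨fun t z ht hz => ?_, fun l hl n hn z => ?_, fun z hz => ?_, hclose1.freq⟩
    · rw [hconj]; exact hclose1.flow t z ht hz
    · simp only [hham]; exact hclose1.deriv l hl n hn z
    · rw [hham]; exact hclose1.ham z hz
  -- break the resonances
  have hh₁s := Z.contDiff_of_adm h₁ hadm
  obtain ⟨N', u', hu', hu0', hpert'⟩ := Z.perturb h₁ hadm M 0 kv hkv
  obtain ⟨η', hη', hclose'⟩ := exists_flowClose_perturbed hh₁s hs₁.symplectic hs₁.eventually_eq hu'
    hu0' j R (half_pos hε)
  obtain ⟨c', hc', hadm', -, hne⟩ := hpert' η' hη'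
  have hclose2 := hclose' c' hc'
  set h' := perturbed h₁ u' c' with hh'
  have hh's := Z.contDiff_of_adm h' hadm'
  have hs' : Z.IsState h' G' := ⟨hadm', hs₁.symplectic, hs₁.support⟩
  have hflow' : ∀ t z, conjFlow h' G' t z = G.symm (Γ (actionFlow h' t (G' z))) := fun t z => rfl
  have hpres : ∀ m, m % 2 = j % 2 → ∀ z, action (G' z) ∈ Z.C m → action (G z) ∈ Z.C m :=
    fun m hm z hz => by rw [← hΓG']; exact (hΓC m hm _).2 hz
  -- every treated point leaves the compact set
  have hexit : ∀ m < M, m % 2 = j % 2 → ∀ z, action z ∈ Z.Q j → action (G z) ∈ Z.C m →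
      ∃ t, conjFlow h' G' t z ∈ {w | action w ∉ Z.Q j} := by
    intro m hmM hm z hzQ hzC
    have hzQ' : action (G z) ∈ Z.Q j' := hj' (Or.inr ⟨z, hzQ, rfl⟩)
    set w := G' z with hw
    have hΓw : Γ w = G z := hΓG' z
    have hwC : action w ∈ Z.C m := (hΓC m hm w).1 (by rw [hΓw]; exact hzC)
    obtain ⟨s, hsw, hsl⟩ := hΓline m hmM hm w (Z.C_subset m hwC)
    rw [hΓw] at hsw
    have hnr := hne m hmM _ hwC
    -- The actions of `w` need not lie in `Q j'`, but those of `G z`, displaced by `s`, do. The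
    -- phase is chosen so that the displacement τ and `s` have opposite signs. The segment from the
    -- actions of `G z` to the displaced ones then contains the segment swept from `w`, which is not
    -- contained in `Q j'`.
    have key : ∀ σ : ℝ, (σ = 1 ∨ σ = -1) → σ * s ≤ 0 →
        ∃ t, conjFlow h' G' t z ∈ {w | action w ∉ Z.Q j} := by
      intro σ hσ hσs
      obtain ⟨t, hre, him⟩ := exists_monomial_rotate_eq hnr w σ hσ
      have hflow : rotate (t • grad h' (action w)) w = actionFlow h' t w := rfl
      rw [hflow] at hre him
      obtain ⟨τ, hτ, hact, hτl, hτQ⟩ := hΓexit m hmM hm (actionFlow h' t w) (by simpa using hwC) hre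
      rw [action_actionFlow] at hact hτl hτQ
      refine ⟨t, fun hQ => hτQ ?_⟩
      -- both ends of the segment lie in the exhausting set, which is convex along the line
      have hmem : action w + τ • (fun i => (kv m i : ℝ)) ∈ Z.Q j' := by
        rw [← hact]
        refine hj' (Or.inr ⟨_, hQ, ?_⟩)
        rw [hflow']
        simp [← hw]
      have hστ : 0 ≤ σ * τ := by
        rw [him] at hτ
        have hp : 0 < ‖monomial (kv m) w‖ := norm_pos_iff.2
          (monomial_ne_zero _ (Z.pos _ (Z.O_subset m (Z.C_subset m hwC))))
        have : 0 ≤ (σ * τ) * ‖monomial (kv m) w‖ := by linarith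
        exact nonneg_of_mul_nonneg_left this hp
      have hl1 : LineIn Z.D (kv m) (action (G z)) (-s + τ) := by
        rw [hsw]
        refine hsl.neg.add ?_
        rw [add_assoc, ← add_smul, add_neg_cancel, zero_smul, add_zero]
        exact hτl
      have hl2 := Z.lineIn_Q j' (kv m) (action (G z)) (-s + τ) hzQ' (by
        rw [hsw, add_assoc, ← add_smul]; simpa using hmem) hl1
      intro x hx
      have hx' : x - s ∈ Set.uIcc 0 (-s + τ) := by
        rw [Set.mem_uIcc] at hx ⊢
        rcases hσ with rfl | rfl
        · left
          rcases hx with hx | hx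
          · constructor <;> linarith [hx.1, hx.2]
          · constructor <;> linarith [hx.1, hx.2]
        · right
          rcases hx with hx | hx
          · constructor <;> linarith [hx.1, hx.2]
          · constructor <;> linarith [hx.1, hx.2]
      have := hl2 _ hx'
      rwa [hsw, add_assoc, ← add_smul, add_sub_cancel] at this
    rcases le_total s 0 with h0 | h0
    · exact key 1 (Or.inl rfl) (by linarith)
    · exact key (-1) (Or.inr rfl) (by linarith)
  have hcont := continuous_conjFlow hh's hs'.symplectic
  set A : Set (Phase d) := ⋃ m ∈ (Finset.range M).filter (fun m => m % 2 = j % 2),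
    {z | action z ∈ Z.Q j ∧ action (G z) ∈ Z.C m} with hA
  have hAc : IsCompact A := by
    refine Finset.isCompact_biUnion _ fun m _ => ?_
    have : {z | action z ∈ Z.Q j ∧ action (G z) ∈ Z.C m} =
        {z | action z ∈ Z.Q j} ∩ (fun z => action (G z)) ⁻¹' (Z.C m ∩ Z.Q j') := by
      ext z
      constructor
      · rintro ⟨h1, h2⟩
        exact ⟨h1, h2, hj' (Or.inr ⟨z, h1, rfl⟩)⟩
      · rintro ⟨h1, h2, -⟩
        exact ⟨h1, h2⟩
    rw [this]
    exact hKj.inter_right ((Z.isCompact_C_inter m _ (Z.isCompact_Q j')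
      (Z.Q_subset j')).isClosed.preimage (continuous_action.comp hGc))
  have hUo : IsOpen {w : Phase d | action w ∉ Z.Q j} :=
    (Z.isCompact_Q j).isClosed.isOpen_compl.preimage continuous_action
  obtain ⟨ε₁, hε₁, R₁, hvisit⟩ := exists_motionClose_visit hcont hAc hUo (by
    intro z hz
    simp only [hA, Set.mem_iUnion, Finset.mem_filter, Finset.mem_range] at hz
    obtain ⟨m, ⟨hmM, hm⟩, h1, h2⟩ := hz
    exact hexit m hmM hm z h1 h2)
  have hvisit' : ∀ Ψ, MotionClose ε₁ R₁ (conjFlow h' G') Ψ → ∀ m, m % 2 = j % 2 → ∀ z,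
      action z ∈ Z.Q j → action (G z) ∈ Z.C m → ∃ t, action (Ψ t z) ∉ Z.Q j := by
    intro Ψ hΨ m hm z h1 h2
    have hmM : m < M := lt_of_lt_of_le
      (hM₀ m ⟨_, h2, hj' (Or.inr ⟨z, h1, rfl⟩)⟩) (le_max_left _ _)
    refine hvisit Ψ hΨ z ?_
    simp only [hA, Set.mem_iUnion, Finset.mem_filter, Finset.mem_range]
    exact ⟨m, ⟨hmM, hm⟩, h1, h2⟩
  refine ⟨h', G', hs', ?_, hpres, ?_⟩
  · have := hclose1'.trans hhs hh₁s hh's hs.symplectic hs₁.symplectic hs₁.symplectic hclose2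
    rwa [add_halves] at this
  by_cases hD : Z.Drift
  swap
  · exact ⟨ε₁, hε₁, R₁, fun Ψ hΨ => ⟨hvisit' Ψ hΨ, fun h => absurd h hD⟩⟩
  obtain ⟨hm₁, ρ, hρ, hρs, hρκ⟩ := hdrift hD
  have hm₁M : m₁ < M := lt_of_lt_of_le (Nat.lt_succ_self _) (le_max_right _ _)
  obtain ⟨hκ0, hκ⟩ := hρκ _ (hkv m₁ hm₁M).1
  have hρpos := Z.pos ρ (Z.O_subset _ (Z.C_subset _ hρ))
  obtain ⟨w, hw⟩ := exists_action_eq fun i => (hρpos i).le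
  have hwC : action w ∈ Z.C m₁ := by rw [hw]; exact hρ
  have hnr := hne m₁ hm₁M _ hwC
  have hp : 0 < ‖monomial (kv m₁) w‖ := norm_pos_iff.2 (monomial_ne_zero _ (by rw [hw]; exact hρpos))
  set p := G'.symm w with hpdef
  have hpw : G' p = w := by simp [hpdef]
  -- The line through `ρ` avoids `K`, off which `G` is the identity, so the actions in the original
  -- coordinates are known exactly. The backward push (σ = −1) does not increase their sum; the
  -- forward push leaves `L`, which forces the sum to be large.
  have hpoint : ∀ σ : ℝ, (σ = 1 ∨ σ = -1) → ∃ s τ, 0 ≤ σ * τ ∧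
      action (conjFlow h' G' s p) = ρ + τ • (fun i => (kv m₁ i : ℝ)) ∧
      LineIn Z.D (kv m₁) ρ τ ∧ ¬ LineIn (Z.Q j') (kv m₁) ρ τ := by
    intro σ hσ
    obtain ⟨s, hre, him⟩ := exists_monomial_rotate_eq hnr w σ hσ
    have hflow : rotate (s • grad h' (action w)) w = actionFlow h' s w := rfl
    rw [hflow] at hre him
    obtain ⟨τ, hτ, hact, hτl, hτQ⟩ :=
      hΓexit m₁ hm₁M hm₁ (actionFlow h' s w) (by simpa using hwC) hre
    rw [action_actionFlow, hw] at hact hτl hτQ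
    refine ⟨s, τ, ?_, ?_, hτl, hτQ⟩
    · rw [him] at hτ
      have : 0 ≤ (σ * τ) * ‖monomial (kv m₁) w‖ := by linarith
      exact nonneg_of_mul_nonneg_left this hp
    · rw [hflow', hpw, hid' _ (by rw [hact]; exact (hκ τ hτl).1), hact]
  have hsum : ∀ τ : ℝ, ∑ i, (ρ + τ • (fun i => (kv m₁ i : ℝ))) i =
      ∑ i, ρ i + τ * ∑ i, (kv m₁ i : ℝ) := fun τ => by
    simp [Finset.sum_add_distrib, Finset.mul_sum]
  have hκs : (0 : ℝ) ≤ ∑ i, (kv m₁ i : ℝ) := Finset.sum_nonneg fun i _ => by exact_mod_cast hκ0 i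
  obtain ⟨s₁, τ₁, hτ₁, ha₁, -, -⟩ := hpoint (-1) (Or.inr rfl)
  obtain ⟨s₂, τ₂, hτ₂, ha₂, hl₂, hQ₂⟩ := hpoint 1 (Or.inl rfl)
  have hnear : ‖conjFlow h' G' s₁ p‖ < ((j : ℝ) + 1)⁻¹ := by
    refine lt_of_pow_lt_pow_left₀ 2 (by positivity) ?_
    rw [norm_sq_eq_sum_action, ha₁, hsum]
    nlinarith
  have hfar : (j : ℝ) + 1 < ‖conjFlow h' G' s₂ p‖ := by
    refine lt_of_pow_lt_pow_left₀ 2 (norm_nonneg _) ?_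
    rw [norm_sq_eq_sum_action, ha₂, hsum]
    rw [one_mul] at hτ₂
    obtain ⟨x, hx, hxQ⟩ : ∃ x ∈ Set.uIcc 0 τ₂, ρ + x • (fun i => (kv m₁ i : ℝ)) ∉ Z.Q j' := by
      by_contra hcon
      push Not at hcon
      exact hQ₂ hcon
    have hx' := hx
    rw [Set.uIcc_of_le hτ₂] at hx'
    have h1 : ¬ ∑ i, (ρ + x • (fun i => (kv m₁ i : ℝ))) i < ((j : ℝ) + 1) ^ 2 := fun hlt =>
      hxQ (hj' (Or.inl ((hκ x (hl₂.mono hx)).2 hx'.1 hlt)))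
    rw [hsum] at h1
    have h2 : x * ∑ i, (kv m₁ i : ℝ) ≤ τ₂ * ∑ i, (kv m₁ i : ℝ) :=
      mul_le_mul_of_nonneg_right hx'.2 hκs
    have h3 : (0 : ℝ) < ((j : ℝ) + 1) ^ 2 := by positivity
    linarith
  obtain ⟨ε₂, hε₂, hclo⟩ : ∃ ε₂ > 0, ‖conjFlow h' G' s₁ p‖ + ε₂ < ((j : ℝ) + 1)⁻¹ ∧
      (j : ℝ) + 1 + ε₂ < ‖conjFlow h' G' s₂ p‖ := by
    refine ⟨min ((((j : ℝ) + 1)⁻¹ - ‖conjFlow h' G' s₁ p‖) / 2)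
      ((‖conjFlow h' G' s₂ p‖ - (j + 1)) / 2), lt_min (by linarith) (by linarith), ?_, ?_⟩
    · linarith [min_le_left ((((j : ℝ) + 1)⁻¹ - ‖conjFlow h' G' s₁ p‖) / 2)
        ((‖conjFlow h' G' s₂ p‖ - (j + 1)) / 2)]
    · linarith [min_le_right ((((j : ℝ) + 1)⁻¹ - ‖conjFlow h' G' s₁ p‖) / 2)
        ((‖conjFlow h' G' s₂ p‖ - (j + 1)) / 2)]
  refine ⟨min ε₁ ε₂, lt_min hε₁ hε₂, max R₁ (max ‖p‖ (max |s₁| |s₂|)), fun Ψ hΨ =>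
    ⟨hvisit' Ψ (hΨ.mono (min_le_left _ _) (le_max_left _ _)), fun _ => ⟨p, s₁, s₂, ?_, ?_⟩⟩⟩
  · have h1 := hΨ s₁ p (by simp) (by simp)
    have h3 := min_le_right ε₁ ε₂
    have h5 := norm_le_norm_add_norm_sub' (Ψ s₁ p) (conjFlow h' G' s₁ p)
    rw [dist_eq_norm, norm_sub_rev] at h1
    linarith [hclo.1]
  · have h1 := hΨ s₂ p (by simp) (by simp)
    have h3 := min_le_right ε₁ ε₂
    have h5 := norm_le_norm_add_norm_sub' (conjFlow h' G' s₂ p) (Ψ s₂ p)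
    rw [dist_eq_norm] at h1
    linarith [hclo.2]

end ZoneSystem

end Step

/-! ### Convergence of the approximations and properties of the limit flow. -/

section Limit

variable {d : ℕ}

/-- The sequence of approximations `h n ∘ action ∘ G n`; the `n`-th one controls the behaviour of
every motion which is `2 ε (n + 1)`-close to the next one. -/
structure ApproxSeq (Z : ZoneSystem d) (h₀ : (Fin d → ℝ) → ℝ) where
  h : ℕ → (Fin d → ℝ) → ℝ
  G : ℕ → Phase d ≃ Phase d
  ε : ℕ → ℝ
  R : ℕ → ℝ
  h_zero : h 0 = h₀
  G_zero : G 0 = Equiv.refl _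
  isState : ∀ n, Z.IsState (h n) (G n)
  ε_pos : ∀ n, 0 < ε n
  ε_succ : ∀ n, ε (n + 1) ≤ ε n / 2
  le_R : ∀ n : ℕ, (n : ℝ) ≤ R n
  monotone_R : Monotone R
  close : ∀ n, FlowClose n (R n) (ε n) (h n) (G n) (h (n + 1)) (G (n + 1))
  preserve : ∀ n m, m % 2 = n % 2 → ∀ z, action (G (n + 1) z) ∈ Z.C m → action (G n z) ∈ Z.C m
  stable : ∀ n Ψ, MotionClose (2 * ε (n + 1)) (R (n + 1)) (conjFlow (h (n + 1)) (G (n + 1))) Ψ →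
    (∀ m, m % 2 = n % 2 → ∀ z, action z ∈ Z.Q n → action (G n z) ∈ Z.C m →
      ∃ t, action (Ψ t z) ∉ Z.Q n) ∧
    (Z.Drift → ∃ p t₁ t₂, ‖Ψ t₁ p‖ < ((n : ℝ) + 1)⁻¹ ∧ (n : ℝ) + 1 < ‖Ψ t₂ p‖)

lemma exists_approxSeq (Z : ZoneSystem d) {h₀ : (Fin d → ℝ) → ℝ} (hadm : Z.Adm h₀) :
    Nonempty (ApproxSeq Z h₀) := by
  let σ := {x : ((Fin d → ℝ) → ℝ) × (Phase d ≃ Phase d) × ℝ × ℝ //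
    Z.IsState x.1 x.2.1 ∧ 0 < x.2.2.1}
  have step : ∀ (n : ℕ) (x : σ), ∃ y : σ,
      FlowClose n x.1.2.2.2 x.1.2.2.1 x.1.1 x.1.2.1 y.1.1 y.1.2.1 ∧
      (∀ m, m % 2 = n % 2 → ∀ z, action (y.1.2.1 z) ∈ Z.C m → action (x.1.2.1 z) ∈ Z.C m) ∧
      y.1.2.2.1 ≤ x.1.2.2.1 / 2 ∧ x.1.2.2.2 + 1 ≤ y.1.2.2.2 ∧
      ∀ Ψ, MotionClose (2 * y.1.2.2.1) y.1.2.2.2 (conjFlow y.1.1 y.1.2.1) Ψ →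
        (∀ m, m % 2 = n % 2 → ∀ z, action z ∈ Z.Q n → action (x.1.2.1 z) ∈ Z.C m →
          ∃ t, action (Ψ t z) ∉ Z.Q n) ∧
        (Z.Drift → ∃ p t₁ t₂, ‖Ψ t₁ p‖ < ((n : ℝ) + 1)⁻¹ ∧ (n : ℝ) + 1 < ‖Ψ t₂ p‖) := by
    rintro n ⟨⟨h, G, ε, R⟩, hs, hε⟩
    obtain ⟨h', G', hs', hclose, hpres, ε', hε', R', hst⟩ := ZoneSystem.exists_step hs n R hε
    -- Tolerances at least halve at each step, so all later changes together amount to at most twice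
    -- the next one; half of `ε'` thus keeps the limit in the stability range.
    refine ⟨⟨⟨h', G', min (ε / 2) (ε' / 2), max (R + 1) R'⟩, hs',
      lt_min (half_pos hε) (half_pos hε')⟩, hclose, hpres, min_le_left _ _, le_max_left _ _,
      fun Ψ hΨ => hst Ψ (hΨ.mono ?_ (le_max_right _ _))⟩
    have := min_le_right (ε / 2) (ε' / 2)
    change 2 * min (ε / 2) (ε' / 2) ≤ ε'
    linarith
  choose next hnext using step
  let x₀ : σ := ⟨⟨h₀, Equiv.refl _, 1, 0⟩, ⟨hadm, IsSymplectic.refl, ∅, isCompact_empty,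
    Set.empty_subset _, fun _ _ => rfl⟩, one_pos⟩
  let x : ℕ → σ := fun n => Nat.rec x₀ (fun n y => next n y) n
  have hx : ∀ n, x (n + 1) = next n (x n) := fun n => rfl
  have hR : ∀ n, (x n).1.2.2.2 + 1 ≤ (x (n + 1)).1.2.2.2 := fun n => (hnext n (x n)).2.2.2.1
  refine ⟨⟨fun n => (x n).1.1, fun n => (x n).1.2.1, fun n => (x n).1.2.2.1,
    fun n => (x n).1.2.2.2, rfl, rfl, fun n => (x n).2.1, fun n => (x n).2.2,
    fun n => (hnext n (x n)).2.2.1, fun n => ?_, monotone_nat_of_le_succ fun n => ?_,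
    fun n => (hnext n (x n)).1, fun n => (hnext n (x n)).2.1,
    fun n => (hnext n (x n)).2.2.2.2⟩⟩
  · induction n with
    | zero => simp [x, x₀]
    | succ n ih =>
      have := hR n
      push_cast
      linarith
  · linarith [hR n]

namespace ApproxSeq

variable {Z : ZoneSystem d} {h₀ : (Fin d → ℝ) → ℝ} (S : ApproxSeq Z h₀)

/-- The unsimplified bound is the general term of the geometric series with sum `2 * S.ε n`. -/
lemma ε_add_le (n k : ℕ) : S.ε (n + k) ≤ 2 * S.ε n / 2 / 2 ^ k := by
  induction k with
  | zero => simp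
  | succ k ih =>
    have := S.ε_succ (n + k)
    rw [← add_assoc, pow_succ]
    calc S.ε (n + k + 1) ≤ S.ε (n + k) / 2 := this
      _ ≤ (2 * S.ε n / 2 / 2 ^ k) / 2 := by linarith
      _ = _ := by rw [div_div _ ((2 : ℝ) ^ k)]

lemma tendsto_ε : Tendsto S.ε atTop (𝓝 0) := by
  refine squeeze_zero (fun n => (S.ε_pos n).le) (fun n => ?_)
    (summable_geometric_two' (2 * S.ε 0)).tendsto_atTop_zero
  simpa using S.ε_add_le 0 n

lemma contDiff_h (n : ℕ) : ContDiff ℝ ∞ (S.h n) := Z.contDiff_of_adm _ (S.isState n).adm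

/-- The approximating Hamiltonians. -/
def ham (n : ℕ) (z : Phase d) : ℝ := S.h n (action (S.G n z))

lemma contDiff_ham (n : ℕ) : ContDiff ℝ ∞ (S.ham n) :=
  _root_.contDiff_ham (S.contDiff_h n) (S.isState n).symplectic

/-- The approximating flows. -/
def flow (n : ℕ) : ℝ → Phase d → Phase d := conjFlow (S.h n) (S.G n)

lemma hasDerivAt_flow (n : ℕ) (z : Phase d) (t : ℝ) :
    HasDerivAt (fun s => S.flow n s z) (hamVectorField (S.ham n) (S.flow n t z)) t :=
  hasDerivAt_conjFlow (S.contDiff_h n) (S.isState n).symplectic z t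

lemma dist_flow_le {n : ℕ} {t : ℝ} {z : Phase d} (ht : |t| ≤ S.R n) (hz : ‖z‖ ≤ S.R n) (k : ℕ) :
    dist (S.flow (n + k) t z) (S.flow (n + (k + 1)) t z) ≤ 2 * S.ε n / 2 / 2 ^ k := by
  have hR : S.R n ≤ S.R (n + k) := S.monotone_R (Nat.le_add_right n k)
  exact ((S.close (n + k)).flow t z (ht.trans hR) (hz.trans hR)).trans (S.ε_add_le n k)

lemma exists_tendsto_flow (t : ℝ) (z : Phase d) :
    ∃ w, Tendsto (fun n => S.flow n t z) atTop (𝓝 w) := by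
  obtain ⟨n, hn⟩ := exists_nat_ge (max |t| ‖z‖)
  have hR := S.le_R n
  have hc : CauchySeq fun k => S.flow (n + k) t z :=
    cauchySeq_of_le_geometric_two (S.dist_flow_le
      ((le_max_left _ _).trans (hn.trans hR)) ((le_max_right _ _).trans (hn.trans hR)))
  obtain ⟨w, hw⟩ := cauchySeq_tendsto_of_complete hc
  refine ⟨w, ?_⟩
  rw [← tendsto_add_atTop_iff_nat n]
  simpa only [add_comm] using hw

/-- The limit flow. -/
def limitFlow (t : ℝ) (z : Phase d) : Phase d := (S.exists_tendsto_flow t z).choose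

lemma tendsto_flow (t : ℝ) (z : Phase d) :
    Tendsto (fun n => S.flow n t z) atTop (𝓝 (S.limitFlow t z)) :=
  (S.exists_tendsto_flow t z).choose_spec

lemma motionClose_limitFlow (n : ℕ) :
    MotionClose (2 * S.ε n) (S.R n) (S.flow n) S.limitFlow := by
  intro t z ht hz
  have h1 : Tendsto (fun k => S.flow (n + k) t z) atTop (𝓝 (S.limitFlow t z)) := by
    simpa only [add_comm] using (tendsto_add_atTop_iff_nat n).2 (S.tendsto_flow t z)
  exact dist_le_of_le_geometric_two_of_tendsto₀ (S.dist_flow_le ht hz) h1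

/-- The limit Hamiltonian. -/
def limitHam (z : Phase d) : ℝ := S.ham 0 z + ∑' n, (S.ham (n + 1) z - S.ham n z)

lemma abs_cutoff_mul_le {l n : ℕ} (hl : l ≤ n) (z : Phase d) :
    |cutoff d l z * (S.ham (n + 1) z - S.ham n z)| ≤ S.ε n := by
  have := (S.close n).deriv l hl 0 (Nat.zero_le _) z
  rwa [norm_iteratedFDeriv_zero, Real.norm_eq_abs] at this

lemma summable_diff (z : Phase d) : Summable fun n => S.ham (n + 1) z - S.ham n z := by
  obtain ⟨l, hl⟩ := exists_nat_ge ‖z‖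
  rw [← summable_nat_add_iff l]
  refine Summable.of_norm_bounded (summable_geometric_two' (2 * S.ε l)) fun k => ?_
  have h1 := S.abs_cutoff_mul_le (Nat.le_add_right l k) z
  rw [cutoff_eq_one hl, one_mul, ← Real.norm_eq_abs] at h1
  rw [add_comm k l]
  exact h1.trans (S.ε_add_le l k)

/-- The difference between the limit Hamiltonian and an approximation, cut off. -/
def tail (l n : ℕ) (z : Phase d) : ℝ :=
  ∑' k, cutoff d l z * (S.ham (n + k + 1) z - S.ham (n + k) z)

lemma limitHam_eq {l : ℕ} {z : Phase d} (hz : ‖z‖ ≤ l) (n : ℕ) :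
    S.limitHam z = S.ham n z + S.tail l n z := by
  have h1 := (S.summable_diff z).sum_add_tsum_nat_add n
  rw [limitHam, ← h1, Finset.sum_range_sub (fun n => S.ham n z)]
  have h2 : S.tail l n z = ∑' k, (S.ham (k + n + 1) z - S.ham (k + n) z) := by
    refine tsum_congr fun k => ?_
    rw [cutoff_eq_one hz, one_mul, add_comm n k]
  rw [h2]
  ring

lemma contDiff_term (l n : ℕ) :
    ContDiff ℝ ∞ fun z => cutoff d l z * (S.ham (n + 1) z - S.ham n z) :=
  (contDiff_cutoff d l).mul ((S.contDiff_ham _).sub (S.contDiff_ham _))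

/-- Derivatives of a given order are only controlled from some index on, which is enough since every
term is smooth. -/
lemma contDiff_tail (l n : ℕ) : ContDiff ℝ ∞ (S.tail l n) := by
  refine contDiff_tsum_of_eventually (v := fun _ k => 2 * S.ε n / 2 / 2 ^ k)
    (fun k => S.contDiff_term l (n + k)) (fun _ _ => summable_geometric_two' _) fun m _ => ?_
  rw [Nat.cofinite_eq_atTop]
  filter_upwards [eventually_ge_atTop (max l m)] with k hk z
  refine ((S.close (n + k)).deriv l ?_ m ?_ z).trans (S.ε_add_le n k)
  · exact (le_max_left _ _).trans (hk.trans (Nat.le_add_left _ _))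
  · exact (le_max_right _ _).trans (hk.trans (Nat.le_add_left _ _))

lemma norm_fderiv_tail_le {l n : ℕ} (hl : l ≤ n) (hn : 1 ≤ n) (z : Phase d) :
    ‖fderiv ℝ (S.tail l n) z‖ ≤ 2 * S.ε n := by
  have hb : ∀ k z, ‖fderiv ℝ (fun z => cutoff d l z * (S.ham (n + k + 1) z - S.ham (n + k) z)) z‖ ≤
      2 * S.ε n / 2 / 2 ^ k := by
    intro k z
    rw [← norm_iteratedFDeriv_one]
    exact ((S.close (n + k)).deriv l (by omega) 1 (by omega) z).trans (S.ε_add_le n k)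
  have hs : Summable fun k => cutoff d l (0 : Phase d) * (S.ham (n + k + 1) 0 - S.ham (n + k) 0) :=
    Summable.of_norm_bounded (summable_geometric_two' (2 * S.ε n)) fun k =>
      (S.abs_cutoff_mul_le (by omega) 0).trans (S.ε_add_le n k)
  have := fderiv_tsum_apply (summable_geometric_two' (2 * S.ε n))
    (fun k => (S.contDiff_term l (n + k)).differentiable (by simp)) hb hs z
  change ‖fderiv ℝ (fun z => ∑' k, cutoff d l z * (S.ham (n + k + 1) z - S.ham (n + k) z)) z‖ ≤ _
  rw [this]
  exact tsum_of_norm_bounded (hasSum_geometric_two' (2 * S.ε n)) fun k => hb k z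

lemma eventuallyEq_limitHam {l : ℕ} {z : Phase d} (hz : ‖z‖ < l) (n : ℕ) :
    S.limitHam =ᶠ[𝓝 z] fun w => S.ham n w + S.tail l n w := by
  filter_upwards [(continuous_norm.tendsto z).eventually (gt_mem_nhds hz)] with w hw
  exact S.limitHam_eq (le_of_lt hw) n

lemma contDiff_limitHam : ContDiff ℝ ∞ S.limitHam := by
  refine contDiff_iff_contDiffAt.2 fun z => ?_
  obtain ⟨l, hl⟩ := exists_nat_gt ‖z‖
  exact ((S.contDiff_ham 0).add (S.contDiff_tail l 0)).contDiffAt.congr_of_eventuallyEq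
    (S.eventuallyEq_limitHam hl 0)

lemma norm_hamVectorField_sub_le {l n : ℕ} (hl : l ≤ n) (hn : 1 ≤ n) {z : Phase d} (hz : ‖z‖ < l) :
    ‖hamVectorField S.limitHam z - hamVectorField (S.ham n) z‖ ≤ 2 * d * (2 * S.ε n) := by
  rw [hamVectorField_sub (S.contDiff_limitHam.differentiable (by simp) z)
    ((S.contDiff_ham n).differentiable (by simp) z)]
  refine (norm_hamVectorField_le _ z).trans ?_
  have h1 : (fun w => S.limitHam w - S.ham n w) =ᶠ[𝓝 z] S.tail l n := by
    filter_upwards [S.eventuallyEq_limitHam hz n] with w hw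
    rw [hw, add_sub_cancel_left]
  rw [h1.fderiv_eq]
  exact mul_le_mul_of_nonneg_left (S.norm_fderiv_tail_le hl hn z) (by positivity)

/-- Near any time the approximate orbits of `z` converge uniformly inside a fixed ball, where the
vector fields also converge uniformly; hence the derivatives in time converge uniformly and the
equation passes to the limit. -/
lemma isHamiltonianFlow_limitFlow : IsHamiltonianFlow S.limitHam S.limitFlow := by
  refine ⟨fun z => ?_, fun z t => ?_⟩
  · refine tendsto_nhds_unique (S.tendsto_flow 0 z) ?_
    simp only [flow, conjFlow_zero]
    exact tendsto_const_nhds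
  obtain ⟨n₀, hn₀⟩ := exists_nat_ge (max (|t| + 1) ‖z‖)
  have hR₀ := S.le_R n₀
  have hz : ‖z‖ ≤ S.R n₀ := (le_max_right _ _).trans (hn₀.trans hR₀)
  have ht : ∀ s ∈ Metric.ball t 1, |s| ≤ S.R n₀ := by
    intro s hs
    rw [Metric.mem_ball, Real.dist_eq] at hs
    have h1 := abs_sub_abs_le_abs_sub s t
    have h2 := (le_max_left (|t| + 1) ‖z‖).trans (hn₀.trans hR₀)
    linarith
  have hcont : Continuous fun s => S.flow n₀ s z :=
    continuous_iff_continuousAt.2 fun s => (S.hasDerivAt_flow n₀ z s).continuousAt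
  obtain ⟨B, hB⟩ := (isCompact_closedBall t 1).exists_bound_of_continuousOn hcont.continuousOn
  have hε₀ := S.ε_pos n₀
  have hΦ : ∀ s ∈ Metric.ball t 1, ‖S.limitFlow s z‖ ≤ B + 2 * S.ε n₀ := by
    intro s hs
    have h1 := S.motionClose_limitFlow n₀ s z (ht s hs) hz
    have h2 := hB s (Metric.ball_subset_closedBall hs)
    have h3 := norm_le_norm_add_norm_sub' (S.limitFlow s z) (S.flow n₀ s z)
    rw [dist_eq_norm, norm_sub_rev] at h1
    linarith
  have hclose : ∀ n ≥ n₀, ∀ s ∈ Metric.ball t 1,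
      dist (S.flow n s z) (S.limitFlow s z) ≤ 2 * S.ε n := by
    intro n hn s hs
    have hR := S.monotone_R hn
    exact S.motionClose_limitFlow n s z ((ht s hs).trans hR) (hz.trans hR)
  obtain ⟨l, hl⟩ := exists_nat_gt (B + 2 * S.ε n₀ + 1)
  have hX := contDiff_hamVectorField S.contDiff_limitHam
  have huc := (isCompact_closedBall (0 : Phase d) l).uniformContinuousOn_of_continuous
    hX.continuous.continuousOn
  refine hasDerivAt_of_tendstoUniformlyOn (l := atTop) (s := Metric.ball t 1) Metric.isOpen_ball
    (f := fun n s => S.flow n s z) (f' := fun n s => hamVectorField (S.ham n) (S.flow n s z))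
    (g' := fun s => hamVectorField S.limitHam (S.limitFlow s z)) ?_
    (Eventually.of_forall fun n s _ => S.hasDerivAt_flow n z s) (fun s _ => S.tendsto_flow s z)
    (Metric.mem_ball_self one_pos)
  rw [Metric.tendstoUniformlyOn_iff]
  intro η hη
  obtain ⟨δ, hδ, huc⟩ := Metric.uniformContinuousOn_iff.1 huc (η / 2) (half_pos hη)
  have hlim : Tendsto (fun n => 2 * d * (2 * S.ε n)) atTop (𝓝 0) := by
    simpa using (S.tendsto_ε.const_mul 2).const_mul (2 * (d : ℝ))
  have hlim' : Tendsto (fun n => 2 * S.ε n) atTop (𝓝 0) := by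
    simpa using S.tendsto_ε.const_mul 2
  filter_upwards [hlim.eventually (gt_mem_nhds (half_pos hη)),
    hlim'.eventually (gt_mem_nhds (lt_min hδ one_pos)), eventually_ge_atTop n₀,
    eventually_ge_atTop l, eventually_ge_atTop 1] with n h1 h2 h3 h4 h5 s hs
  have e1 := hclose n h3 s hs
  have e2 := hΦ s hs
  have e3 : ‖S.flow n s z‖ < l := by
    have h6 := norm_le_norm_add_norm_sub' (S.flow n s z) (S.limitFlow s z)
    rw [dist_eq_norm] at e1
    have := lt_of_lt_of_le h2 (min_le_right δ 1)
    linarith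
  have e4 := S.norm_hamVectorField_sub_le h4 h5 e3
  have e5 := huc (S.limitFlow s z) (by simp; linarith) (S.flow n s z) (by simpa using e3.le) (by
    rw [dist_comm]
    exact lt_of_le_of_lt e1 (lt_of_lt_of_le h2 (min_le_left _ _)))
  rw [← dist_eq_norm] at e4
  linarith [dist_triangle (hamVectorField S.limitHam (S.limitFlow s z))
    (hamVectorField S.limitHam (S.flow n s z)) (hamVectorField (S.ham n) (S.flow n s z))]

lemma isElliptic_limitHam {ω₀ : Fin d → ℝ}
    (h0 : (fun r => h₀ r - ∑ i, ω₀ i * r i) =O[𝓝 0] fun r => ‖r‖ ^ 2) :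
    IsEllipticWithFrequency ω₀ S.limitHam := by
  have hz : ∀ z, S.ham 0 z = h₀ (action z) := fun z => by
    simp [ham, S.h_zero, S.G_zero]
  have e1 := isBigO_comp_action h0
  have e3 : (fun z : Phase d => S.limitHam z - S.ham 0 z) =O[𝓝 0] fun z => ‖z‖ ^ 3 := by
    refine Asymptotics.IsBigO.of_bound (2 * S.ε 0) ?_
    filter_upwards [Metric.closedBall_mem_nhds (0 : Phase d) one_pos] with z hz
    rw [mem_closedBall_zero_iff] at hz
    rw [limitHam, add_sub_cancel_left, norm_pow, norm_norm]
    refine tsum_of_norm_bounded ((hasSum_geometric_two' (2 * S.ε 0)).mul_right (‖z‖ ^ 3))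
      fun n => ?_
    refine ((S.close n).ham z hz).trans (mul_le_mul_of_nonneg_right ?_ (by positivity))
    simpa using S.ε_add_le 0 n
  refine (e3.add e1).congr_left fun z => ?_
  rw [hz]
  ring

/-- Over the complement of `D` all conjugacies are the identity, so each approximate flow rotates
with frequency `grad (S.h n)`, and these gradients form a Cauchy sequence. -/
lemma exists_frequency : ∃ Ω : (Fin d → ℝ) → Fin d → ℝ, ∀ z, action z ∉ Z.D → ∀ t,
    S.limitFlow t z = rotate (t • Ω (action z)) z := by
  have hlim : ∀ r, ∃ v, Tendsto (fun n => grad (S.h n) r) atTop (𝓝 v) := by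
    intro r
    obtain ⟨n, hn⟩ := exists_nat_ge ‖r‖
    have hc : CauchySeq fun k => grad (S.h (n + k)) r :=
      cauchySeq_of_le_geometric_two (C := 2 * S.ε n) fun k => by
        rw [dist_comm, dist_eq_norm]
        refine ((S.close (n + k)).freq r (hn.trans ?_)).trans (S.ε_add_le n k)
        exact_mod_cast Nat.le_add_right n k
    obtain ⟨v, hv⟩ := cauchySeq_tendsto_of_complete hc
    refine ⟨v, ?_⟩
    rw [← tendsto_add_atTop_iff_nat n]
    simpa only [add_comm] using hv
  choose Ω hΩ using hlim
  refine ⟨Ω, fun z hz t => tendsto_nhds_unique (S.tendsto_flow t z) ?_⟩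
  have h1 : ∀ n, S.flow n t z = rotate (t • grad (S.h n) (action z)) z := by
    intro n
    obtain ⟨K, -, hKD, hid, hid'⟩ := (S.isState n).symm_eq
    have hzK : action z ∉ K := fun h => hz (hKD h)
    rw [flow, conjFlow, hid z hzK, hid' _ (by simpa using hzK), actionFlow]
  simp only [h1]
  have h2 : Continuous fun v : Fin d → ℝ => rotate (t • v) z := by
    have := (continuous_rotate (d := d)).comp
      ((continuous_const_smul t).prodMk (continuous_const (y := z)))
    exact this
  exact (h2.tendsto _).comp (hΩ _)

/-- Either step `j` treats `z`, or the actions of `S.G j z` lie in no core of the parity of `j`. In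
the second case, by `preserve`, those of `S.G (j + 1) z` do not either; as the cores cover `D`, they
lie in one of the other parity and step `j + 1` treats `z`. -/
lemma exists_exit {z : Phase d} (hz : action z ∈ Z.D) {K : Set (Fin d → ℝ)} (hK : IsCompact K)
    (hKD : K ⊆ Z.D) : ∃ t, action (S.limitFlow t z) ∉ K := by
  obtain ⟨j, hj⟩ := Z.exists_subset_Q K hK hKD
  by_cases hzj : action z ∈ Z.Q j
  swap
  · exact ⟨0, by rw [S.isHamiltonianFlow_limitFlow.1]; exact fun h => hzj (hj h)⟩
  have hst := fun n => (S.stable n S.limitFlow (S.motionClose_limitFlow (n + 1))).1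
  by_cases h1 : ∃ m, m % 2 = j % 2 ∧ action (S.G j z) ∈ Z.C m
  · obtain ⟨m, hm, hmC⟩ := h1
    obtain ⟨t, ht⟩ := hst j m hm z hzj hmC
    exact ⟨t, fun h => ht (hj h)⟩
  · push Not at h1
    obtain ⟨m, hm⟩ := Z.cover _ (((S.isState (j + 1)).action_mem z).2 hz)
    have hpar : m % 2 = (j + 1) % 2 := by
      by_contra hne
      exact h1 m (by omega) (S.preserve j m (by omega) z hm)
    have hmono := Z.monotone_Q (Nat.le_succ j)
    obtain ⟨t, ht⟩ := hst (j + 1) m hpar z (hmono hzj) hm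
    exact ⟨t, fun h => ht (hmono (hj h))⟩

lemma isDiffusive_limitFlow (hD : Z.Drift) : IsDiffusive S.limitFlow := by
  intro A hA
  obtain ⟨n, hn⟩ := exists_nat_ge A
  obtain ⟨p, t₁, t₂, h1, h2⟩ := (S.stable n S.limitFlow (S.motionClose_limitFlow (n + 1))).2 hD
  refine ⟨p, t₁, t₂, h1.le.trans ?_, by linarith⟩
  exact inv_anti₀ hA (by linarith)

end ApproxSeq

theorem ZoneSystem.exists_hamiltonian (Z : ZoneSystem d) {h₀ : (Fin d → ℝ) → ℝ} (hadm : Z.Adm h₀)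
    {ω₀ : Fin d → ℝ} (h0 : (fun r => h₀ r - ∑ i, ω₀ i * r i) =O[𝓝 0] fun r => ‖r‖ ^ 2) :
    ∃ (H : Phase d → ℝ) (Φ : ℝ → Phase d → Phase d), ContDiff ℝ ∞ H ∧
      IsEllipticWithFrequency ω₀ H ∧ IsHamiltonianFlow H Φ ∧
      (∃ Ω : (Fin d → ℝ) → Fin d → ℝ, ∀ z, action z ∉ Z.D → ∀ t,
        Φ t z = rotate (t • Ω (action z)) z) ∧
      (∀ z, action z ∈ Z.D → ∀ K, IsCompact K → K ⊆ Z.D → ∃ t, action (Φ t z) ∉ K) ∧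
      (Z.Drift → IsDiffusive Φ) := by
  obtain ⟨S⟩ := exists_approxSeq Z hadm
  exact ⟨S.limitHam, S.limitFlow, S.contDiff_limitHam, S.isElliptic_limitHam h0,
    S.isHamiltonianFlow_limitFlow, S.exists_frequency, fun z hz K hK hKD => S.exists_exit hz hK hKD,
    S.isDiffusive_limitFlow⟩

end Limit

/-! ### Null sets, accumulation of orbits, absence of invariant tori over the domain. -/

section Consequences

variable {d : ℕ}

lemma notMem_exceptionalSet_iff {k : Fin d} {a : ℤ → ℝ} {z : Phase d} :
    z ∉ exceptionalSet k a ↔ (∀ i, 0 < action z i) ∧ ∀ n, action z k ≠ a n := by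
  simp only [exceptionalSet, Set.mem_ofPred_eq, not_or, not_exists]
  refine and_congr_left fun _ => forall_congr' fun i => ?_
  exact ⟨fun h => lt_of_le_of_ne (action_nonneg z i) (Ne.symm h), fun h => h.ne'⟩

lemma volume_action_eq_zero (i : Fin d) : volume {z : Phase d | action z i = 0} = 0 := by
  let f : Phase d →ₗ[ℝ] ℝ := (EuclideanSpace.proj (Sum.inl i) : Phase d →L[ℝ] ℝ)
  refine measure_mono_null (t := (LinearMap.ker f : Set (Phase d))) (fun z hz => ?_)
    (Measure.addHaar_submodule _ _ fun h => ?_)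
  · change z (Sum.inl i) = 0
    have h1 : (z (Sum.inl i) ^ 2 + z (Sum.inr i) ^ 2) / 2 = 0 := hz
    nlinarith [sq_nonneg (z (Sum.inl i)), sq_nonneg (z (Sum.inr i))]
  · have : (EuclideanSpace.single (Sum.inl i) 1 : Phase d) ∈ LinearMap.ker f := by
      rw [h]; trivial
    have h1 : (EuclideanSpace.single (Sum.inl i) 1 : Phase d) (Sum.inl i) = 0 := this
    simp at h1

/-- Homotheties map the positive levels of an action onto each other. If one had positive measure,
all of these uncountably many disjoint sets would, which a σ-finite measure forbids. -/
lemma volume_action_eq {k : Fin d} {a : ℝ} (ha : 0 < a) :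
    volume {z : Phase d | action z k = a} = 0 := by
  by_contra hne
  have hpos : ∀ s : ℝ, 0 < s → 0 < volume {z : Phase d | action z k = s ^ 2 * a} := by
    intro s hs
    have h1 : {z : Phase d | action z k = a} = (fun z => s • z) ⁻¹'
        {z : Phase d | action z k = s ^ 2 * a} := by
      ext z
      have : action (s • z) k = s ^ 2 * action z k := by
        simp only [action, PiLp.smul_apply, smul_eq_mul]; ring
      simp only [Set.mem_ofPred_eq, Set.mem_preimage, this]
      exact ⟨fun h => by rw [h], fun h => mul_left_cancel₀ (by positivity) h⟩
    have h2 : volume {z : Phase d | action z k = a} =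
        ENNReal.ofReal |(s ^ Module.finrank ℝ (Phase d))⁻¹| *
          volume {z : Phase d | action z k = s ^ 2 * a} := by
      conv_lhs => rw [h1]
      exact Measure.addHaar_preimage_smul _ hs.ne' _
    refine pos_iff_ne_zero.2 fun h => hne ?_
    rw [h2, h, mul_zero]
  have hc := Measure.countable_meas_level_set_pos (μ := (volume : Measure (Phase d)))
    (g := fun z => action z k) ((continuous_apply k).comp continuous_action).measurable
  have hu : ¬ (Set.Ioi (0 : ℝ)).Countable := by
    rw [← Cardinal.le_aleph0_iff_set_countable, Cardinal.mk_Ioi_real, not_le]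
    exact Cardinal.aleph0_lt_continuum
  refine hu (hc.mono fun x (hx : 0 < x) => ?_)
  have := hpos (Real.sqrt (x / a)) (Real.sqrt_pos.2 (by positivity))
  rw [Real.sq_sqrt (by positivity), div_mul_cancel₀ _ ha.ne'] at this
  exact this

lemma volume_exceptionalSet {k : Fin d} {a : ℤ → ℝ} (ha : ∀ n, 0 < a n) :
    volume (exceptionalSet k a) = 0 := by
  have : exceptionalSet k a = (⋃ i, {z : Phase d | action z i = 0}) ∪
      ⋃ n, {z : Phase d | action z k = a n} := by
    ext z; simp [exceptionalSet]
  rw [this]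
  exact measure_union_null (measure_iUnion_null fun i => volume_action_eq_zero i)
    (measure_iUnion_null fun n => volume_action_eq (ha n))

variable {D : Set (Fin d → ℝ)} {Q : ℕ → Set (Fin d → ℝ)}

/-- A limit point of a sequence which leaves an exhaustion of `D` is not in `D`. -/
lemma notMem_of_tendsto (hD : IsOpen D) (hQ : Monotone Q)
    (hex : ∀ K, IsCompact K → K ⊆ D → ∃ j, K ⊆ Q j) {x : ℕ → Fin d → ℝ} {φ : ℕ → ℕ}
    (hφ : StrictMono φ) (hx : ∀ n, x n ∉ Q n) {r : Fin d → ℝ}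
    (hr : Tendsto (x ∘ φ) atTop (𝓝 r)) : r ∉ D := by
  intro hrD
  obtain ⟨K, hK, hrK, hKD⟩ := exists_compact_subset hD hrD
  obtain ⟨j, hj⟩ := hex K hK hKD
  obtain ⟨n, hn1, hn2⟩ := ((hr.eventually (isOpen_interior.mem_nhds hrK)).and
    (eventually_ge_atTop j)).exists
  exact hx (φ n) (hQ (hn2.trans (hφ.id_le n)) (hj (interior_subset hn1)))

lemma accumulates_of_exit (hD : IsOpen D) (hQ : Monotone Q)
    (hex : ∀ K, IsCompact K → K ⊆ D → ∃ j, K ⊆ Q j) {Φ : ℝ → Phase d → Phase d} {z : Phase d}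
    (hz : ∀ j, ∃ t, action (Φ t z) ∉ Q j) :
    AccumulatesOn Φ z {w | action w ∉ D} ∨ AccumulatesAtInfinity Φ z := by
  choose t ht using hz
  by_cases hinf : Tendsto (fun j => ‖Φ (t j) z‖) atTop atTop
  · exact Or.inr ⟨t, hinf⟩
  left
  obtain ⟨R, hR⟩ : ∃ R, ∃ᶠ j in atTop, Φ (t j) z ∈ Metric.closedBall (0 : Phase d) R := by
    rw [tendsto_atTop] at hinf
    push Not at hinf
    obtain ⟨R, hR⟩ := hinf
    refine ⟨R, hR.mono fun j hj => ?_⟩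
    rw [mem_closedBall_zero_iff]
    exact le_of_lt (by simpa using hj)
  obtain ⟨w, -, φ, hφ, hw⟩ := (isCompact_closedBall (0 : Phase d) R).tendsto_subseq' hR
  exact ⟨w, notMem_of_tendsto hD hQ hex hφ ht ((continuous_action.tendsto w).comp hw),
    t ∘ φ, hw⟩

lemma exists_mem_cube (x : EuclideanSpace ℝ (Fin d)) :
    ∃ n : Fin d → ℤ, ∀ i, x i + 2 * Real.pi * n i ∈ Set.Icc 0 (2 * Real.pi) := by
  refine ⟨fun i => -⌊x i / (2 * Real.pi)⌋, fun i => ?_⟩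
  have hp : 0 < 2 * Real.pi := by positivity
  have h1 := Int.floor_le (x i / (2 * Real.pi))
  have h2 := (Int.lt_floor_add_one (x i / (2 * Real.pi))).le
  rw [le_div_iff₀ hp] at h1
  rw [div_le_iff₀ hp] at h2
  push_cast
  constructor <;> linarith

/-- An invariant torus with linear dynamics is disjoint from the set of orbits which leave every
compact subset of `D`, when the flow preserves the actions outside `D`. -/
lemma IsInvariantLagrangianTorus.action_notMem (hD : IsOpen D) (hQ : Monotone Q)
    (hex : ∀ K, IsCompact K → K ⊆ D → ∃ j, K ⊆ Q j) {Φ : ℝ → Phase d → Phase d}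
    (hexit : ∀ z, action z ∈ D → ∀ j, ∃ t, action (Φ t z) ∉ Q j)
    (hinv : ∀ z, action z ∉ D → ∀ t, action (Φ t z) = action z) {T : Set (Phase d)}
    (hT : IsInvariantLagrangianTorus Φ T) {z : Phase d} (hz : z ∈ T) : action z ∉ D := by
  obtain ⟨φ, Ω, hφ, hper, -, -, hflow, rfl⟩ := hT
  obtain ⟨u, rfl⟩ := hz
  intro huD
  choose t ht using hexit _ huD
  choose n hn using fun j => exists_mem_cube (u + t j • Ω)
  let y : ℕ → EuclideanSpace ℝ (Fin d) := fun j =>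
    WithLp.toLp 2 fun i => (u + t j • Ω) i + 2 * Real.pi * n j i
  have hcube : IsCompact (WithLp.toLp 2 '' Set.univ.pi
      fun _ : Fin d => Set.Icc (0 : ℝ) (2 * Real.pi)) :=
    (isCompact_univ_pi fun _ => isCompact_Icc).image (PiLp.continuous_toLp 2 _)
  have hy : ∀ j, y j ∈ WithLp.toLp 2 '' Set.univ.pi
      fun _ : Fin d => Set.Icc (0 : ℝ) (2 * Real.pi) := fun j =>
    ⟨_, fun i _ => hn j i, rfl⟩
  -- The exit times give a limit point `φ v` on the compact torus, and its actions are outside `D`.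
  obtain ⟨v, -, ψ, hψ, hv⟩ := hcube.tendsto_subseq hy
  have hφy : ∀ j, φ (y j) = Φ (t j) (φ u) := fun j => by
    rw [hflow]
    exact ((hper _ _).2 fun i => ⟨n j i, rfl⟩).symm
  have hlim : Tendsto ((fun j => action (Φ (t j) (φ u))) ∘ ψ) atTop (𝓝 (action (φ v))) := by
    simp only [← hφy]
    exact ((continuous_action.comp hφ.continuous).tendsto v).comp hv
  have hvD := notMem_of_tendsto hD hQ hex hψ ht hlim
  -- Running the linear flow backwards from `φ v` leads back towards `φ u`. But the actions of `φ v`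
  -- never change, so those of `φ u` would be outside `D` as well.
  have hback : ∀ j, Φ (-t j) (φ v) = φ (u + (v - y j)) := fun j => by
    rw [hflow, hper]
    intro i
    refine ⟨-n j i, ?_⟩
    simp [y]
    ring
  have hlim' : Tendsto (fun j => action (φ (u + (v - y (ψ j))))) atTop (𝓝 (action (φ u))) := by
    have hc : Continuous fun x => action (φ (u + (v - x))) :=
      continuous_action.comp (hφ.continuous.comp (by fun_prop))
    have := (hc.tendsto v).comp hv
    simpa [Function.comp_def] using this
  have hconst : ∀ j, action (φ (u + (v - y (ψ j)))) = action (φ v) := fun j => by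
    rw [← hback, hinv _ hvD]
  simp only [hconst] at hlim'
  rw [tendsto_nhds_unique hlim' tendsto_const_nhds] at huD
  exact hvD huD

end Consequences

/-! ### The levels, the cells between them, and the exhaustion of their union. -/

section CellDomain

/-- The levels `a_n`. -/
def level (n : ℤ) : ℝ := (9 / 8) ^ n

lemma level_pos (n : ℤ) : 0 < level n := zpow_pos (by norm_num) n

lemma level_succ (n : ℤ) : level (n + 1) = 9 / 8 * level n := by
  rw [level, zpow_add_one₀ (by norm_num), mul_comm]; rfl

lemma strictMono_level : StrictMono level := zpow_right_strictMono₀ (by norm_num)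

lemma tendsto_level_atTop : Tendsto level atTop atTop := by
  refine tendsto_atTop_atTop_of_monotone strictMono_level.monotone fun b => ?_
  obtain ⟨n, hn⟩ := pow_unbounded_of_one_lt b (show (1 : ℝ) < 9 / 8 by norm_num)
  exact ⟨n, by rw [level, zpow_natCast]; exact hn.le⟩

lemma tendsto_level_atBot : Tendsto level atBot (𝓝 0) := by
  have h1 : Tendsto (fun n : ℤ => (level (-n))⁻¹) atBot (𝓝 0) :=
    tendsto_inv_atTop_zero.comp (tendsto_level_atTop.comp tendsto_neg_atBot_atTop)
  refine h1.congr fun n => ?_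
  rw [level, level, zpow_neg, inv_inv]

lemma exists_level_le {y : ℝ} (hy : 0 < y) : ∃ n, level n ≤ y ∧ y < level (n + 1) :=
  exists_mem_Ico_zpow hy (by norm_num)

variable {d : ℕ} (k : Fin d)

/-- The positive actions which do not lie on one of the levels. -/
def cellDomain : Set (Fin d → ℝ) := {r | (∀ i, 0 < r i) ∧ ∀ n, r k ≠ level n}

/-- The actions in the open cell between two levels. -/
def cell (n : ℤ) : Set (Fin d → ℝ) := {r | (∀ i, 0 < r i) ∧ level n < r k ∧ r k < level (n + 1)}

lemma isOpen_cell (n : ℤ) : IsOpen (cell k n) := by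
  have h1 : IsOpen {r : Fin d → ℝ | ∀ i, 0 < r i} := by
    simp only [Set.ofPred_forall]
    exact isOpen_iInter_of_finite fun i => isOpen_lt continuous_const (continuous_apply i)
  exact h1.inter ((isOpen_lt continuous_const (continuous_apply k)).inter
    (isOpen_lt (continuous_apply k) continuous_const))

variable {k}

lemma cell_subset (n : ℤ) : cell k n ⊆ cellDomain k := by
  rintro r ⟨h1, h2, h3⟩
  refine ⟨h1, fun m hm => ?_⟩
  rw [hm] at h2 h3
  have h4 := strictMono_level.lt_iff_lt.1 h2
  have h5 := strictMono_level.lt_iff_lt.1 h3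
  omega

lemma exists_mem_cell {r : Fin d → ℝ} (hr : r ∈ cellDomain k) : ∃ n, r ∈ cell k n := by
  obtain ⟨n, h1, h2⟩ := exists_level_le (hr.1 k)
  exact ⟨n, hr.1, lt_of_le_of_ne h1 (Ne.symm (hr.2 n)), h2⟩

lemma cell_unique {r : Fin d → ℝ} {n n' : ℤ} (h : r ∈ cell k n) (h' : r ∈ cell k n') : n = n' := by
  have h1 := strictMono_level.lt_iff_lt.1 (h.2.1.trans h'.2.2)
  have h2 := strictMono_level.lt_iff_lt.1 (h'.2.1.trans h.2.2)
  omega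

lemma isOpen_cellDomain : IsOpen (cellDomain k) := by
  have : cellDomain k = ⋃ n, cell k n := by
    ext r
    simp only [Set.mem_iUnion]
    exact ⟨exists_mem_cell, fun ⟨n, hn⟩ => cell_subset n hn⟩
  rw [this]
  exact isOpen_iUnion (isOpen_cell k)

lemma lineIn_lt_iff {κ : Fin d → ℤ} {ρ : Fin d → ℝ} {t : ℝ} (h : LineIn (cellDomain k) κ ρ t)
    (n : ℤ) : ρ k < level n ↔ (ρ + t • (fun i => (κ i : ℝ))) k < level n := by
  have key : level n ∉ (fun s => (ρ + s • (fun i => (κ i : ℝ))) k) '' Set.uIcc 0 t := by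
    rintro ⟨s, hs, he⟩
    exact (h s hs).2 n he
  have hsub : Set.uIcc (ρ k) ((ρ + t • (fun i => (κ i : ℝ))) k) ⊆
      (fun s => (ρ + s • (fun i => (κ i : ℝ))) k) '' Set.uIcc 0 t := by
    have hc : Continuous fun s : ℝ => (ρ + s • (fun i => (κ i : ℝ))) k := by
      simp only [Pi.add_apply, Pi.smul_apply]
      fun_prop
    have := intermediate_value_uIcc (a := 0) (b := t) hc.continuousOn
    simpa using this
  have hn : level n ∉ Set.uIcc (ρ k) ((ρ + t • (fun i => (κ i : ℝ))) k) := fun h => key (hsub h)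
  rw [Set.mem_uIcc] at hn
  push Not at hn
  constructor
  · intro h1
    exact hn.1 h1.le
  · intro h1
    by_contra h2
    exact absurd (hn.2 h1.le) h2

lemma lineIn_mem_cell {κ : Fin d → ℤ} {ρ : Fin d → ℝ} {t : ℝ} (h : LineIn (cellDomain k) κ ρ t)
    {n : ℤ} (hρ : ρ ∈ cell k n) : ρ + t • (fun i => (κ i : ℝ)) ∈ cell k n := by
  have h1 := h.right_mem
  refine ⟨h1.1, ?_, (lineIn_lt_iff h (n + 1)).1 hρ.2.2⟩
  refine lt_of_le_of_ne (le_of_not_gt fun hlt => ?_) (Ne.symm (h1.2 n))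
  exact absurd ((lineIn_lt_iff h n).2 hlt) (not_lt.2 hρ.2.1.le)

variable (k)

/-- An exhaustion of the domain by compact sets. -/
def cellExhaustion (j : ℕ) : Set (Fin d → ℝ) :=
  {r | (∀ i, ((j : ℝ) + 1)⁻¹ ≤ r i ∧ r i ≤ (j : ℝ) + 1) ∧
    ∀ n, ((j : ℝ) + 1)⁻¹ ≤ |r k - level n|}

lemma isCompact_cellExhaustion (j : ℕ) : IsCompact (cellExhaustion k j) := by
  refine (isCompact_univ_pi fun _ : Fin d =>
    isCompact_Icc (a := ((j : ℝ) + 1)⁻¹) (b := (j : ℝ) + 1)).of_isClosed_subset ?_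
    fun r hr i _ => hr.1 i
  have h1 : IsClosed {r : Fin d → ℝ | ∀ i, ((j : ℝ) + 1)⁻¹ ≤ r i ∧ r i ≤ (j : ℝ) + 1} := by
    simp only [Set.ofPred_forall]
    exact isClosed_iInter fun i => (isClosed_le continuous_const (continuous_apply i)).inter
      (isClosed_le (continuous_apply i) continuous_const)
  have h2 : IsClosed {r : Fin d → ℝ | ∀ n, ((j : ℝ) + 1)⁻¹ ≤ |r k - level n|} := by
    simp only [Set.ofPred_forall]
    exact isClosed_iInter fun n => isClosed_le continuous_const
      ((continuous_apply k).sub continuous_const).abs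
  exact h1.inter h2

lemma cellExhaustion_subset (j : ℕ) : cellExhaustion k j ⊆ cellDomain k := by
  intro r hr
  have hj : 0 < ((j : ℝ) + 1)⁻¹ := by positivity
  refine ⟨fun i => hj.trans_le (hr.1 i).1, fun n hn => ?_⟩
  have := hr.2 n
  rw [hn, sub_self, abs_zero] at this
  linarith

lemma monotone_cellExhaustion : Monotone (cellExhaustion k) := by
  intro j j' hj r hr
  have h1 : (j : ℝ) + 1 ≤ (j' : ℝ) + 1 := by
    have : (j : ℝ) ≤ j' := by exact_mod_cast hj
    linarith
  have h2 : ((j' : ℝ) + 1)⁻¹ ≤ ((j : ℝ) + 1)⁻¹ := inv_anti₀ (by positivity) h1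
  exact ⟨fun i => ⟨h2.trans (hr.1 i).1, (hr.1 i).2.trans h1⟩, fun n => h2.trans (hr.2 n)⟩

/-- A δ-neighbourhood of `K` stays in the domain. Replacing one coordinate by 0, or `r k` by a
level, leaves the domain, so these changes have size at least δ. -/
lemma exists_subset_cellExhaustion {K : Set (Fin d → ℝ)} (hK : IsCompact K)
    (hKD : K ⊆ cellDomain k) : ∃ j, K ⊆ cellExhaustion k j := by
  obtain ⟨δ, hδ, hsub⟩ := hK.exists_thickening_subset_open isOpen_cellDomain hKD
  obtain ⟨R, hR⟩ := hK.isBounded.exists_norm_le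
  obtain ⟨j, hj⟩ := exists_nat_ge (max R δ⁻¹)
  have hjδ : ((j : ℝ) + 1)⁻¹ ≤ δ := by
    rw [inv_le_comm₀ (by positivity) hδ]
    linarith [le_max_right R δ⁻¹]
  have hupd : ∀ r ∈ K, ∀ i x, |r i - x| < δ → Function.update r i x ∈ cellDomain k := by
    intro r hr i x hx
    refine hsub (Metric.mem_thickening_iff.2 ⟨r, hr, ?_⟩)
    rw [dist_pi_lt_iff hδ]
    intro b
    by_cases hb : b = i
    · subst hb
      rwa [Function.update_self, Real.dist_eq, abs_sub_comm]
    · rw [Function.update_of_ne hb, dist_self]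
      exact hδ
  refine ⟨j, fun r hr => ⟨fun i => ⟨?_, ?_⟩, fun n => ?_⟩⟩
  · by_contra hlt
    have hri := (hKD hr).1 i
    have := (hupd r hr i 0 (by rw [sub_zero, abs_of_pos hri]; linarith)).1 i
    simp at this
  · have h1 := (norm_le_pi_norm r i).trans (hR r hr)
    have h2 := le_abs_self (r i)
    rw [Real.norm_eq_abs] at h1
    linarith [le_max_left R δ⁻¹]
  · by_contra hlt
    have := (hupd r hr k (level n) (by linarith)).2 n
    simp at this

/-- Each coordinate is monotone along the segment, and `r k` stays on one side of each level, so
every defining inequality follows from the one at an end. -/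
lemma lineIn_cellExhaustion (j : ℕ) (κ : Fin d → ℤ) (ρ : Fin d → ℝ) (t : ℝ)
    (h1 : ρ ∈ cellExhaustion k j) (h2 : ρ + t • (fun i => (κ i : ℝ)) ∈ cellExhaustion k j)
    (h : LineIn (cellDomain k) κ ρ t) : LineIn (cellExhaustion k j) κ ρ t := by
  intro s hs
  have hmem : ∀ i, (ρ + s • (fun i => (κ i : ℝ))) i ∈
      Set.uIcc (ρ i) ((ρ + t • (fun i => (κ i : ℝ))) i) := by
    intro i
    simp only [Pi.add_apply, Pi.smul_apply, smul_eq_mul]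
    rw [Set.mem_uIcc] at hs ⊢
    rcases le_total 0 (κ i : ℝ) with hκ | hκ
    · rcases hs with hs | hs
      · left; constructor <;> nlinarith [hs.1, hs.2]
      · right; constructor <;> nlinarith [hs.1, hs.2]
    · rcases hs with hs | hs
      · right; constructor <;> nlinarith [hs.1, hs.2]
      · left; constructor <;> nlinarith [hs.1, hs.2]
  refine ⟨fun i => ?_, fun n => ?_⟩
  · have := hmem i
    rw [Set.mem_uIcc] at this
    have e1 := h1.1 i
    have e2 := h2.1 i
    rcases this with h3 | h3
    · exact ⟨e1.1.trans h3.1, h3.2.trans e2.2⟩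
    · exact ⟨e2.1.trans h3.1, h3.2.trans e1.2⟩
  · have h3 := hmem k
    rw [Set.mem_uIcc] at h3
    have e1 := h1.2 n
    have e2 := h2.2 n
    have e3 := lineIn_lt_iff h n
    have hpos : 0 < ((j : ℝ) + 1)⁻¹ := by positivity
    rcases lt_or_ge (ρ k) (level n) with hlt | hge
    · have hlt' := e3.1 hlt
      rw [abs_of_neg (by linarith)] at e1 e2
      rw [le_abs]
      right
      rcases h3 with h3 | h3 <;> linarith [h3.1, h3.2]
    · have hge' := not_lt.1 (mt e3.2 (not_lt.2 hge))
      rw [abs_of_nonneg (by linarith)] at e1 e2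
      rw [le_abs]
      left
      rcases h3 with h3 | h3 <;> linarith [h3.1, h3.2]

end CellDomain

/-! ### The case where only the k-th frequency may be nonzero. -/

section Degenerate

variable {d : ℕ}

lemma sum_mul_grad_eq {h : (Fin d → ℝ) → ℝ} {r v : Fin d → ℝ} {D : ℝ}
    (hh : DifferentiableAt ℝ h r) (hd : HasDerivAt (fun s : ℝ => h (r + s • v)) D 0) :
    ∑ i, v i * grad h r i = D := by
  rw [← fderiv_eq_sum_grad]
  have h1 : HasDerivAt (fun s : ℝ => r + s • v) v 0 := by
    simpa using ((hasDerivAt_id (0 : ℝ)).smul_const v).const_add r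
  have h2 : HasFDerivAt h (fderiv ℝ h r) (r + (0 : ℝ) • v) := by simpa using hh.hasFDerivAt
  exact (h2.comp_hasDerivAt 0 h1).unique hd

/-- The Hamiltonians which are used when only the `k`-th frequency is nonzero. -/
def degenerateHam (w : ℝ) (i j k : Fin d) (t : ℝ) (r : Fin d → ℝ) : ℝ :=
  w * r k + r k * (r i + t * r j)

lemma contDiff_degenerateHam (w : ℝ) (i j k : Fin d) (t : ℝ) :
    ContDiff ℝ ∞ (degenerateHam w i j k t) := by
  unfold degenerateHam
  fun_prop

lemma sum_mul_grad_degenerateHam (w : ℝ) (i j k : Fin d) (t : ℝ) (r : Fin d → ℝ)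
    {κ : Fin d → ℤ} (hκ : κ k = 0) :
    ∑ x, κ x * grad (degenerateHam w i j k t) r x = r k * (κ i + t * κ j) := by
  refine sum_mul_grad_eq (v := fun x => (κ x : ℝ))
    ((contDiff_degenerateHam w i j k t).differentiable (by simp)).differentiableAt ?_
  have h1 : (fun s : ℝ => degenerateHam w i j k t (r + s • fun x => (κ x : ℝ))) =
      fun s => degenerateHam w i j k t r + s * (r k * (κ i + t * κ j)) := by
    funext s
    simp only [degenerateHam, Pi.add_apply, Pi.smul_apply, hκ, smul_eq_mul, Int.cast_zero]
    ring
  rw [h1]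
  simpa using ((hasDerivAt_id (0 : ℝ)).mul_const (r k * (κ i + t * κ j))).const_add
    (degenerateHam w i j k t r)

lemma isBigO_mul_coord (i j : Fin d) :
    (fun r : Fin d → ℝ => r i * r j) =O[𝓝 0] fun r => ‖r‖ ^ 2 := by
  refine Asymptotics.IsBigO.of_bound 1 (Eventually.of_forall fun r => ?_)
  rw [norm_mul, norm_pow, norm_norm, one_mul, sq]
  exact mul_le_mul (norm_le_pi_norm r i) (norm_le_pi_norm r j) (norm_nonneg _) (norm_nonneg _)

/-- The zone system with one zone, for the Hamiltonians `degenerateHam w i j k t`. -/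
def degenerateZones (w : ℝ) (i j k : Fin d) (hij : i ≠ j) (hik : i ≠ k) (hjk : j ≠ k) :
    ZoneSystem d where
  D := cellDomain k
  pos r hr := hr.1
  zero_notMem h := lt_irrefl _ (h.1 k)
  Q := cellExhaustion k
  isCompact_Q := isCompact_cellExhaustion k
  Q_subset := cellExhaustion_subset k
  monotone_Q := monotone_cellExhaustion k
  exists_subset_Q _ hK hKD := exists_subset_cellExhaustion k hK hKD
  lineIn_Q := lineIn_cellExhaustion k
  O m := {r | m = 0 ∧ r ∈ cellDomain k}
  C m := {r | m = 0 ∧ r ∈ cellDomain k}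
  isOpen_O m := isOpen_const.inter isOpen_cellDomain
  O_subset _ _ hr := hr.2
  C_subset _ := subset_rfl
  isCompact_C_inter m K hK hKD := by
    by_cases hm : m = 0
    · convert hK using 1
      exact Set.inter_eq_right.2 fun r hr => ⟨hm, hKD hr⟩
    · convert isCompact_empty using 1
      exact Set.eq_empty_of_forall_notMem fun r hr => hm hr.1.1
  cover _ hr := ⟨0, rfl, hr⟩
  disjoint_O m m' hne _ := Set.disjoint_left.2 fun r hr hr' => hne (hr.1.trans hr'.1.symm)
  finite_C _ _ _ := ⟨1, fun m ⟨r, hr⟩ => by rw [hr.1.1]; exact one_pos⟩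
  dir _ := {κ | κ k = 0 ∧ κ j ≠ 0}
  dir_ne _ κ hκ h := hκ.2 (by rw [h]; rfl)
  inv_O _ κ _ ρ hρ t ht := ⟨hρ.1, ht.right_mem⟩
  inv_C _ κ _ ρ hρ t ht := ⟨hρ.1, ht.right_mem⟩
  Adm h := ∃ t, h = degenerateHam w i j k t
  contDiff_of_adm h := by
    rintro ⟨t, rfl⟩
    exact contDiff_degenerateHam w i j k t
  perturb := by
    rintro h ⟨t, rfl⟩ M M' kv hkv
    refine ⟨1, fun _ r => r k * r j, fun _ => by fun_prop, fun _ => isBigO_mul_coord k j,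
      fun η hη => ?_⟩
    obtain ⟨q, hq1, hq2⟩ := exists_rat_btwn (show t < t + η by linarith)
    have hpert : perturbed (degenerateHam w i j k t) (fun (_ : Fin 1) r => r k * r j)
        (fun _ => (q : ℝ) - t) = degenerateHam w i j k q := by
      funext r
      simp only [perturbed, degenerateHam, Fin.sum_univ_one]
      ring
    refine ⟨fun _ => q - t, ?_, ⟨q, hpert⟩, ?_, ?_⟩
    · rw [pi_norm_const, Real.norm_eq_abs, abs_lt]
      constructor <;> linarith
    -- The pairing of a direction having `κ k = 0` with the gradient is `r k * (κ i + q * κ j)`,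
    -- which vanishes for this choice on the whole domain.
    · refine ⟨fun _ x => if x = j then (q.den : ℤ) else if x = i then -q.num else 0,
        fun m _ => ⟨⟨?_, ?_⟩, fun r _ => ?_⟩⟩
      · simp [hik.symm, hjk.symm]
      · simp
      · rw [hpert, sum_mul_grad_degenerateHam _ _ _ _ _ _ (by simp [hik.symm, hjk.symm])]
        have hq : (q : ℝ) * q.den = q.num := by exact_mod_cast Rat.mul_den_eq_num q
        simp [hij, hq]
    · intro m hm r hr
      obtain ⟨hκ, hres⟩ := hkv m hm
      have h0 := hres r hr
      have hrk : r k ≠ 0 := (hr.2.1 k).ne'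
      rw [sum_mul_grad_degenerateHam _ _ _ _ _ _ hκ.1] at h0
      rw [hpert, sum_mul_grad_degenerateHam _ _ _ _ _ _ hκ.1]
      have h1 : (kv m i : ℝ) + t * kv m j = 0 := (mul_eq_zero.1 h0).resolve_left hrk
      have h2 : (kv m i : ℝ) + q * kv m j = (q - t) * kv m j := by linear_combination h1
      rw [h2]
      exact mul_ne_zero hrk (mul_ne_zero (by linarith) (by exact_mod_cast hκ.2))

end Degenerate

/-! ### From a zone system on the cell domain to the dynamical statements. -/

section Conclusion

variable {d : ℕ}

lemma ZoneSystem.exists_of_cellDomain (Z : ZoneSystem d) {k : Fin d} (hD : Z.D = cellDomain k)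
    {h₀ : (Fin d → ℝ) → ℝ} {ω₀ : Fin d → ℝ} (hadm : Z.Adm h₀)
    (h0 : (fun r => h₀ r - ∑ i, ω₀ i * r i) =O[𝓝 0] fun r => ‖r‖ ^ 2) :
    ∃ (H : Phase d → ℝ) (Φ : ℝ → Phase d → Phase d),
      ContDiff ℝ ∞ H ∧
      IsEllipticWithFrequency ω₀ H ∧
      IsHamiltonianFlow H Φ ∧
      (∀ n, FoliatedByInvariantTori Φ {z | action z k = level n}) ∧
      (∀ i, FoliatedByInvariantTori Φ {z | action z i = 0}) ∧
      (∀ z, z ∉ exceptionalSet k level →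
        AccumulatesOn Φ z (exceptionalSet k level) ∨ AccumulatesAtInfinity Φ z) ∧
      ¬ IsKAMStable Φ ∧ (Z.Drift → IsDiffusive Φ) := by
  obtain ⟨H, Φ, hH, hell, hflow, ⟨Ω, hΩ⟩, hexit, hdiff⟩ := Z.exists_hamiltonian hadm h0
  have hmem : ∀ z : Phase d, action z ∈ Z.D ↔ z ∉ exceptionalSet k level := fun z => by
    rw [notMem_exceptionalSet_iff, hD]
    rfl
  have hfol : ∀ S : Set (Phase d), S ⊆ exceptionalSet k level → (∀ z ∈ S, flatTorus z ⊆ S) →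
      FoliatedByInvariantTori Φ S := fun S hS hsat z hz =>
    ⟨hsat z hz, Ω (action z), fun w hw t => by
      rw [hΩ w fun hw' => (hmem w).1 hw' (hS (hsat z hz hw)),
        show action w = action z from funext hw]⟩
  have hopen : IsOpen Z.D := hD ▸ isOpen_cellDomain
  have hexitQ : ∀ z, action z ∈ Z.D → ∀ j, ∃ t, action (Φ t z) ∉ Z.Q j := fun z hz j =>
    hexit z hz _ (Z.isCompact_Q j) (Z.Q_subset j)
  refine ⟨H, Φ, hH, hell, hflow, fun n => hfol _ (fun z hz => Or.inr ⟨n, hz⟩) ?_,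
    fun i => hfol _ (fun z hz => Or.inl ⟨i, hz⟩) ?_, fun z hz => ?_, fun hkam => ?_, hdiff⟩
  · exact fun z hz w hw => (hw k).trans hz
  · exact fun z hz w hw => (hw i).trans hz
  · have := accumulates_of_exit hopen Z.monotone_Q Z.exists_subset_Q (hexitQ z ((hmem z).2 hz))
    have hset : {w : Phase d | action w ∉ Z.D} = exceptionalSet k level := by
      ext w
      simp only [Set.mem_ofPred_eq, hmem, not_not]
    rwa [hset] at this
  · refine (hkam Set.univ univ_mem).ne' (measure_mono_null ?_
      (volume_exceptionalSet (k := k) level_pos))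
    rintro z ⟨T, ⟨hT, -⟩, hz⟩
    have := hT.action_notMem hopen Z.monotone_Q Z.exists_subset_Q hexitQ
      (fun w hw t => by rw [hΩ w hw, action_rotate]) hz
    rwa [hmem, not_not] at this

end Conclusion

/-! ### A smooth ramp function. -/

section Ramp

/-- A smooth function which is `0` for `x ≤ 0` and `x` for `1 ≤ x`. -/
def ramp (x : ℝ) : ℝ := x * Real.smoothTransition x

lemma contDiff_ramp : ContDiff ℝ ∞ ramp := contDiff_id.mul Real.smoothTransition.contDiff

lemma ramp_of_nonpos {x : ℝ} (hx : x ≤ 0) : ramp x = 0 := by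
  rw [ramp, Real.smoothTransition.zero_of_nonpos hx, mul_zero]

lemma ramp_of_one_le {x : ℝ} (hx : 1 ≤ x) : ramp x = x := by
  rw [ramp, Real.smoothTransition.one_of_one_le hx, mul_one]

lemma hasDerivAt_ramp_of_neg {x : ℝ} (hx : x < 0) : HasDerivAt ramp 0 x :=
  (hasDerivAt_const x (0 : ℝ)).congr_of_eventuallyEq
    ((eventually_lt_nhds hx).mono fun _ hy => ramp_of_nonpos hy.le)

lemma hasDerivAt_ramp_of_one_lt {x : ℝ} (hx : 1 < x) : HasDerivAt ramp 1 x :=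
  (hasDerivAt_id x).congr_of_eventuallyEq
    ((eventually_gt_nhds hx).mono fun _ hy => ramp_of_one_le hy.le)

end Ramp

/-! ### Geometry of the resonant zones. -/

section Zones

/-- The `m`-th zone may be active in the `n`-th cell. -/
def Active (m : ℕ) (n : ℤ) : Prop := (m : ℝ) + 10 < 2 ^ m * level (n + 1)

/-- A lower bound for the width of the `m`-th zone in the `n`-th cell. -/
def gap (m : ℕ) (n : ℤ) : ℝ := 2 ^ m * level n - 1

lemma Active.succ {m : ℕ} {n : ℤ} (h : Active m n) : Active (m + 1) n := by
  unfold Active at *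
  rw [pow_succ]
  push_cast
  linarith [Nat.cast_nonneg (α := ℝ) m]

lemma Active.mono {m m' : ℕ} {n : ℤ} (h : Active m n) (hm : m ≤ m') : Active m' n := by
  induction hm with
  | refl => exact h
  | step _ ih => exact ih.succ

/-- Activity gives `2 ^ m * level n > 8/9 * (m + 10) ≥ 80/9`. The margins of the zones are fractions
of the gap and have to exceed fixed constants. -/
lemma Active.gap_gt {m : ℕ} {n : ℤ} (h : Active m n) : 7 < gap m n := by
  unfold Active at h
  unfold gap
  rw [level_succ] at h
  linarith [Nat.cast_nonneg (α := ℝ) m]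

variable {d : ℕ} (i k : Fin d)

/-- The function `2 ^ m r_k - (m + 10) - r_i`, which is constant along the resonant lines of
the `m`-th zone. -/
def zoneCoord (m : ℕ) (r : Fin d → ℝ) : ℝ := 2 ^ m * r k - (m + 10) - r i

lemma contDiff_zoneCoord (m : ℕ) : ContDiff ℝ ∞ (zoneCoord i k m) := by
  unfold zoneCoord
  fun_prop

lemma continuous_zoneCoord (m : ℕ) : Continuous (zoneCoord i k m) :=
  (contDiff_zoneCoord i k m).continuous

lemma zoneCoord_succ (m : ℕ) (r : Fin d → ℝ) :
    zoneCoord i k (m + 1) r = zoneCoord i k m r + (2 ^ m * r k - 1) := by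
  unfold zoneCoord
  push_cast
  ring

lemma zoneCoord_line {p : ℕ} {κ : Fin d → ℤ} (hκ : κ i = 2 ^ p * κ k) (m : ℕ) (r : Fin d → ℝ)
    (s : ℝ) : zoneCoord i k m (r + s • fun x => (κ x : ℝ)) =
      zoneCoord i k m r + s * ((2 ^ m - 2 ^ p) * κ k) := by
  simp only [zoneCoord, Pi.add_apply, Pi.smul_apply, smul_eq_mul, hκ]
  push_cast
  ring

/-- The resonant zones. -/
def openZone (m : ℕ) : Set (Fin d → ℝ) :=
  {r | ∃ n, r ∈ cell k n ∧ Active m n ∧ -(7 / 10 * gap m n) < zoneCoord i k m r ∧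
    ∀ m', m' + 1 = m → Active m' n → zoneCoord i k m r < 7 / 10 * gap m' n}

/-- The cores of the resonant zones. -/
def closedZone (m : ℕ) : Set (Fin d → ℝ) :=
  {r | ∃ n, r ∈ cell k n ∧ Active m n ∧ -(13 / 20 * gap m n) ≤ zoneCoord i k m r ∧
    ∀ m', m' + 1 = m → Active m' n → zoneCoord i k m r ≤ 13 / 20 * gap m' n}

variable {i k}

lemma gap_lt {m : ℕ} {n : ℤ} {r : Fin d → ℝ} (hr : r ∈ cell k n) : gap m n < 2 ^ m * r k - 1 := by
  have : (2 : ℝ) ^ m * level n < 2 ^ m * r k := mul_lt_mul_of_pos_left hr.2.1 (by positivity)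
  unfold gap
  linarith

lemma lt_gap {m : ℕ} {n : ℤ} {r : Fin d → ℝ} (hr : r ∈ cell k n) :
    2 ^ m * r k - 1 < 9 / 8 * gap m n + 1 / 8 := by
  have : (2 : ℝ) ^ m * r k < 2 ^ m * level (n + 1) :=
    mul_lt_mul_of_pos_left hr.2.2 (by positivity)
  rw [level_succ] at this
  unfold gap
  linarith

lemma zoneCoord_mono {m m' : ℕ} {n : ℤ} {r : Fin d → ℝ} (hr : r ∈ cell k n) (hm : Active m n)
    (h : m ≤ m') : zoneCoord i k m r ≤ zoneCoord i k m' r := by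
  induction m', h using Nat.le_induction with
  | base => exact le_rfl
  | succ m' h ih =>
    rw [zoneCoord_succ]
    linarith [gap_lt (m := m') hr, (hm.mono h).gap_gt]

lemma zoneCoord_neg_of_not_active {m : ℕ} {n : ℤ} {r : Fin d → ℝ} (hr : r ∈ cell k n)
    (hm : ¬ Active m n) : zoneCoord i k m r < 0 := by
  have h1 : (2 : ℝ) ^ m * r k < 2 ^ m * level (n + 1) :=
    mul_lt_mul_of_pos_left hr.2.2 (by positivity)
  unfold Active at hm
  unfold zoneCoord
  linarith [hr.1 i]

/-- Passing from `p` to `p + 1` adds more than the gap, while the zone is bounded below by −7/10 of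
it; the remaining 3/10 of a gap above 7 exceeds 1. The upper bound of the zone gives `zoneCoord_neg`
in the same way. -/
lemma one_lt_zoneCoord {p m : ℕ} {r : Fin d → ℝ} (hr : r ∈ openZone i k p) (h : p < m) :
    1 < zoneCoord i k m r := by
  obtain ⟨n, hn, hact, hlow, -⟩ := hr
  have h1 := zoneCoord_mono (i := i) hn hact.succ h
  rw [zoneCoord_succ] at h1
  linarith [gap_lt (m := p) hn, hact.gap_gt]

lemma zoneCoord_neg {p m : ℕ} {r : Fin d → ℝ} (hr : r ∈ openZone i k p) (h : m < p) :
    zoneCoord i k m r < 0 := by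
  obtain ⟨n, hn, -, -, hup⟩ := hr
  by_cases hact : Active m n
  · obtain ⟨p, rfl⟩ : ∃ q, p = q + 1 := ⟨p - 1, by omega⟩
    have hp : Active p n := hact.mono (by omega)
    have h1 := hup p rfl hp
    rw [zoneCoord_succ] at h1
    have h2 := zoneCoord_mono (i := i) hn hact (show m ≤ p by omega)
    linarith [gap_lt (m := p) hn, hp.gap_gt]
  · exact zoneCoord_neg_of_not_active hn hact

lemma closedZone_subset (m : ℕ) : closedZone i k m ⊆ openZone i k m := by
  rintro r ⟨n, hn, hact, hlow, hup⟩
  refine ⟨n, hn, hact, by linarith [hact.gap_gt], fun m' hm' hact' => ?_⟩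
  linarith [hup m' hm' hact', hact'.gap_gt]

lemma openZone_subset (m : ℕ) : openZone i k m ⊆ cellDomain k := by
  rintro r ⟨n, hn, -⟩
  exact cell_subset n hn

lemma isOpen_openZone (m : ℕ) : IsOpen (openZone i k m) := by
  have : openZone i k m = ⋃ n, cell k n ∩ ({r | Active m n} ∩
      ({r | -(7 / 10 * gap m n) < zoneCoord i k m r} ∩
        {r | ∀ m', m' + 1 = m → Active m' n → zoneCoord i k m r < 7 / 10 * gap m' n})) := by
    ext r
    simp only [openZone, Set.mem_iUnion, Set.mem_inter_iff, Set.mem_ofPred_eq]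
  rw [this]
  refine isOpen_iUnion fun n => (isOpen_cell k n).inter (isOpen_const.inter
    ((isOpen_lt continuous_const (continuous_zoneCoord i k m)).inter ?_))
  rcases m with _ | m
  · simp
  · by_cases h : Active m n
    · simpa [h] using isOpen_lt (continuous_zoneCoord i k (m + 1)) continuous_const
    · simp [h]

/-- The cells are open, disjoint and cover the domain, so closed conditions imposed cell by cell
define a relatively closed subset. -/
lemma isCompact_closedZone_inter (m : ℕ) {K : Set (Fin d → ℝ)} (hK : IsCompact K)
    (hKD : K ⊆ cellDomain k) : IsCompact (closedZone i k m ∩ K) := by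
  let F : ℤ → Set (Fin d → ℝ) := fun n => {r | Active m n} ∩
      ({r | -(13 / 20 * gap m n) ≤ zoneCoord i k m r} ∩
        {r | ∀ m', m' + 1 = m → Active m' n → zoneCoord i k m r ≤ 13 / 20 * gap m' n})
  have hF : ∀ n, IsClosed (F n) := fun n => by
    refine isClosed_const.inter ((isClosed_le continuous_const
      (continuous_zoneCoord i k m)).inter ?_)
    simp only [Set.ofPred_forall]
    exact isClosed_iInter fun m' => isClosed_iInter fun _ => isClosed_iInter fun _ =>
      isClosed_le (continuous_zoneCoord i k m) continuous_const
  have : closedZone i k m ∩ K = K \ ⋃ n, cell k n \ F n := by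
    ext r
    constructor
    · rintro ⟨⟨n, hn, hr⟩, hrK⟩
      refine ⟨hrK, fun hr' => ?_⟩
      obtain ⟨n', hn', hF'⟩ := Set.mem_iUnion.1 hr'
      rw [← cell_unique hn hn'] at hF'
      exact hF' hr
    · rintro ⟨hrK, hr⟩
      obtain ⟨n, hn⟩ := exists_mem_cell (hKD hrK)
      refine ⟨⟨n, hn, ?_⟩, hrK⟩
      by_contra h
      exact hr (Set.mem_iUnion.2 ⟨n, hn, h⟩)
  rw [this]
  exact hK.diff (isOpen_iUnion fun n => (isOpen_cell k n).sdiff (hF n))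

lemma exists_add_lt_two_pow {δ : ℝ} (hδ : 0 < δ) (R : ℝ) :
    ∃ M : ℕ, ∀ m ≥ M, (m : ℝ) + R < 2 ^ m * δ := by
  have h1 : Tendsto (fun m : ℕ => (m : ℝ) / 2 ^ m) atTop (𝓝 0) := by
    simpa using tendsto_pow_const_div_const_pow_of_one_lt 1 (show (1 : ℝ) < 2 by norm_num)
  have h2 : Tendsto (fun m : ℕ => R / (2 : ℝ) ^ m) atTop (𝓝 0) :=
    tendsto_const_nhds.div_atTop (tendsto_pow_atTop_atTop_of_one_lt (by norm_num))
  have h3 := h1.add h2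
  rw [add_zero] at h3
  obtain ⟨M, hM⟩ := eventually_atTop.1 (h3.eventually (eventually_lt_nhds hδ))
  refine ⟨M, fun m hm => ?_⟩
  have h4 := hM m hm
  rw [← add_div, div_lt_iff₀ (by positivity)] at h4
  linarith

/-- The first active zone whose lower bound holds also satisfies its upper bound: if the previous
zone is active, its lower bound fails, so the new coordinate is below (9/8 − 13/20) gap + 1/8. This
is less than 13/20 gap since the gap exceeds 7. Here the ratio 9/8 of consecutive levels matters. -/
lemma exists_mem_closedZone {r : Fin d → ℝ} (hr : r ∈ cellDomain k) :
    ∃ m, r ∈ closedZone i k m := by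
  classical
  obtain ⟨n, hn⟩ := exists_mem_cell hr
  have hex : ∃ m, Active m n ∧ -(13 / 20 * gap m n) ≤ zoneCoord i k m r := by
    obtain ⟨m, hm⟩ := exists_add_lt_two_pow (hr.1 k) (10 + r i)
    have h1 := hm m le_rfl
    have h2 : (2 : ℝ) ^ m * r k < 2 ^ m * level (n + 1) :=
      mul_lt_mul_of_pos_left hn.2.2 (by positivity)
    have hact : Active m n := by
      unfold Active
      linarith [hr.1 i]
    refine ⟨m, hact, ?_⟩
    have h3 := hact.gap_gt
    unfold zoneCoord
    linarith
  obtain ⟨h1, h2⟩ := Nat.find_spec hex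
  refine ⟨Nat.find hex, n, hn, h1, h2, fun m' hm' hact => ?_⟩
  have h3 := Nat.find_min hex (show m' < Nat.find hex by omega)
  rw [← hm', zoneCoord_succ]
  have h4 : zoneCoord i k m' r < -(13 / 20 * gap m' n) := by
    by_contra h
    exact h3 ⟨hact, not_lt.1 h⟩
  linarith [lt_gap (m := m') hn, hact.gap_gt]

lemma disjoint_openZone {m m' : ℕ} (h : m + 2 ≤ m') :
    Disjoint (openZone i k m) (openZone i k m') := by
  refine Set.disjoint_left.2 fun r hr hr' => ?_
  linarith [one_lt_zoneCoord hr (show m < m + 1 by omega),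
    zoneCoord_neg hr' (show m + 1 < m' by omega)]

lemma exists_bound_closedZone {K : Set (Fin d → ℝ)} (hK : IsCompact K) (hKD : K ⊆ cellDomain k) :
    ∃ M, ∀ m, (closedZone i k m ∩ K).Nonempty → m < M := by
  obtain ⟨j, hj⟩ := exists_subset_cellExhaustion k hK hKD
  obtain ⟨M, hM⟩ := exists_add_lt_two_pow (show 0 < ((j : ℝ) + 1)⁻¹ by positivity)
    (10 + ((j : ℝ) + 1))
  refine ⟨M + 1, fun m ⟨r, hr, hrK⟩ => ?_⟩
  by_contra h
  have h1 := hM (m - 1) (by omega)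
  -- In the m-th zone the previous coordinate is negative, so `2 ^ (m - 1) * r k` is bounded
  -- linearly in `m` over a compact set, where `r k` is bounded below.
  have h2 := zoneCoord_neg (closedZone_subset m hr) (show m - 1 < m by omega)
  have h3 := (hj hrK).1
  have h4 := mul_le_mul_of_nonneg_left (h3 k).1 (show (0 : ℝ) ≤ 2 ^ (m - 1) by positivity)
  unfold zoneCoord at h2
  linarith [(h3 i).2]

lemma lineInvariant_openZone {m : ℕ} {κ : Fin d → ℤ} (hκ : κ i = 2 ^ m * κ k) :
    LineInvariant (cellDomain k) κ (openZone i k m) := by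
  rintro ρ ⟨n, hn, h⟩ t ht
  refine ⟨n, lineIn_mem_cell ht hn, ?_⟩
  rw [zoneCoord_line i k hκ, sub_self, zero_mul, mul_zero, add_zero]
  exact h

lemma lineInvariant_closedZone {m : ℕ} {κ : Fin d → ℤ} (hκ : κ i = 2 ^ m * κ k) :
    LineInvariant (cellDomain k) κ (closedZone i k m) := by
  rintro ρ ⟨n, hn, h⟩ t ht
  refine ⟨n, lineIn_mem_cell ht hn, ?_⟩
  rw [zoneCoord_line i k hκ, sub_self, zero_mul, mul_zero, add_zero]
  exact h

end Zones

/-! ### Integrable Hamiltonians with an independent frequency shift in each zone. -/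

section ZoneHamiltonians

variable {d : ℕ} (i k : Fin d)

/-- A function whose derivative along the resonant lines of the `p`-th zone is constant, and
vanishes if `m < p`. -/
def zoneStep (m : ℕ) (r : Fin d → ℝ) : ℝ :=
  (ramp (zoneCoord i k (m + 1) r) - ramp (zoneCoord i k m r)) / 2 ^ m

lemma contDiff_zoneStep (m : ℕ) : ContDiff ℝ ∞ (zoneStep i k m) :=
  ((contDiff_ramp.comp (contDiff_zoneCoord i k (m + 1))).sub
    (contDiff_ramp.comp (contDiff_zoneCoord i k m))).div_const _

lemma zoneStep_eventually_eq_zero (m : ℕ) : ∀ᶠ r in 𝓝 0, zoneStep i k m r = 0 := by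
  have h : ∀ m, ∀ᶠ r in 𝓝 0, ramp (zoneCoord i k m r) = 0 := fun m => by
    have h0 : zoneCoord i k m 0 < 0 := by
      simp only [zoneCoord, Pi.zero_apply]
      linarith [Nat.cast_nonneg (α := ℝ) m]
    exact ((continuous_zoneCoord i k m).tendsto 0).eventually (eventually_lt_nhds h0) |>.mono
      fun r hr => ramp_of_nonpos hr.le
  filter_upwards [h m, h (m + 1)] with r h1 h2
  rw [zoneStep, h1, h2, sub_zero, zero_div]

variable {i k}

/-- In the p-th zone the ramp is zero for `m < p` and equal to its argument for `m > p`. Its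
nonlinear part can only matter for `m = p`, where the argument is constant along κ. -/
lemma hasDerivAt_ramp_zoneCoord {p : ℕ} {κ : Fin d → ℤ} (hκ : κ i = 2 ^ p * κ k) {r : Fin d → ℝ}
    (hr : r ∈ openZone i k p) (m : ℕ) :
    HasDerivAt (fun s : ℝ => ramp (zoneCoord i k m (r + s • fun x => (κ x : ℝ))))
      (if p ≤ m then (2 ^ m - 2 ^ p) * κ k else 0) 0 := by
  simp only [zoneCoord_line i k hκ]
  have h1 : HasDerivAt (fun s : ℝ => zoneCoord i k m r + s * ((2 ^ m - 2 ^ p) * κ k))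
      ((2 ^ m - 2 ^ p) * κ k) 0 := by
    simpa using ((hasDerivAt_id (0 : ℝ)).mul_const (((2 : ℝ) ^ m - 2 ^ p) * κ k)).const_add
      (zoneCoord i k m r)
  have h0 : zoneCoord i k m r + 0 * ((2 ^ m - 2 ^ p) * κ k) = zoneCoord i k m r := by ring
  rcases lt_trichotomy m p with h | h | h
  · rw [if_neg (by omega)]
    have h2 := hasDerivAt_ramp_of_neg (zoneCoord_neg hr h)
    rw [← h0] at h2
    simpa [Function.comp_def] using h2.comp 0 h1
  · subst h
    simpa using hasDerivAt_const (0 : ℝ) (ramp (zoneCoord i k m r))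
  · rw [if_pos h.le]
    have h2 := hasDerivAt_ramp_of_one_lt (one_lt_zoneCoord hr h)
    rw [← h0] at h2
    simpa [Function.comp_def] using h2.comp 0 h1

lemma sum_mul_grad_zoneStep {p : ℕ} {κ : Fin d → ℤ} (hκ : κ i = 2 ^ p * κ k) {r : Fin d → ℝ}
    (hr : r ∈ openZone i k p) (m : ℕ) :
    ∑ x, κ x * grad (zoneStep i k m) r x = if p ≤ m then (κ k : ℝ) else 0 := by
  refine sum_mul_grad_eq (v := fun x => (κ x : ℝ))
    ((contDiff_zoneStep i k m).differentiable (by simp)).differentiableAt ?_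
  have hval : (if p ≤ m then (κ k : ℝ) else 0) =
      ((if p ≤ m + 1 then (2 ^ (m + 1) - 2 ^ p) * (κ k : ℝ) else 0) -
        if p ≤ m then (2 ^ m - 2 ^ p) * (κ k : ℝ) else 0) / 2 ^ m := by
    rcases Nat.lt_or_ge m p with h | h
    · rcases Nat.lt_or_ge (m + 1) p with h' | h'
      · simp [h.not_ge, h'.not_ge]
      · obtain rfl : p = m + 1 := by omega
        simp
    · rw [if_pos h, if_pos (by omega), if_pos h, pow_succ]
      field_simp
      ring
  rw [hval]
  exact ((hasDerivAt_ramp_zoneCoord hκ hr (m + 1)).sub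
    (hasDerivAt_ramp_zoneCoord hκ hr m)).div_const ((2 : ℝ) ^ m)

variable (i k)

/-- The Hamiltonian `⟨ω₀, r⟩ + ∑ (T_m - T_{m+1}) b_m`; in the `m`-th zone, `T_m` shifts the
frequency along the resonant lines. -/
def zoneHam (ω₀ : Fin d → ℝ) (N : ℕ) (T : ℕ → ℝ) (r : Fin d → ℝ) : ℝ :=
  ∑ x, ω₀ x * r x + ∑ m ∈ Finset.range N, (T m - T (m + 1)) * zoneStep i k m r

variable {i k} {ω₀ : Fin d → ℝ}

lemma zoneHam_eq_perturbed (N : ℕ) (T : ℕ → ℝ) :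
    zoneHam i k ω₀ N T = perturbed (fun r => ∑ x, ω₀ x * r x)
      (fun m : Fin N => zoneStep i k m) (fun m => T m - T (m + 1)) := by
  funext r
  rw [zoneHam, perturbed, Fin.sum_univ_eq_sum_range
    (fun m => (T m - T (m + 1)) * zoneStep i k m r) N]

lemma contDiff_zoneHam (N : ℕ) (T : ℕ → ℝ) : ContDiff ℝ ∞ (zoneHam i k ω₀ N T) := by
  rw [zoneHam_eq_perturbed]
  exact contDiff_perturbed (by fun_prop) (fun m => contDiff_zoneStep i k m) _

lemma zoneHam_of_le {N N' : ℕ} {T : ℕ → ℝ} (hT : ∀ m ≥ N, T m = 0) (hN : N ≤ N') :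
    zoneHam i k ω₀ N T = zoneHam i k ω₀ N' T := by
  funext r
  rw [zoneHam, zoneHam]
  congr 1
  refine Finset.sum_subset (Finset.range_mono hN) fun m _ hm => ?_
  rw [Finset.mem_range, not_lt] at hm
  rw [hT m hm, hT (m + 1) (by omega), sub_self, zero_mul]

lemma sum_range_sub_ite (T : ℕ → ℝ) (p N : ℕ) :
    ∑ m ∈ Finset.range N, (if p ≤ m then T m - T (m + 1) else 0) =
      if p ≤ N then T p - T N else 0 := by
  induction N with
  | zero =>
    split_ifs with h
    · obtain rfl : p = 0 := by omega
      simp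
    · simp
  | succ N ih =>
    rw [Finset.sum_range_succ, ih]
    rcases lt_trichotomy p (N + 1) with h | h | h
    · rw [if_pos (by omega), if_pos (by omega), if_pos h.le]
      ring
    · subst h
      simp
    · rw [if_neg (by omega), if_neg (by omega), if_neg (by omega), add_zero]

/-- Only the steps with `m ≥ p` contribute, each with the factor `κ k`, and the differences
telescope to `T p`. The resonance condition of a zone thus depends on its own parameter only and is
uniform over the zone. -/
lemma sum_mul_grad_zoneHam {N : ℕ} {T : ℕ → ℝ} (hT : ∀ m ≥ N, T m = 0) {p : ℕ}
    {κ : Fin d → ℤ} (hκ : κ i = 2 ^ p * κ k) {r : Fin d → ℝ} (hr : r ∈ openZone i k p) :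
    ∑ x, κ x * grad (zoneHam i k ω₀ N T) r x = ∑ x, κ x * ω₀ x + κ k * T p := by
  have hlin : ∑ x, κ x * grad (fun r => ∑ x, ω₀ x * r x) r x = ∑ x, κ x * ω₀ x := by
    refine sum_mul_grad_eq (v := fun x => (κ x : ℝ)) (by fun_prop) ?_
    have h1 : (fun s : ℝ => ∑ x, ω₀ x * (r + s • fun x => (κ x : ℝ)) x) =
        fun s => ∑ x, ω₀ x * r x + s * ∑ x, κ x * ω₀ x := by
      funext s
      rw [Finset.mul_sum, ← Finset.sum_add_distrib]
      refine Finset.sum_congr rfl fun x _ => ?_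
      simp only [Pi.add_apply, Pi.smul_apply, smul_eq_mul]
      ring
    rw [h1]
    simpa using ((hasDerivAt_id (0 : ℝ)).mul_const (∑ x, (κ x : ℝ) * ω₀ x)).const_add
      (∑ x, ω₀ x * r x)
  rw [zoneHam_eq_perturbed, grad_perturbed (by fun_prop) (fun m => contDiff_zoneStep i k m)]
  simp only [Pi.add_apply, Finset.sum_apply, Pi.smul_apply, smul_eq_mul, mul_add,
    Finset.sum_add_distrib, hlin, Finset.mul_sum]
  rw [Finset.sum_comm]
  congr 1
  have h2 : ∀ m : Fin N, ∑ x, (κ x : ℝ) * ((T m - T (m + 1)) * grad (zoneStep i k m) r x) =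
      κ k * (if p ≤ (m : ℕ) then T m - T (m + 1) else 0) := fun m => by
    have h3 : ∑ x, (κ x : ℝ) * ((T m - T (m + 1)) * grad (zoneStep i k m) r x) =
        (T m - T (m + 1)) * ∑ x, κ x * grad (zoneStep i k m) r x := by
      rw [Finset.mul_sum]
      exact Finset.sum_congr rfl fun x _ => by ring
    rw [h3, sum_mul_grad_zoneStep hκ hr]
    split_ifs <;> ring
  rw [Finset.sum_congr rfl fun m _ => h2 m, ← Finset.mul_sum,
    Fin.sum_univ_eq_sum_range (fun m => if p ≤ m then T m - T (m + 1) else 0) N,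
    sum_range_sub_ite]
  congr 1
  split_ifs with h
  · rw [hT N le_rfl, sub_zero]
  · exact (hT p (by omega)).symm

/-- Arbitrarily close to a given shift there is another one, for which the frequencies are
resonant. -/
lemma exists_resonant_shift {a w t η : ℝ} (hw : w ≠ 0) (ht : |t| < 1) (hη : 0 < η) :
    ∃ (t' : ℝ) (q : ℚ), |t' - t| < η ∧ |t'| < 1 ∧ t' ≠ t ∧ w * q = a + t' := by
  have hlt := abs_lt.1 ht
  have hm : t < min (t + η) 1 := lt_min (by linarith) hlt.2
  have hopen : IsOpen ((fun x => w * x - a) ⁻¹' Set.Ioo t (min (t + η) 1)) :=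
    isOpen_Ioo.preimage (by fun_prop)
  obtain ⟨y, hy⟩ := exists_between hm
  have hne : ((fun x => w * x - a) ⁻¹' Set.Ioo t (min (t + η) 1)).Nonempty := by
    refine ⟨(y + a) / w, ?_⟩
    rw [Set.mem_preimage, mul_div_cancel₀ _ hw, add_sub_cancel_right]
    exact hy
  obtain ⟨q, hq1, hq2⟩ := (Rat.denseRange_cast (𝕜 := ℝ)).exists_mem_open hopen hne
  have h1 := hq2.trans_le (min_le_left _ _)
  have h2 := hq2.trans_le (min_le_right _ _)
  refine ⟨w * q - a, q, ?_, ?_, hq1.ne', by ring⟩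
  · rw [abs_lt]
    constructor <;> linarith
  · rw [abs_lt]
    constructor <;> linarith [hlt.1]

lemma exists_resonant_shifts {w : ℝ} (hw : w ≠ 0) (a : ℕ → ℝ) {N : ℕ} {T : ℕ → ℝ}
    (hT : ∀ m, |T m| < 1) (hT0 : ∀ m ≥ N, T m = 0) {η : ℝ} (hη : 0 < η) :
    ∃ (T' : ℕ → ℝ) (q : ℕ → ℚ), (∀ m, |T' m - T m| < η) ∧ (∀ m, |T' m| < 1) ∧
      (∀ m ≥ N, T' m = 0) ∧ ∀ m < N, T' m ≠ T m ∧ w * q m = a m + T' m := by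
  choose T' q h1 h2 h3 h4 using fun m => exists_resonant_shift (a := a m) hw (hT m) hη
  refine ⟨fun m => if m < N then T' m else 0, q, fun m => ?_, fun m => ?_, fun m hm => ?_,
    fun m hm => ?_⟩
  · by_cases h : m < N
    · simp only [if_pos h, h1]
    · simpa only [if_neg h, hT0 m (not_lt.1 h), sub_zero, abs_zero]
  · by_cases h : m < N
    · simp only [if_pos h, h2]
    · simp [if_neg h]
  · exact if_neg (not_lt.2 hm)
  · simp only [if_pos hm]
    exact ⟨h3 m, h4 m⟩

end ZoneHamiltonians

/-! ### The zone system for a nonzero frequency, and diffusion. -/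

section Resonant

variable {i j k : Fin 3}

lemma sum_fin_three (hij : i ≠ j) (hik : i ≠ k) (hjk : j ≠ k) (f : Fin 3 → ℝ) :
    ∑ x, f x = f i + f j + f k := by
  have h : ∀ i j k : Fin 3, i ≠ j → i ≠ k → j ≠ k → Finset.univ = {i, j, k} := by decide
  rw [h i j k hij hik hjk, Finset.sum_insert (by simp [hij, hik]), Finset.sum_insert (by simp [hjk]),
    Finset.sum_singleton, add_assoc]

lemma eq_of_fin_three (hij : i ≠ j) (hik : i ≠ k) (hjk : j ≠ k) (x : Fin 3) :
    x = i ∨ x = j ∨ x = k := by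
  have h : ∀ i j k : Fin 3, i ≠ j → i ≠ k → j ≠ k → ∀ x, x = i ∨ x = j ∨ x = k := by decide
  exact h i j k hij hik hjk x

variable (i j k) in
/-- The integer directions that are used in the `m`-th zone. -/
def zoneDir (ω₀ : Fin 3 → ℝ) (m : ℕ) : Set (Fin 3 → ℤ) :=
  {κ | 0 < κ k ∧ κ i = 2 ^ m * κ k ∧
    (ω₀ i * ω₀ j < 0 → |ω₀ k| + 1 ≤ 2 ^ m * |ω₀ i| → 0 ≤ κ j)}

/-- If the frequencies `ω_i`, `ω_j` have opposite signs and `ω_i` dominates, then so do the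
components of the resonance. -/
lemma resonance_nonpos {a b c t : ℝ} {q : ℚ} (hab : a * b < 0) (ht : |t| < 1) {m : ℕ}
    (hm : |c| + 1 ≤ 2 ^ m * |a|) (hq : b * q = 2 ^ m * a + c + t) : q ≤ 0 := by
  have h1 := abs_lt.1 ht
  have h2 := neg_abs_le c
  have h3 := le_abs_self c
  by_contra hq0
  have hq0' : (0 : ℝ) < q := by exact_mod_cast not_le.1 hq0
  rcases mul_neg_iff.1 hab with ⟨ha, hb⟩ | ⟨ha, hb⟩
  · rw [abs_of_pos ha] at hm
    nlinarith [mul_neg_of_neg_of_pos hb hq0']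
  · rw [abs_of_neg ha] at hm
    nlinarith [mul_pos hb hq0']

/-- The zone system for a frequency vector with `ω_j ≠ 0`. -/
def resonantZones (ω₀ : Fin 3 → ℝ) (i j k : Fin 3) (hij : i ≠ j) (hik : i ≠ k) (hjk : j ≠ k)
    (hω : ω₀ j ≠ 0) : ZoneSystem 3 where
  D := cellDomain k
  pos r hr := hr.1
  zero_notMem h := lt_irrefl _ (h.1 k)
  Q := cellExhaustion k
  isCompact_Q := isCompact_cellExhaustion k
  Q_subset := cellExhaustion_subset k
  monotone_Q := monotone_cellExhaustion k
  exists_subset_Q _ hK hKD := exists_subset_cellExhaustion k hK hKD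
  lineIn_Q := lineIn_cellExhaustion k
  O := openZone i k
  C := closedZone i k
  isOpen_O := isOpen_openZone
  O_subset := openZone_subset
  C_subset := closedZone_subset
  isCompact_C_inter m _ hK hKD := isCompact_closedZone_inter m hK hKD
  cover _ hr := exists_mem_closedZone hr
  disjoint_O m m' hne hmod := by
    rcases lt_or_gt_of_ne hne with h | h
    · exact disjoint_openZone (by omega)
    · exact (disjoint_openZone (by omega)).symm
  finite_C _ hK hKD := exists_bound_closedZone hK hKD
  dir := zoneDir i j k ω₀
  dir_ne m κ hκ h := by
    have := hκ.1
    simp [h] at this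
  inv_O m κ hκ := lineInvariant_openZone hκ.2.1
  inv_C m κ hκ := lineInvariant_closedZone hκ.2.1
  Adm h := ∃ N T, (∀ m ≥ N, T m = 0) ∧ (∀ m, |T m| < 1) ∧ h = zoneHam i k ω₀ N T
  contDiff_of_adm h := by
    rintro ⟨N, T, -, -, rfl⟩
    exact contDiff_zoneHam N T
  perturb := by
    rintro h ⟨N₀, T, hT0', hT, rfl⟩ M M' kv hkv
    obtain ⟨N, hN0, hNM, hNM'⟩ : ∃ N, N₀ ≤ N ∧ M ≤ N ∧ M' ≤ N :=
      ⟨N₀ + M + M', by omega, by omega, by omega⟩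
    have hT0 : ∀ m ≥ N, T m = 0 := fun m hm => hT0' m (hN0.trans hm)
    rw [zoneHam_of_le hT0' hN0] at hkv ⊢
    refine ⟨N, fun m => zoneStep i k m, fun m => contDiff_zoneStep i k m, fun m => ?_,
      fun η hη => ?_⟩
    · exact (Asymptotics.isBigO_zero _ _).congr'
        ((zoneStep_eventually_eq_zero i k m).mono fun r hr => hr.symm) EventuallyEq.rfl
    obtain ⟨T', q, hT'T, hT', hT'0, hq⟩ := exists_resonant_shifts hω
      (fun m => 2 ^ m * ω₀ i + ω₀ k) hT hT0 (show 0 < η / 2 by linarith)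
    have hpert : perturbed (zoneHam i k ω₀ N T) (fun m : Fin N => zoneStep i k m)
        (fun m => (T' m - T m) - (T' (m + 1) - T (m + 1))) = zoneHam i k ω₀ N T' := by
      funext r
      rw [zoneHam_eq_perturbed, zoneHam_eq_perturbed]
      simp only [perturbed]
      rw [add_assoc, ← Finset.sum_add_distrib]
      congr 1
      exact Finset.sum_congr rfl fun m _ => by ring
    refine ⟨_, ?_, ⟨N, T', hT'0, hT', hpert⟩, ?_, ?_⟩
    · rw [pi_norm_lt_iff hη]
      intro m
      rw [Real.norm_eq_abs]
      refine (abs_sub _ _).trans_lt ?_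
      linarith [hT'T m, hT'T (m + 1)]
    -- The direction is the denominator of `q m` times (1, 2^m, −q m) in the coordinates `k`, `i`,
    -- `j`; the equation for `q m` is its resonance. By `resonance_nonpos` its `j`-entry is
    -- nonnegative when the signs require it.
    · refine ⟨fun m x => if x = k then ((q m).den : ℤ) else if x = i then 2 ^ m * (q m).den else
        -(q m).num, fun m hm => ⟨⟨?_, ?_, fun h1 h2 => ?_⟩, fun r hr => ?_⟩⟩
      · simpa using (q m).den_pos
      · simp [hik]
      · have := resonance_nonpos h1 (hT' m) h2 (hq m (by omega)).2
        simp [hij.symm, hjk, this]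
      · rw [hpert, sum_mul_grad_zoneHam hT'0 (p := m) (by simp [hik]) hr,
          sum_fin_three hij hik hjk]
        have h1 : (q m : ℝ) * (q m).den = (q m).num := by
          exact_mod_cast Rat.mul_den_eq_num (q m)
        have h2 := (hq m (by omega)).2
        simp only [if_pos, if_neg hij.symm, if_neg hik, if_neg hjk]
        push_cast
        linear_combination ω₀ j * h1 - (q m).den * h2
    · intro m hm r hr
      obtain ⟨hκ, hres⟩ := hkv m hm
      have hrO := closedZone_subset m hr
      have h0 := hres r hrO
      rw [sum_mul_grad_zoneHam hT0 hκ.2.1 hrO] at h0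
      rw [hpert, sum_mul_grad_zoneHam hT'0 hκ.2.1 hrO]
      have h1 : ∑ x, (kv m x : ℝ) * ω₀ x + kv m k * T' m = kv m k * (T' m - T m) := by
        linear_combination h0
      rw [h1]
      exact mul_ne_zero (by exact_mod_cast hκ.1.ne') (sub_ne_zero.2 (hq m (by omega)).1)

/-- For large `m`, take the lowest zone active in a cell where `level n` is about `(m + 10) / 2 ^
m`. The cell is so close to zero that `K` lies above it. The room left to `r k` is of order `m / 2 ^
m`, hence allows `r i` to grow by an amount of order `m`, beyond `A ^ 2`. -/
lemma drift_resonantZones {ω₀ : Fin 3 → ℝ} (hij : i ≠ j) (hik : i ≠ k) (hjk : j ≠ k)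
    (hω : ω₀ j ≠ 0) (hneg : ω₀ i * ω₀ j < 0) :
    (resonantZones ω₀ i j k hij hik hjk hω).Drift := by
  intro A hA K hK hKD m₀
  obtain ⟨j₀, hj₀⟩ := exists_subset_cellExhaustion k hK hKD
  have hωi : 0 < |ω₀ i| := abs_pos.2 (left_ne_zero_of_mul hneg.ne)
  obtain ⟨ε, hε, hε1, hεA, hεK⟩ : ∃ ε : ℝ, 0 < ε ∧ ε ≤ 1 ∧ 7 * ε ≤ A⁻¹ ^ 2 ∧
      9 / 8 * ε ≤ ((j₀ : ℝ) + 1)⁻¹ := by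
    refine ⟨min 1 (min (A⁻¹ ^ 2 / 7) (((j₀ : ℝ) + 1)⁻¹ / 2)), by positivity, min_le_left _ _, ?_, ?_⟩
    · have := (min_le_right 1 (min (A⁻¹ ^ 2 / 7) (((j₀ : ℝ) + 1)⁻¹ / 2))).trans (min_le_left _ _)
      linarith
    · have := (min_le_right 1 (min (A⁻¹ ^ 2 / 7) (((j₀ : ℝ) + 1)⁻¹ / 2))).trans (min_le_right _ _)
      have h2 : 0 < ((j₀ : ℝ) + 1)⁻¹ := by positivity
      linarith
  obtain ⟨M₁, hM₁⟩ := exists_add_lt_two_pow hε 10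
  obtain ⟨M₂, hM₂⟩ := exists_add_lt_two_pow hωi (|ω₀ k| + 1)
  -- As `2 ^ m * level n > 8/9 * (m + 10)`, this gives `A ^ 2 / 2 ^ m < level n / 16`, the distance
  -- from `ρ k` to the top of the cell.
  obtain ⟨M₃, hM₃⟩ := exists_nat_gt (18 * A ^ 2)
  obtain ⟨m, hmod, hm1, hm2, hm3⟩ : ∃ m, m % 2 = m₀ % 2 ∧ M₁ ≤ m ∧ M₂ ≤ m ∧ M₃ ≤ m :=
    ⟨m₀ + 2 * (M₁ + M₂ + M₃), by omega, by omega, by omega, by omega⟩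
  have hm0 : (0 : ℝ) ≤ m := Nat.cast_nonneg m
  have hP : (0 : ℝ) < 2 ^ m := by positivity
  have h1 := hM₁ m hm1
  have h2 := hM₂ m hm2
  have h3 : 18 * A ^ 2 < m := hM₃.trans_le (by exact_mod_cast hm3)
  obtain ⟨n, hn1, hn2⟩ := exists_level_le (show 0 < ((m : ℝ) + 10) / 2 ^ m by positivity)
  rw [le_div_iff₀ hP] at hn1
  rw [div_lt_iff₀ hP] at hn2
  have hl := level_pos n
  have hls := level_succ n
  have hlε : level n ≤ ε := by
    by_contra h
    have := mul_lt_mul_of_pos_right (not_le.1 h) hP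
    linarith
  have hact : Active m n := by
    unfold Active
    linarith
  rw [hls] at hn2
  let ρ : Fin 3 → ℝ := fun x => if x = k then 17 / 16 * level n else level n
  have hρk : ρ k = 17 / 16 * level n := if_pos rfl
  have hρi : ρ i = level n := if_neg hik
  have hρj : ρ j = level n := if_neg hjk
  have hρcell : ρ ∈ cell k n := by
    refine ⟨fun x => ?_, by linarith, by linarith⟩
    rcases eq_of_fin_three hij hik hjk x with rfl | rfl | rfl <;> linarith
  let τ : Fin 3 → ℝ := fun x => if x = k then ρ k + A ^ 2 / 2 ^ m else A ^ 2
  have hτk : τ k = ρ k + A ^ 2 / 2 ^ m := if_pos rfl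
  have hAm : A ^ 2 / 2 ^ m < level n / 16 := by
    rw [div_lt_iff₀ hP]
    linarith
  refine ⟨m, hmod, ρ, ⟨n, hρcell, hact, ?_, fun m' hm' hact' => ?_⟩, ?_, Set.Icc ρ τ,
    isCompact_Icc, fun r hr => ?_, fun κ hκ => ?_⟩
  · simp only [zoneCoord, hρk, hρi, gap]
    linarith
  -- The previous zone is not active in this cell: `2 ^ m * level n ≤ m + 10` gives `2 ^ (m - 1) *
  -- level (n + 1) ≤ 9/16 * (m + 10)`, less than `m + 9`. So no upper bound has to be checked.
  · exfalso
    unfold Active at hact'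
    subst hm'
    rw [pow_succ] at hn1
    rw [hls] at hact'
    push_cast at hn1
    linarith [Nat.cast_nonneg (α := ℝ) m']
  · rw [sum_fin_three hij hik hjk, hρi, hρj, hρk]
    linarith
  · refine cell_subset n ⟨fun x => (hρcell.1 x).trans_le (hr.1 x), ?_, ?_⟩
    · exact hρcell.2.1.trans_le (hr.1 k)
    · have := hr.2 k
      rw [hτk, hρk] at this
      linarith
  · obtain ⟨hκk, hκi, hκj⟩ := hκ
    have hκj' := hκj hneg (by linarith)
    have hpos : ∀ x, 0 ≤ κ x := fun x => by
      rcases eq_of_fin_three hij hik hjk x with rfl | rfl | rfl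
      · rw [hκi]; positivity
      · exact hκj'
      · exact hκk.le
    refine ⟨hpos, fun t ht => ⟨fun hmem => ?_, fun ht0 hsum => ?_⟩⟩
    · have h4 := (lineIn_mem_cell ht hρcell).2.2
      have h5 := ((hj₀ hmem).1 k).1
      linarith
    · have hge : ∀ x, 0 ≤ t * κ x := fun x => mul_nonneg ht0 (by exact_mod_cast hpos x)
      rw [sum_fin_three hij hik hjk] at hsum
      simp only [Pi.add_apply, Pi.smul_apply, smul_eq_mul] at hsum
      have hri := hρcell.1 i
      have hrj := hρcell.1 j
      have hrk := hρcell.1 k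
      refine ⟨fun x => ?_, fun x => ?_⟩
      · simp only [Pi.add_apply, Pi.smul_apply, smul_eq_mul]
        linarith [hge x]
      · simp only [Pi.add_apply, Pi.smul_apply, smul_eq_mul]
        rcases eq_of_fin_three hij hik hjk x with rfl | rfl | rfl
        · rw [show τ x = A ^ 2 from if_neg hik]
          linarith [hge j, hge k]
        · rw [show τ x = A ^ 2 from if_neg hjk]
          linarith [hge i, hge k]
        · rw [hτk]
          have h6 : t * κ x ≤ A ^ 2 / 2 ^ m := by
            rw [le_div_iff₀ hP]
            have h7 : t * (κ i : ℝ) = t * κ x * 2 ^ m := by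
              rw [hκi]
              push_cast
              ring
            linarith [hge j, hge x]
          linarith

end Resonant

end

theorem theoremB (ω₀ : Fin 3 → ℝ) (k : Fin 3) :
    ∃ (H : Phase 3 → ℝ) (Φ : ℝ → Phase 3 → Phase 3) (a : ℤ → ℝ),
      ContDiff ℝ ∞ H ∧
      IsEllipticWithFrequency ω₀ H ∧
      IsHamiltonianFlow H Φ ∧
      StrictMono a ∧ (∀ n, 0 < a n) ∧
      Tendsto a atBot (𝓝 0) ∧ Tendsto a atTop atTop ∧
      (∀ n, FoliatedByInvariantTori Φ {z | action z k = a n}) ∧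
      (∀ i, FoliatedByInvariantTori Φ {z | action z i = 0}) ∧
      (∀ z, z ∉ exceptionalSet k a →
        AccumulatesOn Φ z (exceptionalSet k a) ∨ AccumulatesAtInfinity Φ z) ∧
      ¬ IsKAMStable Φ ∧
      ((∃ i j, i ≠ k ∧ j ≠ k ∧ ω₀ i * ω₀ j < 0) → IsDiffusive Φ) := by
  suffices h : ∃ (Z : ZoneSystem 3) (h₀ : (Fin 3 → ℝ) → ℝ), Z.D = cellDomain k ∧ Z.Adm h₀ ∧
      ((fun r => h₀ r - ∑ i, ω₀ i * r i) =O[𝓝 0] fun r => ‖r‖ ^ 2) ∧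
      ((∃ i j, i ≠ k ∧ j ≠ k ∧ ω₀ i * ω₀ j < 0) → Z.Drift) by
    obtain ⟨Z, h₀, hD, hadm, h0, hdrift⟩ := h
    obtain ⟨H, Φ, h1, h2, h3, h4, h5, h6, h7, h8⟩ := Z.exists_of_cellDomain hD hadm h0
    exact ⟨H, Φ, level, h1, h2, h3, strictMono_level, level_pos, tendsto_level_atBot,
      tendsto_level_atTop, h4, h5, h6, h7, fun h => h8 (hdrift h)⟩
  have hlin : ∀ i : Fin 3, ((fun r => zoneHam i k ω₀ 0 0 r - ∑ i, ω₀ i * r i) =O[𝓝 0]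
      fun r => ‖r‖ ^ 2) := fun i => by
    simpa [zoneHam] using Asymptotics.isBigO_zero _ _
  by_cases hneg : ∃ i j, i ≠ k ∧ j ≠ k ∧ ω₀ i * ω₀ j < 0
  · obtain ⟨i, j, hik, hjk, hlt⟩ := hneg
    have hij : i ≠ j := by
      rintro rfl
      exact absurd hlt (not_lt.2 (mul_self_nonneg _))
    have hω : ω₀ j ≠ 0 := right_ne_zero_of_mul hlt.ne
    exact ⟨resonantZones ω₀ i j k hij hik hjk hω, _, rfl, ⟨0, 0, by simp, by simp, rfl⟩, hlin i,
      fun _ => drift_resonantZones hij hik hjk hω hlt⟩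
  obtain ⟨i, j, hij, hik, hjk⟩ : ∃ i j : Fin 3, i ≠ j ∧ i ≠ k ∧ j ≠ k := by
    have h : ∀ k : Fin 3, ∃ i j : Fin 3, i ≠ j ∧ i ≠ k ∧ j ≠ k := by decide
    exact h k
  -- The resonance is solved for `κ j`, so the index playing the role of `j` must have nonzero
  -- frequency; the roles of the two indices may be exchanged.
  by_cases hj : ω₀ j = 0
  · by_cases hi : ω₀ i = 0
    · refine ⟨degenerateZones (ω₀ k) i j k hij hik hjk, degenerateHam (ω₀ k) i j k 0, rfl, ⟨0, rfl⟩,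
        ?_, fun h => absurd h hneg⟩
      convert isBigO_mul_coord k i using 2 with r
      rw [sum_fin_three hij hik hjk, hi, hj, degenerateHam]
      ring
    · exact ⟨resonantZones ω₀ j i k hij.symm hjk hik hi, _, rfl, ⟨0, 0, by simp, by simp, rfl⟩,
        hlin j, fun h => absurd h hneg⟩
  · exact ⟨resonantZones ω₀ i j k hij hik hjk hj, _, rfl, ⟨0, 0, by simp, by simp, rfl⟩,
      hlin i, fun h => absurd h hneg⟩
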